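/- **Theorem 3.** Let $\mathcal{C}$ be a (small) category with families (CwF) equipped with weakly stable weak identity types. Then there exist a CwF $\mathcal{D}$ equipped with strictly stable weak identity types and a strict CwF morphism $F : \mathcal{D} \to \mathcal{C}$ such that 1. $\mathcal{D}$ is $I$-cellular, i.e. freely generated by types and terms: the map from the initial CwF to $\mathcal{D}$ is the composition of an $\omega$-sequence of basic cellular maps, where a map $\mathcal{A} \to \mathcal{B}$ is basic cellular if it freely adjoins to $\mathcal{A}$ a set of new types (each over a context of $\mathcal{A}$) and of new terms (each of a type of $\mathcal{A}$ over a context of $\mathcal{A}$); 2. $F$ is a trivial fibration: for every context $\Gamma$ of $\mathcal{D}$, every type of $\mathcal{C}$ over $F(\Gamma)$ is $F(A_0)$ for some type $A_0$ over $\Gamma$, and for every type $A$ of $\mathcal{D}$ over $\Gamma$, every term of $\mathcal{C}$ of type $F(A)$ is $F(a_0)$ for some term $a_0$ of type $A$; 3. $F$ weakly preserves identity types: for every context $\Gamma$ of $\mathcal{D}$, type $A$ over $\Gamma$ and term $x : A$, the canonical map $\mathsf{Id}_{(F\Gamma,FA,Fx)} \to F(\mathsf{Id}_{(\Gamma,A,x)})$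 over $F(\Gamma.A)$, obtained by elimination from $F(\mathsf{refl}_{(\Gamma,A,x)})$, is an equivalence, i.e. it has an inverse over $F(\Gamma.A)$ up to the identity types of $\mathcal{C}$. Here weakly stable weak identity types on $\mathcal{C}$ consist of the following operations, with no compatibility with substitution required. For every context $\Gamma$, type $A$ and term $x : A$ over $\Gamma$: a type $\mathsf{Id}_{(\Gamma,A,x)}$ over $\Gamma.(y:A)$ and a term $\mathsf{refl}_{(\Gamma,A,x)}$ of type $\mathsf{Id}_{(\Gamma,A,x)}(x)$. For every substitution $\gamma : \Delta \to \Gamma$, type $P$ over $\Delta.(y:A[\gamma]).(p:\mathsf{Id}_{(\Gamma,A,x)}(\gamma,y))$ and term $d : P(x[\gamma],\mathsf{refl}_{(\Gamma,A,x)}[\gamma])$ over $\Delta$: a term $\mathsf{J}$ of type $P$, and a term $\mathsf{J}\beta$ over $\Delta$ of type $\mathsf{Id}_{(\Delta,P',d)}(\mathsf{J}(x[\gamma],\mathsf{refl}[\gamma]))$, where $P' = P(x[\gamma],\mathsf{refl}[\gamma])$. Strictly stable weak identity types on $\mathcal{D}$ consist of operations $\mathsf{Id}(A,x,y)$, $\mathsf{refl}(A,x)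 : \mathsf{Id}(A,x,x)$, $\mathsf{J}(A,x,P,d)$ of type $P$ over $\Gamma.(y:A).(p:\mathsf{Id}(A,x,y))$ for $d : P(x,\mathsf{refl}(A,x))$, and $\mathsf{J}\beta(A,x,P,d) : \mathsf{Id}(P(x,\mathsf{refl}), \mathsf{J}(x,\mathsf{refl}), d)$, all of which commute with substitution; in 3, $\mathsf{Id}_{(\Gamma,A,x)}$ is then the type $\mathsf{Id}(A,x,y)$ over $\Gamma.(y:A)$. -/

import Mathlib

open CategoryTheory

universe u

/-- A (small) category with families. The dependent presheaf of terms over the presheaf `Ty` of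
types is presented by its total presheaf `Tm` with the projection `tp : Tm → Ty`; the terms of
type `A` over `Γ` are the `a : Tm Γ` with `tp a = A`. Local representability of the terms is given
by the chosen context extensions `ext A`, with projection `p A`, variable `q A` and pairing. -/
structure CwF : Type (u + 1) where
  /-- contexts -/
  Ctx : Type u
  /-- substitutions -/
  [cat : Category.{u} Ctx]
  /-- the empty context -/
  nil : Ctx
  nilTerminal : Limits.IsTerminal nil
  Ty : Ctx → Type u
  /-- restriction of types -/
  tySub : ∀ {Δ Γ : Ctx}, (Δ ⟶ Γ) → Ty Γ → Ty Δ
  tySub_id : ∀ {Γ : Ctx} (A : Ty Γ), tySub (𝟙 Γ) A = A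
  tySub_comp : ∀ {Θ Δ Γ : Ctx} (τ : Θ ⟶ Δ) (σ : Δ ⟶ Γ) (A : Ty Γ),
    tySub (τ ≫ σ) A = tySub τ (tySub σ A)
  Tm : Ctx → Type u
  /-- restriction of terms -/
  tmSub : ∀ {Δ Γ : Ctx}, (Δ ⟶ Γ) → Tm Γ → Tm Δ
  tmSub_id : ∀ {Γ : Ctx} (a : Tm Γ), tmSub (𝟙 Γ) a = a
  tmSub_comp : ∀ {Θ Δ Γ : Ctx} (τ : Θ ⟶ Δ) (σ : Δ ⟶ Γ) (a : Tm Γ),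
    tmSub (τ ≫ σ) a = tmSub τ (tmSub σ a)
  /-- the type of a term -/
  tp : ∀ {Γ : Ctx}, Tm Γ → Ty Γ
  tp_sub : ∀ {Δ Γ : Ctx} (σ : Δ ⟶ Γ) (a : Tm Γ), tp (tmSub σ a) = tySub σ (tp a)
  /-- the extended context `Γ.A` -/
  ext : ∀ {Γ : Ctx}, Ty Γ → Ctx
  p : ∀ {Γ : Ctx} (A : Ty Γ), ext A ⟶ Γ
  q : ∀ {Γ : Ctx} (A : Ty Γ), Tm (ext A)
  tp_q : ∀ {Γ : Ctx} (A : Ty Γ), tp (q A) = tySub (p A) A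
  /-- the substitution `⟨σ, a⟩` -/
  pair : ∀ {Δ Γ : Ctx} {A : Ty Γ} (σ : Δ ⟶ Γ) (a : Tm Δ), tp a = tySub σ A → (Δ ⟶ ext A)
  pair_p : ∀ {Δ Γ : Ctx} {A : Ty Γ} (σ : Δ ⟶ Γ) (a : Tm Δ) (h : tp a = tySub σ A),
    pair σ a h ≫ p A = σ
  q_pair : ∀ {Δ Γ : Ctx} {A : Ty Γ} (σ : Δ ⟶ Γ) (a : Tm Δ) (h : tp a = tySub σ A),
    tmSub (pair σ a h) (q A) = a
  ext_hom : ∀ {Δ Γ : Ctx} {A : Ty Γ} (σ τ : Δ ⟶ ext A),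
    σ ≫ p A = τ ≫ p A → tmSub σ (q A) = tmSub τ (q A) → σ = τ

namespace CwF

attribute [instance] CwF.cat

/-- Strict morphisms of CwFs: they preserve the empty context and the chosen context extensions
up to equality of objects. -/
structure Hom (C D : CwF.{u}) extends C.Ctx ⥤ D.Ctx where
  ty : ∀ {Γ : C.Ctx}, C.Ty Γ → D.Ty (obj Γ)
  ty_sub : ∀ {Δ Γ : C.Ctx} (σ : Δ ⟶ Γ) (A : C.Ty Γ), ty (C.tySub σ A) = D.tySub (map σ) (ty A)
  tm : ∀ {Γ : C.Ctx}, C.Tm Γ → D.Tm (obj Γ)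
  tm_sub : ∀ {Δ Γ : C.Ctx} (σ : Δ ⟶ Γ) (a : C.Tm Γ), tm (C.tmSub σ a) = D.tmSub (map σ) (tm a)
  tp_tm : ∀ {Γ : C.Ctx} (a : C.Tm Γ), D.tp (tm a) = ty (C.tp a)
  obj_nil : obj C.nil = D.nil
  obj_ext : ∀ {Γ : C.Ctx} (A : C.Ty Γ), obj (C.ext A) = D.ext (ty A)
  map_p : ∀ {Γ : C.Ctx} (A : C.Ty Γ), map (C.p A) = eqToHom (obj_ext A) ≫ D.p (ty A)
  tm_q : ∀ {Γ : C.Ctx} (A : C.Ty Γ), tm (C.q A) = D.tmSub (eqToHom (obj_ext A)) (D.q (ty A))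

/-- The identity morphism. -/
def Hom.id (C : CwF.{u}) : Hom C C where
  toFunctor := 𝟭 C.Ctx
  ty A := A
  ty_sub _ _ := rfl
  tm a := a
  tm_sub _ _ := rfl
  tp_tm _ := rfl
  obj_nil := rfl
  obj_ext _ := rfl
  map_p A := by simp
  tm_q A := by simp [C.tmSub_id]

/-- Composition of morphisms. -/
def Hom.comp {C D E : CwF.{u}} (F : Hom C D) (G : Hom D E) : Hom C E where
  toFunctor := F.toFunctor ⋙ G.toFunctor
  ty A := G.ty (F.ty A)
  ty_sub σ A := by rw [F.ty_sub, G.ty_sub]; rfl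
  tm a := G.tm (F.tm a)
  tm_sub σ a := by rw [F.tm_sub, G.tm_sub]; rfl
  tp_tm a := by rw [G.tp_tm, F.tp_tm]
  obj_nil := (congrArg G.obj F.obj_nil).trans G.obj_nil
  obj_ext A := (congrArg G.obj (F.obj_ext A)).trans (G.obj_ext _)
  map_p A := by
    simp only [Functor.comp_map, F.map_p, G.map_p, Functor.map_comp, eqToHom_map,
      ← Category.assoc, eqToHom_trans]
  tm_q A := by
    rw [F.tm_q, G.tm_sub, G.tm_q, ← E.tmSub_comp, eqToHom_map, eqToHom_trans]

/-- The category of CwFs and strict morphisms. -/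
instance : Category.{u} CwF.{u} where
  Hom := Hom
  id := Hom.id
  comp := Hom.comp

section Substitutions

variable (C : CwF.{u})

/-- The substitution `⟨id, a⟩ : Γ ⟶ Γ.A` given by a term `a` of type `A`. -/
def sec {Γ : C.Ctx} (A : C.Ty Γ) (a : C.Tm Γ) (h : C.tp a = A) : Γ ⟶ C.ext A :=
  C.pair (𝟙 Γ) a (by rw [h, C.tySub_id])

/-- A term of type `A` restricts to a term of type `A[σ]`. -/
theorem tp_sub_of {Δ Γ : C.Ctx} (σ : Δ ⟶ Γ) {a : C.Tm Γ} {A : C.Ty Γ} (h : C.tp a = A) :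
    C.tp (C.tmSub σ a) = C.tySub σ A := by rw [C.tp_sub, h]

/-- The substitution `σ⁺ : Δ.A[σ] ⟶ Γ.A`. -/
def lift {Δ Γ : C.Ctx} (σ : Δ ⟶ Γ) (A : C.Ty Γ) : C.ext (C.tySub σ A) ⟶ C.ext A :=
  C.pair (C.p (C.tySub σ A) ≫ σ) (C.q (C.tySub σ A)) (by rw [C.tp_q, C.tySub_comp])

theorem sec_p {Γ : C.Ctx} (A : C.Ty Γ) (a : C.Tm Γ) (h : C.tp a = A) :
    C.sec A a h ≫ C.p A = 𝟙 Γ := C.pair_p _ _ _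

theorem q_sec {Γ : C.Ctx} (A : C.Ty Γ) (a : C.Tm Γ) (h : C.tp a = A) :
    C.tmSub (C.sec A a h) (C.q A) = a := C.q_pair _ _ _

theorem lift_p {Δ Γ : C.Ctx} (σ : Δ ⟶ Γ) (A : C.Ty Γ) :
    C.lift σ A ≫ C.p A = C.p (C.tySub σ A) ≫ σ := C.pair_p _ _ _

theorem q_lift {Δ Γ : C.Ctx} (σ : Δ ⟶ Γ) (A : C.Ty Γ) :
    C.tmSub (C.lift σ A) (C.q A) = C.q (C.tySub σ A) := C.q_pair _ _ _

theorem sec_lift {Δ Γ : C.Ctx} (σ : Δ ⟶ Γ) (A : C.Ty Γ) (a : C.Tm Γ) (h : C.tp a = A) :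
    C.sec (C.tySub σ A) (C.tmSub σ a) (C.tp_sub_of σ h) ≫ C.lift σ A = σ ≫ C.sec A a h := by
  apply C.ext_hom
  · rw [Category.assoc, C.lift_p, ← Category.assoc, C.sec_p, Category.assoc, C.sec_p,
      Category.id_comp, Category.comp_id]
  · rw [C.tmSub_comp, C.q_lift, C.q_sec, C.tmSub_comp, C.q_sec]

end Substitutions

/-! ### Weakly stable weak identity types -/

/-- A weakly stable identity type introduction structure: for every context `Γ`, type `A` and term
`x` of type `A` over `Γ`, a type `Id A x` over `Γ.A` and a term `refl A x` of `Id A x [⟨id, x⟩]`,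
without any compatibility with substitution. -/
structure IdIntro (C : CwF.{u}) where
  Id : ∀ {Γ : C.Ctx} (A : C.Ty Γ) (x : C.Tm Γ), C.tp x = A → C.Ty (C.ext A)
  refl : ∀ {Γ : C.Ctx} (A : C.Ty Γ) (x : C.Tm Γ), C.tp x = A → C.Tm Γ
  tp_refl : ∀ {Γ : C.Ctx} (A : C.Ty Γ) (x : C.Tm Γ) (hx : C.tp x = A),
    C.tp (refl A x hx) = C.tySub (C.sec A x hx) (Id A x hx)

namespace IdIntro

variable {C : CwF.{u}} (I : IdIntro C)

/-- For `γ : Δ ⟶ Γ`, the type `Id A x [γ⁺]` over `Δ.A[γ]`. -/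
def idSub {Γ : C.Ctx} (A : C.Ty Γ) (x : C.Tm Γ) (hx : C.tp x = A) {Δ : C.Ctx} (γ : Δ ⟶ Γ) :
    C.Ty (C.ext (C.tySub γ A)) :=
  C.tySub (C.lift γ A) (I.Id A x hx)

theorem tp_refl_sub {Γ : C.Ctx} (A : C.Ty Γ) (x : C.Tm Γ) (hx : C.tp x = A) {Δ : C.Ctx}
    (γ : Δ ⟶ Γ) :
    C.tp (C.tmSub γ (I.refl A x hx)) =
      C.tySub (C.sec (C.tySub γ A) (C.tmSub γ x) (C.tp_sub_of γ hx)) (I.idSub A x hx γ) := by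
  rw [idSub, C.tp_sub, I.tp_refl, ← C.tySub_comp, ← C.tySub_comp, C.sec_lift]

/-- For `γ : Δ ⟶ Γ`, the substitution `⟨id, x[γ], refl[γ]⟩ : Δ ⟶ Δ.A[γ].Id[γ⁺]`. -/
def reflSec {Γ : C.Ctx} (A : C.Ty Γ) (x : C.Tm Γ) (hx : C.tp x = A) {Δ : C.Ctx} (γ : Δ ⟶ Γ) :
    Δ ⟶ C.ext (I.idSub A x hx γ) :=
  C.pair (C.sec (C.tySub γ A) (C.tmSub γ x) (C.tp_sub_of γ hx)) (C.tmSub γ (I.refl A x hx))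
    (I.tp_refl_sub A x hx γ)

end IdIntro

/-- Weakly stable weak identity types. An elimination context over `(Γ, A, x)` consists of
`γ : Δ ⟶ Γ`, a type `P` over `Δ.(y : A[γ]).(p : Id[γ⁺])` and a term `d` over `Δ` of type
`P(x[γ], refl[γ])`. The eliminator is a term `J` of type `P`, with a term `Jβ` of the identity type
at base point `d` and index `J(x[γ], refl[γ])`. -/
structure WeaklyStableId (C : CwF.{u}) extends IdIntro C where
  J : ∀ {Γ : C.Ctx} (A : C.Ty Γ) (x : C.Tm Γ) (hx : C.tp x = A) {Δ : C.Ctx} (γ : Δ ⟶ Γ)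
    (P : C.Ty (C.ext (toIdIntro.idSub A x hx γ))) (d : C.Tm Δ),
    C.tp d = C.tySub (toIdIntro.reflSec A x hx γ) P → C.Tm (C.ext (toIdIntro.idSub A x hx γ))
  tp_J : ∀ {Γ : C.Ctx} (A : C.Ty Γ) (x : C.Tm Γ) (hx : C.tp x = A) {Δ : C.Ctx} (γ : Δ ⟶ Γ)
    (P : C.Ty (C.ext (toIdIntro.idSub A x hx γ))) (d : C.Tm Δ)
    (hd : C.tp d = C.tySub (toIdIntro.reflSec A x hx γ) P), C.tp (J A x hx γ P d hd) = P
  Jβ : ∀ {Γ : C.Ctx} (A : C.Ty Γ) (x : C.Tm Γ) (hx : C.tp x = A) {Δ : C.Ctx} (γ : Δ ⟶ Γ)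
    (P : C.Ty (C.ext (toIdIntro.idSub A x hx γ))) (d : C.Tm Δ),
    C.tp d = C.tySub (toIdIntro.reflSec A x hx γ) P → C.Tm Δ
  tp_Jβ : ∀ {Γ : C.Ctx} (A : C.Ty Γ) (x : C.Tm Γ) (hx : C.tp x = A) {Δ : C.Ctx} (γ : Δ ⟶ Γ)
    (P : C.Ty (C.ext (toIdIntro.idSub A x hx γ))) (d : C.Tm Δ)
    (hd : C.tp d = C.tySub (toIdIntro.reflSec A x hx γ) P),
    C.tp (Jβ A x hx γ P d hd) =
      C.tySub
        (C.sec (C.tySub (toIdIntro.reflSec A x hx γ) P)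
          (C.tmSub (toIdIntro.reflSec A x hx γ) (J A x hx γ P d hd))
          (C.tp_sub_of _ (tp_J A x hx γ P d hd)))
        (Id (C.tySub (toIdIntro.reflSec A x hx γ) P) d hd)

/-! ### Strictly stable weak identity types -/

/-- A strictly stable identity type introduction structure: `Id(A, x, y)` and `refl(A, x)`,
natural in the context. -/
structure StableIdIntro (C : CwF.{u}) where
  Id : ∀ {Γ : C.Ctx} (A : C.Ty Γ) (x y : C.Tm Γ), C.tp x = A → C.tp y = A → C.Ty Γ
  Id_sub : ∀ {Δ Γ : C.Ctx} (σ : Δ ⟶ Γ) (A : C.Ty Γ) (x y : C.Tm Γ) (hx : C.tp x = A)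
    (hy : C.tp y = A),
    C.tySub σ (Id A x y hx hy) = Id (C.tySub σ A) (C.tmSub σ x) (C.tmSub σ y)
      (C.tp_sub_of σ hx) (C.tp_sub_of σ hy)
  refl : ∀ {Γ : C.Ctx} (A : C.Ty Γ) (x : C.Tm Γ), C.tp x = A → C.Tm Γ
  tp_refl : ∀ {Γ : C.Ctx} (A : C.Ty Γ) (x : C.Tm Γ) (hx : C.tp x = A),
    C.tp (refl A x hx) = Id A x x hx hx
  refl_sub : ∀ {Δ Γ : C.Ctx} (σ : Δ ⟶ Γ) (A : C.Ty Γ) (x : C.Tm Γ) (hx : C.tp x = A),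
    C.tmSub σ (refl A x hx) = refl (C.tySub σ A) (C.tmSub σ x) (C.tp_sub_of σ hx)

namespace StableIdIntro

variable {C : CwF.{u}} (S : StableIdIntro C)

theorem Id_congr {Γ : C.Ctx} {A A' : C.Ty Γ} {x x' y y' : C.Tm Γ} (hx : C.tp x = A)
    (hy : C.tp y = A) (hx' : C.tp x' = A') (hy' : C.tp y' = A') (eA : A = A') (ex : x = x')
    (ey : y = y') : S.Id A x y hx hy = S.Id A' x' y' hx' hy' := by
  subst eA ex ey; rfl

/-- The family `y ↦ Id(A, x, y)`, as the type `Id(A[p], x[p], q)` over `Γ.A`. -/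
def fam {Γ : C.Ctx} (A : C.Ty Γ) (x : C.Tm Γ) (hx : C.tp x = A) : C.Ty (C.ext A) :=
  S.Id (C.tySub (C.p A) A) (C.tmSub (C.p A) x) (C.q A) (C.tp_sub_of _ hx) (C.tp_q A)

theorem fam_sec {Γ : C.Ctx} (A : C.Ty Γ) (x y : C.Tm Γ) (hx : C.tp x = A) (hy : C.tp y = A) :
    C.tySub (C.sec A y hy) (S.fam A x hx) = S.Id A x y hx hy := by
  rw [fam, S.Id_sub]
  apply S.Id_congr
  · rw [← C.tySub_comp, C.sec_p, C.tySub_id]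
  · rw [← C.tmSub_comp, C.sec_p, C.tmSub_id]
  · rw [C.q_sec]

theorem fam_sub {Δ Γ : C.Ctx} (σ : Δ ⟶ Γ) (A : C.Ty Γ) (x : C.Tm Γ) (hx : C.tp x = A) :
    C.tySub (C.lift σ A) (S.fam A x hx) =
      S.fam (C.tySub σ A) (C.tmSub σ x) (C.tp_sub_of σ hx) := by
  rw [fam, fam, S.Id_sub]
  apply S.Id_congr
  · rw [← C.tySub_comp, C.lift_p, C.tySub_comp]
  · rw [← C.tmSub_comp, C.lift_p, C.tmSub_comp]
  · rw [C.q_lift]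

/-- The underlying weakly stable introduction structure. -/
def toIdIntro : IdIntro C where
  Id := S.fam
  refl := S.refl
  tp_refl A x hx := by rw [S.tp_refl, S.fam_sec]

/-- The substitution `⟨id, x, refl⟩ : Γ ⟶ Γ.(y : A).(p : Id(A, x, y))`. -/
def reflSec {Γ : C.Ctx} (A : C.Ty Γ) (x : C.Tm Γ) (hx : C.tp x = A) :
    Γ ⟶ C.ext (S.fam A x hx) :=
  C.pair (C.sec A x hx) (S.refl A x hx) (by rw [S.tp_refl, S.fam_sec])

/-- The substitution `σ⁺⁺` from `Δ.(y : A[σ]).Id(A[σ], x[σ], y)` to `Γ.(y : A).Id(A, x, y)`. -/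
def lift₂ {Δ Γ : C.Ctx} (σ : Δ ⟶ Γ) (A : C.Ty Γ) (x : C.Tm Γ) (hx : C.tp x = A) :
    C.ext (S.fam (C.tySub σ A) (C.tmSub σ x) (C.tp_sub_of σ hx)) ⟶ C.ext (S.fam A x hx) :=
  C.pair (C.p _ ≫ C.lift σ A) (C.q _) (by rw [C.tp_q, C.tySub_comp, S.fam_sub])

theorem reflSec_lift₂ {Δ Γ : C.Ctx} (σ : Δ ⟶ Γ) (A : C.Ty Γ) (x : C.Tm Γ) (hx : C.tp x = A) :
    S.reflSec (C.tySub σ A) (C.tmSub σ x) (C.tp_sub_of σ hx) ≫ S.lift₂ σ A x hx =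
      σ ≫ S.reflSec A x hx := by
  apply C.ext_hom
  · rw [lift₂, reflSec, reflSec, Category.assoc, C.pair_p, ← Category.assoc, C.pair_p,
      Category.assoc, C.pair_p, C.sec_lift]
  · rw [lift₂, reflSec, reflSec, C.tmSub_comp, C.q_pair, C.q_pair, C.tmSub_comp, C.q_pair,
      S.refl_sub]

theorem tp_sub_reflSec {Δ Γ : C.Ctx} (σ : Δ ⟶ Γ) (A : C.Ty Γ) (x : C.Tm Γ) (hx : C.tp x = A)
    (P : C.Ty (C.ext (S.fam A x hx))) (d : C.Tm Γ)
    (hd : C.tp d = C.tySub (S.reflSec A x hx) P) :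
    C.tp (C.tmSub σ d) =
      C.tySub (S.reflSec (C.tySub σ A) (C.tmSub σ x) (C.tp_sub_of σ hx))
        (C.tySub (S.lift₂ σ A x hx) P) := by
  rw [C.tp_sub, hd, ← C.tySub_comp, ← C.tySub_comp, S.reflSec_lift₂]

end StableIdIntro

/-- Strictly stable weak identity types. The motive `P` is a type over `Γ.(y : A).(p : Id(A, x, y))`
and `J(A, x, P, d)` is a term of type `P`; `Jβ(A, x, P, d)` is a term of type
`Id(P(x, refl), J(x, refl), d)`. All operations are natural in the context. -/
structure StableId (C : CwF.{u}) extends StableIdIntro C where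
  J : ∀ {Γ : C.Ctx} (A : C.Ty Γ) (x : C.Tm Γ) (hx : C.tp x = A)
    (P : C.Ty (C.ext (toStableIdIntro.fam A x hx))) (d : C.Tm Γ),
    C.tp d = C.tySub (toStableIdIntro.reflSec A x hx) P →
      C.Tm (C.ext (toStableIdIntro.fam A x hx))
  tp_J : ∀ {Γ : C.Ctx} (A : C.Ty Γ) (x : C.Tm Γ) (hx : C.tp x = A)
    (P : C.Ty (C.ext (toStableIdIntro.fam A x hx))) (d : C.Tm Γ)
    (hd : C.tp d = C.tySub (toStableIdIntro.reflSec A x hx) P), C.tp (J A x hx P d hd) = P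
  J_sub : ∀ {Δ Γ : C.Ctx} (σ : Δ ⟶ Γ) (A : C.Ty Γ) (x : C.Tm Γ) (hx : C.tp x = A)
    (P : C.Ty (C.ext (toStableIdIntro.fam A x hx))) (d : C.Tm Γ)
    (hd : C.tp d = C.tySub (toStableIdIntro.reflSec A x hx) P),
    C.tmSub (toStableIdIntro.lift₂ σ A x hx) (J A x hx P d hd) =
      J (C.tySub σ A) (C.tmSub σ x) (C.tp_sub_of σ hx)
        (C.tySub (toStableIdIntro.lift₂ σ A x hx) P) (C.tmSub σ d)
        (toStableIdIntro.tp_sub_reflSec σ A x hx P d hd)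
  Jβ : ∀ {Γ : C.Ctx} (A : C.Ty Γ) (x : C.Tm Γ) (hx : C.tp x = A)
    (P : C.Ty (C.ext (toStableIdIntro.fam A x hx))) (d : C.Tm Γ),
    C.tp d = C.tySub (toStableIdIntro.reflSec A x hx) P → C.Tm Γ
  tp_Jβ : ∀ {Γ : C.Ctx} (A : C.Ty Γ) (x : C.Tm Γ) (hx : C.tp x = A)
    (P : C.Ty (C.ext (toStableIdIntro.fam A x hx))) (d : C.Tm Γ)
    (hd : C.tp d = C.tySub (toStableIdIntro.reflSec A x hx) P),
    C.tp (Jβ A x hx P d hd) =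
      Id (C.tySub (toStableIdIntro.reflSec A x hx) P)
        (C.tmSub (toStableIdIntro.reflSec A x hx) (J A x hx P d hd)) d
        (C.tp_sub_of _ (tp_J A x hx P d hd)) hd
  Jβ_sub : ∀ {Δ Γ : C.Ctx} (σ : Δ ⟶ Γ) (A : C.Ty Γ) (x : C.Tm Γ) (hx : C.tp x = A)
    (P : C.Ty (C.ext (toStableIdIntro.fam A x hx))) (d : C.Tm Γ)
    (hd : C.tp d = C.tySub (toStableIdIntro.reflSec A x hx) P),
    C.tmSub σ (Jβ A x hx P d hd) =
      Jβ (C.tySub σ A) (C.tmSub σ x) (C.tp_sub_of σ hx)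
        (C.tySub (toStableIdIntro.lift₂ σ A x hx) P) (C.tmSub σ d)
        (toStableIdIntro.tp_sub_reflSec σ A x hx P d hd)

/-! ### Equivalences -/

/-- Two terms `a`, `b` of type `A` over `Γ` are typally equal if `Id A a [⟨id, b⟩]` has a term. -/
def IdIntro.TypalEq {C : CwF.{u}} (I : IdIntro C) {Γ : C.Ctx} (A : C.Ty Γ) (a b : C.Tm Γ)
    (ha : C.tp a = A) (hb : C.tp b = A) : Prop :=
  ∃ e : C.Tm Γ, C.tp e = C.tySub (C.sec A b hb) (I.Id A a ha)

/-- Composition of a map `A → B` over `Γ`, given as a term `f` of type `B[p]` over `Γ.A`, with a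
map `B → A'` over `Γ`, given as a term `g` of type `A'[p]` over `Γ.B`. -/
def mapComp (C : CwF.{u}) {Γ : C.Ctx} {A B : C.Ty Γ} (f : C.Tm (C.ext A))
    (hf : C.tp f = C.tySub (C.p A) B) (g : C.Tm (C.ext B)) : C.Tm (C.ext A) :=
  C.tmSub (C.pair (C.p A) f hf) g

theorem tp_mapComp (C : CwF.{u}) {Γ : C.Ctx} {A B A' : C.Ty Γ} (f : C.Tm (C.ext A))
    (hf : C.tp f = C.tySub (C.p A) B) (g : C.Tm (C.ext B)) (hg : C.tp g = C.tySub (C.p B) A') :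
    C.tp (C.mapComp f hf g) = C.tySub (C.p A) A' := by
  rw [mapComp, C.tp_sub, hg, ← C.tySub_comp, C.pair_p]

/-- A map `f : A → B` of types over `Γ` is an equivalence if it has an inverse `g : B → A` over `Γ`
up to typal equalities `g(f(a)) = a` over `Γ.(a : A)` and `f(g(b)) = b` over `Γ.(b : B)`. -/
def IdIntro.IsEquiv {C : CwF.{u}} (I : IdIntro C) {Γ : C.Ctx} (A B : C.Ty Γ) (f : C.Tm (C.ext A))
    (hf : C.tp f = C.tySub (C.p A) B) : Prop :=
  ∃ (g : C.Tm (C.ext B)) (hg : C.tp g = C.tySub (C.p B) A),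
    I.TypalEq (C.tySub (C.p A) A) (C.mapComp f hf g) (C.q A) (C.tp_mapComp f hf g hg) (C.tp_q A) ∧
    I.TypalEq (C.tySub (C.p B) B) (C.mapComp g hg f) (C.q B) (C.tp_mapComp g hg f hf) (C.tp_q B)

/-! ### The canonical map out of an identity type -/

namespace WeaklyStableId

variable {C : CwF.{u}} (I : WeaklyStableId C)

/-- The comparison `Γ.A.Id ⟶ Γ.A[id].Id[id⁺]`, which is the identity up to `A[id] = A`. -/
def unbias {Γ : C.Ctx} (A : C.Ty Γ) (x : C.Tm Γ) (hx : C.tp x = A) :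
    C.ext (I.Id A x hx) ⟶ C.ext (I.idSub A x hx (𝟙 Γ)) :=
  C.pair
    (C.p (I.Id A x hx) ≫ C.pair (C.p A) (C.q A) (by rw [C.tp_q, C.tySub_id]))
    (C.q (I.Id A x hx))
    (by
      rw [C.tp_q, IdIntro.idSub, ← C.tySub_comp, Category.assoc]
      congr 1
      apply C.ext_hom
      · simp only [Category.assoc, C.lift_p]
        rw [← Category.assoc (C.pair _ _ _), C.pair_p, Category.comp_id]
      · simp only [C.tmSub_comp, C.q_lift, C.q_pair])

/-- Let `B` be a type over `Γ.(y : A)`, let `P(y, p) = B(y)`, as a type over `Γ.A[id].Id[id⁺]`. -/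
def motive {Γ : C.Ctx} (A : C.Ty Γ) (x : C.Tm Γ) (hx : C.tp x = A) (B : C.Ty (C.ext A)) :
    C.Ty (C.ext (I.idSub A x hx (𝟙 Γ))) :=
  C.tySub (C.p (I.idSub A x hx (𝟙 Γ)) ≫ C.lift (𝟙 Γ) A) B

theorem tp_motive {Γ : C.Ctx} (A : C.Ty Γ) (x : C.Tm Γ) (hx : C.tp x = A) (B : C.Ty (C.ext A))
    (b : C.Tm Γ) (hb : C.tp b = C.tySub (C.sec A x hx) B) :
    C.tp b = C.tySub (I.reflSec A x hx (𝟙 Γ)) (I.motive A x hx B) := by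
  rw [hb, motive, IdIntro.reflSec, ← C.tySub_comp, ← Category.assoc, C.pair_p, C.sec_lift,
    Category.id_comp]

/-- The canonical map `Id A x → B` of types over `Γ.A` that is determined, through the eliminator,
by a type `B` over `Γ.(y : A)` and a term `b` of type `B(x)`. It is a term over `Γ.A.Id`. -/
def canMap {Γ : C.Ctx} (A : C.Ty Γ) (x : C.Tm Γ) (hx : C.tp x = A) (B : C.Ty (C.ext A))
    (b : C.Tm Γ) (hb : C.tp b = C.tySub (C.sec A x hx) B) : C.Tm (C.ext (I.Id A x hx)) :=
  C.tmSub (I.unbias A x hx)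
    (I.J A x hx (𝟙 Γ) (I.motive A x hx B) b (I.tp_motive A x hx B b hb))

theorem tp_canMap {Γ : C.Ctx} (A : C.Ty Γ) (x : C.Tm Γ) (hx : C.tp x = A) (B : C.Ty (C.ext A))
    (b : C.Tm Γ) (hb : C.tp b = C.tySub (C.sec A x hx) B) :
    C.tp (I.canMap A x hx B b hb) = C.tySub (C.p (I.Id A x hx)) B := by
  rw [canMap, C.tp_sub, I.tp_J, motive, ← C.tySub_comp]
  congr 1
  rw [unbias, ← Category.assoc, C.pair_p]
  apply C.ext_hom
  · simp only [Category.assoc, C.lift_p]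
    rw [← Category.assoc (C.pair _ _ _), C.pair_p, Category.comp_id]
  · simp only [C.tmSub_comp, C.q_lift, C.q_pair]

end WeaklyStableId

/-! ### Weak preservation of identity types -/

namespace Hom

variable {D C : CwF.{u}} (F : D ⟶ C)

/-- The image under `F` of a type over `Γ.A`, as a type over `F(Γ).F(A) = F(Γ.A)`. -/
def tyExt {Γ : D.Ctx} {A : D.Ty Γ} (B : D.Ty (D.ext A)) : C.Ty (C.ext (F.ty A)) :=
  C.tySub (eqToHom (F.obj_ext A).symm) (F.ty B)

theorem tp_tm_of {Γ : D.Ctx} {A : D.Ty Γ} {x : D.Tm Γ} (hx : D.tp x = A) :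
    C.tp (F.tm x) = F.ty A := by rw [F.tp_tm, hx]

theorem map_sec {Γ : D.Ctx} (A : D.Ty Γ) (x : D.Tm Γ) (hx : D.tp x = A) :
    F.map (D.sec A x hx) =
      C.sec (F.ty A) (F.tm x) (tp_tm_of F hx) ≫ eqToHom (F.obj_ext A).symm := by
  rw [← cancel_mono (eqToHom (F.obj_ext A)), Category.assoc, eqToHom_trans, eqToHom_refl,
    Category.comp_id]
  apply C.ext_hom
  · rw [Category.assoc, ← F.map_p, ← F.map_comp, D.sec_p, C.sec_p, F.map_id]
  · rw [C.tmSub_comp, ← F.tm_q, ← F.tm_sub, D.q_sec, C.q_sec]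

theorem tp_tm_refl (I : IdIntro D) {Γ : D.Ctx} (A : D.Ty Γ) (x : D.Tm Γ) (hx : D.tp x = A) :
    C.tp (F.tm (I.refl A x hx)) =
      C.tySub (C.sec (F.ty A) (F.tm x) (tp_tm_of F hx)) (tyExt F (I.Id A x hx)) := by
  rw [F.tp_tm, I.tp_refl, F.ty_sub, map_sec, C.tySub_comp, tyExt]

/-- `F` weakly preserves identity types: for all `(Γ, A, x)`, the canonical map from
`Id (F A) (F x)` to `F (Id A x)`, which is determined by `F (refl A x)`, is an equivalence over
`F(Γ.A)`. -/
def WeaklyPreservesId (ID : IdIntro D) (IC : WeaklyStableId C) : Prop :=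
  ∀ {Γ : D.Ctx} (A : D.Ty Γ) (x : D.Tm Γ) (hx : D.tp x = A),
    IC.IsEquiv (IC.Id (F.ty A) (F.tm x) (tp_tm_of F hx)) (tyExt F (ID.Id A x hx))
      (IC.canMap (F.ty A) (F.tm x) (tp_tm_of F hx) (tyExt F (ID.Id A x hx))
        (F.tm (ID.refl A x hx)) (tp_tm_refl F ID A x hx))
      (IC.tp_canMap _ _ _ _ _ _)

/-- `F` is a trivial fibration: it has the type lifting and the term lifting property. -/
structure IsTrivialFibration : Prop where
  ty_lift : ∀ {Γ : D.Ctx} (A : C.Ty (F.obj Γ)), ∃ A₀ : D.Ty Γ, F.ty A₀ = A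
  tm_lift : ∀ {Γ : D.Ctx} (A : D.Ty Γ) (a : C.Tm (F.obj Γ)), C.tp a = F.ty A →
    ∃ a₀ : D.Tm Γ, D.tp a₀ = A ∧ F.tm a₀ = a

end Hom

/-! ### Cellular CwFs -/

/-- A collection of types and terms to be adjoined to `C`: generating types with their contexts,
and generating terms with their contexts and types. -/
structure Generators (C : CwF.{u}) where
  GenTy : Type u
  GenTm : Type u
  bdTy : GenTy → C.Ctx
  bdTm : GenTm → C.Ctx
  outTy : ∀ f, C.Ty (bdTm f)

/-- A choice, in a CwF `E` under `C`, of a type for every generating type and of a term for every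
generating term. -/
structure Generators.Interp {C : CwF.{u}} (G : Generators C) {E : CwF.{u}} (H : C ⟶ E) where
  ty : ∀ s, E.Ty (H.obj (G.bdTy s))
  tm : ∀ f, E.Tm (H.obj (G.bdTm f))
  tp_tm : ∀ f, E.tp (tm f) = H.ty (G.outTy f)

/-- The image of an interpretation under a morphism. -/
def Generators.Interp.map {C : CwF.{u}} {G : Generators C} {D E : CwF.{u}} {i : C ⟶ D}
    (j : G.Interp i) (H : D ⟶ E) : G.Interp (i ≫ H) where
  ty s := H.ty (j.ty s)
  tm f := H.tm (j.tm f)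
  tp_tm f := (H.tp_tm _).trans (congrArg H.ty (j.tp_tm f))

/-- Basic cellular maps `i : C ⟶ D`, the pushouts of coproducts of the generating cofibrations
`Free(Γ : Ob) ⟶ Free(A : Ty Γ)` and `Free(A : Ty Γ) ⟶ Free(a : Tm Γ A)`: `D` is obtained from `C`
by freely adjoining types and terms whose contexts and types are from `C`. The condition is the
universal property of that pushout: a morphism `D ⟶ E` is the same as a morphism `C ⟶ E` with
images in `E` for the generating types and terms. -/
def basicCellular : MorphismProperty CwF.{u} := fun C _ i =>
  ∃ (G : Generators C) (j : G.Interp i), ∀ (E : CwF.{u}) (K : C ⟶ E) (k : G.Interp K),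
    ∃! H, ∃ h : i ≫ H = K, h ▸ j.map H = k

/-- A CwF is cellular if the map from the initial CwF is a composition of an `ω`-sequence of basic
cellular maps. -/
def IsCellular (D : CwF.{u}) : Prop :=
  ∃ (Z : CwF.{u}) (hZ : Limits.IsInitial Z),
    basicCellular.{u}.transfiniteCompositionsOfShape ℕ (hZ.to D)

end CwF

-- Take for `D` the free CwF on symbols read off from `C`. A type symbol consists of a context built
-- from symbols of earlier stages and a type of `C` over the evaluation of that context; a term
-- symbol consists of such a context, a type over it, and a term of `C` of the evaluated type. A
-- type of `C` over `F Γ` is then the image of a symbol with boundary `Γ`, applied to the identity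
-- substitution, and likewise for terms, so `F` is a trivial fibration by construction
-- (`proj_isTrivialFibration`). Since a context mentions finitely many symbols, its boundary always
-- lives at a finite stage (`WCon.exists_stage`). No equations are imposed, so `D` is given by raw
-- syntax. A morphism out of a syntactic CwF is the same as an interpretation of its symbols
-- (`interp`, `hom_eq_of_genVal_le`), which gives the universal properties behind cellularity
-- (`basicCellular_inc`, `IsChain.isColimit`).
--
-- Identity types: every type of `D` is `T(σ)` for a unique symbol `T` and substitution `σ`. It
-- suffices to lift the identity type of `C` at the generic instance of each `T` along `F`, and to
-- define the others by substitution. Stability is then the strict equality `T(σ)[δ] = T(σδ)`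
-- (`synId`). The image under `F` of such a type is a reindexed identity type of `C`, and weak
-- stability says exactly that reindexed identity types still eliminate (`hasJ_of_eq`,
-- `synId_mapsToHasJ`). Two families with elimination over the same point are equivalent, which is
-- weak preservation (`HasJ.isEquiv_canMap`). Eliminating in `C` and lifting along `F` solves every
-- elimination problem in `D`, though not stably (`exists_J`).
--
-- Stability of the eliminator: the data `(A, x, P, d)` form a category under restriction. If each
-- connected component has a generic datum of which all members are restrictions, naturally, one
-- solves the generic problem and restricts the solution (`Elim.exists_stable_sol`). To find the
-- generic datum (`Elim.exists_generic`), view the data of a component as families of raw terms over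
-- a connected diagram of contexts, compatible with substitution. If such a family is nowhere a
-- context variable, its head is constant (`Natural.classify`) and its arguments are amalgamated
-- recursively. If it is a variable somewhere, it becomes a variable of the generic context, once
-- its type has been amalgamated. The recursion passes from a term to its arguments and to the
-- arguments of its type; it terminates because output types of symbols come from earlier stages and
-- types of variables from shorter contexts (`HasTy.tAcc`). Motives live over two further variables;
-- these are treated as bound variables, fixed by all substitutions, so that a single diagram of
-- contexts serves all components of the data.

namespace FreeCwF

/-! ### Raw syntax -/

/-- Raw terms. A variable `inl i` is the `i`-th variable of the context, counted from the left; a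
variable `inr k` is a bound variable outside of the context. The arguments of a symbol beyond its
arity are `junk`. -/
inductive RTm (G : Type u) : Type u
  | junk : RTm G
  | var (v : ℕ ⊕ ℕ) : RTm G
  | app (f : G) (σ : ℕ → RTm G) : RTm G

/-- Raw types: a symbol applied to raw terms. -/
@[ext]
structure RTy (GTy GTm : Type u) : Type u where
  head : GTy
  args : ℕ → RTm GTm

namespace RTm

variable {G : Type u}

/-- Simultaneous substitution of all variables. -/
def sub (s : ℕ ⊕ ℕ → RTm G) : RTm G → RTm G
  | junk => junk
  | var v => s v
  | app f σ => app f fun i => (σ i).sub s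

@[simp] theorem sub_var (s : ℕ ⊕ ℕ → RTm G) (v : ℕ ⊕ ℕ) : (var v).sub s = s v := rfl
@[simp] theorem sub_app (s : ℕ ⊕ ℕ → RTm G) (f : G) (σ : ℕ → RTm G) :
    (app f σ).sub s = app f fun i => (σ i).sub s := rfl

theorem sub_sub (t : RTm G) (s s' : ℕ ⊕ ℕ → RTm G) :
    (t.sub s).sub s' = t.sub fun v => (s v).sub s' := by
  induction t with
  | junk => rfl
  | var v => rfl
  | app f σ ih => simp [ih]

end RTm

/-- The substitution of the context variables that discards the bound variables. -/
def inst {G : Type u} (σ : ℕ → RTm G) : ℕ ⊕ ℕ → RTm G := Sum.elim σ fun _ => .junk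

/-- The substitution of the context variables that keeps the bound variables. -/
def up {G : Type u} (σ : ℕ → RTm G) : ℕ ⊕ ℕ → RTm G := Sum.elim σ fun k => .var (.inr k)

@[simp] theorem inst_inl {G : Type u} (σ : ℕ → RTm G) (i : ℕ) : inst σ (.inl i) = σ i := rfl
@[simp] theorem up_inl {G : Type u} (σ : ℕ → RTm G) (i : ℕ) : up σ (.inl i) = σ i := rfl

theorem inst_sub {G : Type u} (σ : ℕ → RTm G) (s : ℕ ⊕ ℕ → RTm G) :
    (fun v => (inst σ v).sub s) = inst fun i => (σ i).sub s := by
  funext v; cases v <;> rfl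

@[simp] theorem sub_inst_sub {G : Type u} (t : RTm G) (σ : ℕ → RTm G) (s : ℕ ⊕ ℕ → RTm G) :
    (t.sub (inst σ)).sub s = t.sub (inst fun i => (σ i).sub s) := by
  rw [RTm.sub_sub, inst_sub]

namespace RTy

variable {GTy GTm : Type u}

/-- Simultaneous substitution of all variables. -/
def sub (s : ℕ ⊕ ℕ → RTm GTm) (A : RTy GTy GTm) : RTy GTy GTm := ⟨A.head, fun i => (A.args i).sub s⟩

theorem sub_sub (A : RTy GTy GTm) (s s' : ℕ ⊕ ℕ → RTm GTm) :
    (A.sub s).sub s' = A.sub fun v => (s v).sub s' := by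
  simp [sub, RTm.sub_sub]

@[simp] theorem sub_inst_sub (A : RTy GTy GTm) (σ : ℕ → RTm GTm) (s : ℕ ⊕ ℕ → RTm GTm) :
    (A.sub (inst σ)).sub s = A.sub (inst fun i => (σ i).sub s) := by
  rw [sub_sub, inst_sub]

end RTy

/-- `Look l i a`: the `i`-th element of `l`, counted from the end of the list, is `a`. -/
def Look {α : Type*} : List α → ℕ → α → Prop
  | [], _, _ => False
  | b :: l, i, a => (i = l.length ∧ a = b) ∨ Look l i a

namespace Look

variable {α β : Type*} {l : List α} {i : ℕ} {a b : α}

@[simp] theorem nil_iff : Look ([] : List α) i a ↔ False := Iff.rfl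

theorem cons_iff : Look (b :: l) i a ↔ (i = l.length ∧ a = b) ∨ Look l i a := Iff.rfl

theorem here : Look (a :: l) l.length a := .inl ⟨rfl, rfl⟩

theorem there (h : Look l i a) : Look (b :: l) i a := .inr h

theorem lt (h : Look l i a) : i < l.length := by
  induction l with
  | nil => exact h.elim
  | cons c l ih =>
    rcases h with ⟨rfl, -⟩ | h
    · simp
    · exact (ih h).trans (by simp)

theorem unique (h : Look l i a) (h' : Look l i b) : a = b := by
  induction l with
  | nil => exact h.elim
  | cons c l ih =>
    rcases h with ⟨rfl, rfl⟩ | h <;> rcases h' with ⟨h', rfl⟩ | h'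
    · rfl
    · exact absurd h'.lt (lt_irrefl _)
    · exact absurd (h' ▸ h.lt) (lt_irrefl _)
    · exact ih h h'

theorem exists_of_lt (h : i < l.length) : ∃ a, Look l i a := by
  induction l with
  | nil => simp at h
  | cons c l ih =>
    rcases Nat.lt_succ_iff_lt_or_eq.1 h with h | rfl
    · exact (ih h).imp fun _ => there
    · exact ⟨c, here⟩

theorem map_iff {f : α → β} {c : β} : Look (l.map f) i c ↔ ∃ a, Look l i a ∧ f a = c := by
  induction l with
  | nil => simp
  | cons b l ih =>
    simp only [List.map_cons, cons_iff, List.length_map, ih]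
    constructor
    · rintro (⟨rfl, rfl⟩ | ⟨a, h, rfl⟩)
      · exact ⟨b, .inl ⟨rfl, rfl⟩, rfl⟩
      · exact ⟨a, .inr h, rfl⟩
    · rintro ⟨a, ⟨rfl, rfl⟩ | h, rfl⟩
      · exact .inl ⟨rfl, rfl⟩
      · exact .inr ⟨a, h, rfl⟩

theorem map {f : α → β} (h : Look l i a) : Look (l.map f) i (f a) := map_iff.2 ⟨a, h, rfl⟩

/-- Lookup is functional, and total below the length, so with equal lengths one inclusion is enough.
-/
theorem list_ext {l l' : List α} (hl : l.length = l'.length)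
    (h : ∀ i a, Look l i a → Look l' i a) : l = l' := by
  induction l generalizing l' with
  | nil => exact (List.length_eq_zero_iff.1 hl.symm).symm
  | cons a l ih =>
    cases l' with
    | nil => simp at hl
    | cons a' l' =>
      simp only [List.length_cons, add_left_inj] at hl
      obtain rfl : a = a' := by
        rcases h _ _ here with ⟨-, h⟩ | h
        · exact h
        · exact absurd h.lt (by rw [hl]; exact lt_irrefl _)
      rw [ih hl fun i b hb => ?_]
      rcases h _ _ hb.there with ⟨h, -⟩ | h
      · exact absurd hb.lt (by rw [hl, h]; exact lt_irrefl _)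
      · exact h

end Look

/-! ### Typing -/

/-- A signature: symbols for types and for terms, with raw contexts and raw output types. -/
structure Sig : Type (u + 1) where
  GTy : Type u
  GTm : Type u
  bdTy : GTy → List (RTy GTy GTm)
  bdTm : GTm → List (RTy GTy GTm)
  out : GTm → RTy GTy GTm

namespace Sig

/-- The raw terms over a signature. -/
abbrev Tm (S : Sig.{u}) : Type u := RTm S.GTm
/-- The raw types over a signature. -/
abbrev Ty (S : Sig.{u}) : Type u := RTy S.GTy S.GTm
/-- The raw contexts over a signature. -/
abbrev Con (S : Sig.{u}) : Type u := List S.Ty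
/-- The symbols of a signature. -/
abbrev Sym (S : Sig.{u}) : Type u := S.GTy ⊕ S.GTm

end Sig

variable {S : Sig.{u}} {W W' : Set S.Sym} {L L' : ℕ ⊕ ℕ → S.Ty → Prop}

/-- Well-typed raw terms: the symbols are in `W` and the types of the variables are given
by `L`. -/
inductive HasTy (W : Set S.Sym) (L : ℕ ⊕ ℕ → S.Ty → Prop) : S.Tm → S.Ty → Prop
  | var {v : ℕ ⊕ ℕ} {A : S.Ty} : L v A → HasTy W L (.var v) A
  | app {f : S.GTm} {σ : ℕ → S.Tm} : .inr f ∈ W →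
      (∀ i, (S.bdTm f).length ≤ i → σ i = .junk) →
      (∀ i A, Look (S.bdTm f) i A → HasTy W L (σ i) (A.sub (inst σ))) →
      HasTy W L (.app f σ) ((S.out f).sub (inst σ))

/-- Well-typed raw substitutions into a raw context. -/
structure IsSub (W : Set S.Sym) (L : ℕ ⊕ ℕ → S.Ty → Prop) (Φ : S.Con) (σ : ℕ → S.Tm) : Prop where
  junk : ∀ i, Φ.length ≤ i → σ i = .junk
  typed : ∀ i A, Look Φ i A → HasTy W L (σ i) (A.sub (inst σ))

/-- Well-formed raw types. -/
structure WTy (W : Set S.Sym) (L : ℕ ⊕ ℕ → S.Ty → Prop) (A : S.Ty) : Prop where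
  mem : .inl A.head ∈ W
  args : IsSub W L (S.bdTy A.head) A.args

/-- The variables of a raw context. -/
def ctxL (Γ : S.Con) (v : ℕ ⊕ ℕ) (A : S.Ty) : Prop := ∃ i, v = .inl i ∧ Look Γ i A

/-- Well-formed raw contexts. -/
inductive WCon (W : Set S.Sym) : S.Con → Prop
  | nil : WCon W []
  | cons {Γ : S.Con} {A : S.Ty} : WCon W Γ → WTy W (ctxL Γ) A → WCon W (A :: Γ)

theorem HasTy.of_isSub {f : S.GTm} {σ : ℕ → S.Tm} (hf : .inr f ∈ W)
    (h : IsSub W L (S.bdTm f) σ) : HasTy W L (.app f σ) ((S.out f).sub (inst σ)) :=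
  .app hf h.junk h.typed

theorem HasTy.inv_app {f : S.GTm} {σ : ℕ → S.Tm} {A : S.Ty} (h : HasTy W L (.app f σ) A) :
    .inr f ∈ W ∧ IsSub W L (S.bdTm f) σ ∧ A = (S.out f).sub (inst σ) := by
  cases h with
  | app h₁ h₂ h₃ => exact ⟨h₁, ⟨h₂, h₃⟩, rfl⟩

theorem HasTy.inv_var {v : ℕ ⊕ ℕ} {A : S.Ty} (h : HasTy W L (.var v) A) : L v A := by
  cases h with
  | var h => exact h

theorem HasTy.ne_junk {t : S.Tm} {A : S.Ty} (h : HasTy W L t A) : t ≠ .junk := by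
  rintro rfl; cases h

theorem HasTy.mono (hW : W ⊆ W') (hL : ∀ v A, L v A → L' v A) {t : S.Tm} {A : S.Ty}
    (h : HasTy W L t A) : HasTy W' L' t A := by
  induction h with
  | var h => exact .var (hL _ _ h)
  | app h₁ h₂ _ ih => exact .app (hW h₁) h₂ ih

theorem IsSub.mono (hW : W ⊆ W') (hL : ∀ v A, L v A → L' v A) {Φ : S.Con} {σ : ℕ → S.Tm}
    (h : IsSub W L Φ σ) : IsSub W' L' Φ σ :=
  ⟨h.junk, fun i A hA => (h.typed i A hA).mono hW hL⟩

theorem WTy.mono (hW : W ⊆ W') (hL : ∀ v A, L v A → L' v A) {A : S.Ty}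
    (h : WTy W L A) : WTy W' L' A :=
  ⟨hW h.mem, h.args.mono hW hL⟩

theorem WCon.mono (hW : W ⊆ W') {Γ : S.Con} (h : WCon W Γ) : WCon W' Γ := by
  induction h with
  | nil => exact .nil
  | cons _ hA ih => exact .cons ih (hA.mono hW fun _ _ => id)

/-- There is no conversion rule: the type is read off from the variable or from the head symbol and
its arguments. The two derivations may therefore use different sets of symbols. -/
theorem HasTy.unique (hL : ∀ v A B, L v A → L v B → A = B) {t : S.Tm} {A B : S.Ty}
    (h : HasTy W L t A) (h' : HasTy W' L t B) : A = B := by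
  cases h with
  | var h => exact hL _ _ _ h h'.inv_var
  | app => exact h'.inv_app.2.2.symm

theorem ctxL_unique {Γ : S.Con} (v : ℕ ⊕ ℕ) (A B : S.Ty) (h : ctxL Γ v A) (h' : ctxL Γ v B) :
    A = B := by
  obtain ⟨i, rfl, h⟩ := h
  obtain ⟨j, hj, h'⟩ := h'
  cases hj
  exact h.unique h'

theorem ctxL_there {Γ : S.Con} {B : S.Ty} (v : ℕ ⊕ ℕ) (A : S.Ty) (h : ctxL Γ v A) :
    ctxL (B :: Γ) v A := by
  obtain ⟨i, rfl, h⟩ := h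
  exact ⟨i, rfl, h.there⟩

theorem HasTy.sub_congr {s s' : ℕ ⊕ ℕ → S.Tm} (hs : ∀ v A, L v A → s v = s' v) {t : S.Tm}
    {A : S.Ty} (h : HasTy W L t A) : t.sub s = t.sub s' := by
  induction h with
  | var h => exact hs _ _ h
  | @app f σ _ h₂ _ ih =>
    simp only [RTm.sub_app, RTm.app.injEq, true_and]
    funext i
    by_cases hi : i < (S.bdTm f).length
    · obtain ⟨A, hA⟩ := Look.exists_of_lt hi
      exact ih i A hA
    · rw [h₂ i (not_lt.1 hi)]; rfl

theorem IsSub.sub_congr {s s' : ℕ ⊕ ℕ → S.Tm} (hs : ∀ v A, L v A → s v = s' v) {Φ : S.Con}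
    {σ : ℕ → S.Tm} (h : IsSub W L Φ σ) (i : ℕ) : (σ i).sub s = (σ i).sub s' := by
  by_cases hi : i < Φ.length
  · obtain ⟨A, hA⟩ := Look.exists_of_lt hi
    exact (h.typed i A hA).sub_congr hs
  · rw [h.junk i (not_lt.1 hi)]; rfl

theorem WTy.sub_congr {s s' : ℕ ⊕ ℕ → S.Tm} (hs : ∀ v A, L v A → s v = s' v) {A : S.Ty}
    (h : WTy W L A) : A.sub s = A.sub s' := by
  ext1
  · rfl
  · funext i; exact h.args.sub_congr hs i

theorem RTm.sub_var_id {G : Type u} (t : RTm G) : t.sub .var = t := by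
  induction t with
  | junk => rfl
  | var v => rfl
  | app f σ ih => simp [ih]

theorem RTy.sub_var_id {GTy GTm : Type u} (A : RTy GTy GTm) : A.sub .var = A := by
  ext1
  · rfl
  · funext i; exact RTm.sub_var_id _

theorem HasTy.sub {s : ℕ ⊕ ℕ → S.Tm} (hs : ∀ v A, L v A → HasTy W' L' (s v) (A.sub s))
    (hW : W ⊆ W') {t : S.Tm} {A : S.Ty} (h : HasTy W L t A) :
    HasTy W' L' (t.sub s) (A.sub s) := by
  induction h with
  | var h => exact hs _ _ h
  | @app f σ h₁ h₂ _ ih =>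
    rw [RTy.sub_inst_sub]
    refine .app (hW h₁) (fun i hi => by rw [h₂ i hi]; rfl) fun i A hA => ?_
    have := ih i A hA
    rwa [RTy.sub_inst_sub] at this

theorem IsSub.sub {s : ℕ ⊕ ℕ → S.Tm} (hs : ∀ v A, L v A → HasTy W' L' (s v) (A.sub s))
    (hW : W ⊆ W') {Φ : S.Con} {σ : ℕ → S.Tm} (h : IsSub W L Φ σ) :
    IsSub W' L' Φ fun i => (σ i).sub s := by
  refine ⟨fun i hi => by rw [h.junk i hi]; rfl, fun i A hA => ?_⟩
  have := (h.typed i A hA).sub hs hW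
  rwa [RTy.sub_inst_sub] at this

theorem WTy.sub {s : ℕ ⊕ ℕ → S.Tm} (hs : ∀ v A, L v A → HasTy W' L' (s v) (A.sub s))
    (hW : W ⊆ W') {A : S.Ty} (h : WTy W L A) : WTy W' L' (A.sub s) :=
  ⟨hW h.mem, h.args.sub hs hW⟩

theorem IsSub.ctxL {Γ : S.Con} {σ : ℕ → S.Tm} (h : IsSub W L Γ σ) (v : ℕ ⊕ ℕ) (A : S.Ty)
    (hv : ctxL Γ v A) : HasTy W L (inst σ v) (A.sub (inst σ)) := by
  obtain ⟨i, rfl, hA⟩ := hv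
  exact h.typed i A hA

/-- The raw identity substitution of a context of length `n`. -/
def idS {G : Type u} (n : ℕ) (i : ℕ) : RTm G := if i < n then .var (.inl i) else .junk

theorem idS_of_lt {G : Type u} {n i : ℕ} (h : i < n) : (idS n i : RTm G) = .var (.inl i) := if_pos h

theorem idS_of_le {G : Type u} {n i : ℕ} (h : n ≤ i) : (idS n i : RTm G) = .junk :=
  if_neg (not_lt.2 h)

theorem inst_idS {Γ : S.Con} {n : ℕ} (hn : Γ.length ≤ n) (v : ℕ ⊕ ℕ) (A : S.Ty)
    (h : ctxL Γ v A) : (inst (idS n) v : S.Tm) = .var v := by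
  obtain ⟨i, rfl, h⟩ := h
  exact idS_of_lt (h.lt.trans_le hn)

theorem HasTy.sub_idS {Γ : S.Con} {n : ℕ} (hn : Γ.length ≤ n) {t : S.Tm} {A : S.Ty}
    (h : HasTy W (ctxL Γ) t A) : t.sub (inst (idS n)) = t :=
  (h.sub_congr (inst_idS hn)).trans (RTm.sub_var_id t)

theorem IsSub.sub_idS {Γ Φ : S.Con} {n : ℕ} (hn : Γ.length ≤ n) {σ : ℕ → S.Tm}
    (h : IsSub W (FreeCwF.ctxL Γ) Φ σ) (i : ℕ) : (σ i).sub (inst (idS n)) = σ i :=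
  (h.sub_congr (inst_idS hn) i).trans (RTm.sub_var_id _)

theorem WTy.sub_idS {Γ : S.Con} {n : ℕ} (hn : Γ.length ≤ n) {A : S.Ty}
    (h : WTy W (ctxL Γ) A) : A.sub (inst (idS n)) = A :=
  (h.sub_congr (inst_idS hn)).trans (RTy.sub_var_id A)

theorem WCon.look {Γ : S.Con} (h : WCon W Γ) {i : ℕ} {A : S.Ty} (hA : Look Γ i A) :
    WTy W (ctxL Γ) A := by
  induction h with
  | nil => exact hA.elim
  | cons _ hB ih =>
    rcases hA with ⟨-, rfl⟩ | hA
    · exact hB.mono subset_rfl ctxL_there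
    · exact (ih hA).mono subset_rfl ctxL_there

/-- Variables are counted from the left, so weakening leaves raw syntax unchanged. The same raw
identity is both the identity of `Γ` and the projection from an extension of `Γ`. -/
theorem WCon.isSub_idS {Γ Δ : S.Con} (h : WCon W Γ)
    (hL : ∀ i A, Look Γ i A → Look Δ i A) : IsSub W (ctxL Δ) Γ (idS Γ.length) where
  junk _ := idS_of_le
  typed i A hA := by
    rw [idS_of_lt hA.lt, (h.look hA).sub_idS le_rfl]
    exact .var ⟨i, rfl, hL i A hA⟩

theorem IsSub.update {Γ : S.Con} {A : S.Ty} {σ : ℕ → S.Tm} {t : S.Tm} (h : IsSub W L Γ σ)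
    (hΓ : WCon W' (A :: Γ)) (ht : HasTy W L t (A.sub (inst σ))) :
    IsSub W L (A :: Γ) (Function.update σ Γ.length t) := by
  cases hΓ with | cons hΓ hA =>
  -- The types in `Γ` and the type `A` mention only variables below `Γ.length`, so they do not see
  -- the updated entry.
  have key : ∀ v B, FreeCwF.ctxL Γ v B →
      inst σ v = inst (Function.update σ Γ.length t) v := by
    rintro _ B ⟨i, rfl, hB⟩
    simp only [inst_inl]
    rw [Function.update_of_ne hB.lt.ne]
  refine ⟨fun i hi => ?_, fun i B hB => ?_⟩
  · rw [Function.update_of_ne (by simp only [List.length_cons] at hi; omega)]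
    exact h.junk i (by simp only [List.length_cons] at hi; omega)
  · rcases hB with ⟨rfl, rfl⟩ | hB
    · rw [Function.update_self, ← hA.sub_congr key]; exact ht
    · rw [Function.update_of_ne hB.lt.ne, ← (hΓ.look hB).sub_congr key]
      exact h.typed i B hB

end FreeCwF

namespace FreeCwF

variable {S : Sig.{u}}

/-! ### The syntactic CwF -/

/-- Contexts of the syntactic CwF. -/
structure DCtx (W : Set S.Sym) : Type u where
  raw : S.Con
  wf : WCon W raw

/-- Substitutions of the syntactic CwF. -/
@[ext]
structure DHom {W : Set S.Sym} (Δ Γ : DCtx W) : Type u where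
  raw : ℕ → S.Tm
  wf : IsSub W (ctxL Δ.raw) Γ.raw raw

/-- Types of the syntactic CwF. -/
@[ext]
structure DTy {W : Set S.Sym} (Γ : DCtx W) : Type u where
  raw : S.Ty
  wf : WTy W (ctxL Γ.raw) raw

/-- Terms of the syntactic CwF, with their types. -/
structure DTm {W : Set S.Sym} (Γ : DCtx W) : Type u where
  raw : S.Tm
  ty : DTy Γ
  wf : HasTy W (ctxL Γ.raw) raw ty.raw

variable {W : Set S.Sym}

-- The raw term determines its type by `HasTy.unique`, so the type and the proof carry no
-- information.
@[ext]
theorem DTm.ext {Γ : DCtx W} {a b : DTm Γ} (h : a.raw = b.raw) : a = b := by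
  obtain ⟨t, A, ha⟩ := a
  obtain ⟨t', B, hb⟩ := b
  obtain rfl : t = t' := h
  obtain rfl : A = B := DTy.ext (ha.unique ctxL_unique hb)
  rfl

instance : Category (DCtx W) where
  Hom := DHom
  id Γ := ⟨idS Γ.raw.length, Γ.wf.isSub_idS fun _ _ => id⟩
  comp σ τ := ⟨fun i => (τ.raw i).sub (inst σ.raw), τ.wf.sub σ.wf.ctxL subset_rfl⟩
  id_comp τ := DHom.ext (funext fun i => τ.wf.sub_idS le_rfl i)
  comp_id {Δ Γ} τ := DHom.ext <| funext fun i => by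
    change (idS Γ.raw.length i).sub (inst τ.raw) = τ.raw i
    by_cases hi : i < Γ.raw.length
    · rw [idS_of_lt hi]; rfl
    · rw [idS_of_le (not_lt.1 hi), τ.wf.junk i (not_lt.1 hi)]; rfl
  assoc σ τ υ := DHom.ext (funext fun i => (sub_inst_sub (υ.raw i) τ.raw (inst σ.raw)).symm)

theorem DCtx.hom_ext {Δ Γ : DCtx W} {σ τ : Δ ⟶ Γ}
    (h : ∀ i < Γ.raw.length, DHom.raw σ i = DHom.raw τ i) : σ = τ := by
  refine DHom.ext (funext fun i => ?_)
  by_cases hi : i < Γ.raw.length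
  · exact h i hi
  · rw [σ.wf.junk i (not_lt.1 hi), τ.wf.junk i (not_lt.1 hi)]

/-- The syntactic CwF on the symbols in `W`. -/
def D (W : Set S.Sym) : CwF.{u} where
  Ctx := DCtx W
  nil := ⟨[], .nil⟩
  nilTerminal := Limits.IsTerminal.ofUniqueHom
    (fun Γ => (⟨fun _ => .junk, ⟨fun _ _ => rfl, fun _ _ h => h.elim⟩⟩ : DHom Γ ⟨[], .nil⟩))
    (fun _ _ => DCtx.hom_ext fun _ h => absurd h (Nat.not_lt_zero _))
  Ty Γ := DTy Γ
  tySub σ A := ⟨A.raw.sub (inst (DHom.raw σ)), A.wf.sub (DHom.wf σ).ctxL subset_rfl⟩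
  tySub_id A := DTy.ext (A.wf.sub_idS le_rfl)
  tySub_comp τ σ A := DTy.ext (RTy.sub_inst_sub A.raw (DHom.raw σ) (inst (DHom.raw τ))).symm
  Tm Γ := DTm Γ
  tmSub σ a := ⟨a.raw.sub (inst (DHom.raw σ)),
    ⟨a.ty.raw.sub (inst (DHom.raw σ)), a.ty.wf.sub (DHom.wf σ).ctxL subset_rfl⟩,
    a.wf.sub (DHom.wf σ).ctxL subset_rfl⟩
  tmSub_id a := DTm.ext (a.wf.sub_idS le_rfl)
  tmSub_comp τ σ a := DTm.ext (sub_inst_sub a.raw (DHom.raw σ) (inst (DHom.raw τ))).symm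
  tp a := a.ty
  tp_sub _ _ := rfl
  ext {Γ} A := ⟨A.raw :: Γ.raw, .cons Γ.wf A.wf⟩
  p {Γ} _ := (⟨idS Γ.raw.length, Γ.wf.isSub_idS fun _ _ => Look.there⟩ : DHom _ _)
  q {Γ} A := ⟨.var (.inl Γ.raw.length), ⟨A.raw, A.wf.mono subset_rfl ctxL_there⟩,
    .var ⟨_, rfl, Look.here⟩⟩
  tp_q A := DTy.ext (A.wf.sub_idS le_rfl).symm
  pair {Δ Γ A} σ a h := (⟨Function.update (DHom.raw σ) Γ.raw.length a.raw,
    (DHom.wf σ).update (.cons Γ.wf A.wf) (by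
      have := a.wf
      rwa [h] at this)⟩ : DHom _ _)
  pair_p {Δ Γ A} σ a h := DCtx.hom_ext fun i hi => by
    change (idS Γ.raw.length i).sub (inst (Function.update (DHom.raw σ) Γ.raw.length a.raw)) = _
    rw [idS_of_lt hi, RTm.sub_var, inst_inl, Function.update_of_ne hi.ne]
  q_pair {Δ Γ A} σ a h := DTm.ext (Function.update_self _ _ _)
  ext_hom {Δ Γ A} σ τ h h' := DCtx.hom_ext fun i hi => by
    rcases Nat.lt_succ_iff_lt_or_eq.1 hi with hi | rfl
    · have := congrFun (congrArg DHom.raw h) i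
      change (idS Γ.raw.length i).sub (inst (DHom.raw σ)) =
        (idS Γ.raw.length i).sub (inst (DHom.raw τ)) at this
      rwa [idS_of_lt hi] at this
    · exact congrArg DTm.raw h'

section Raw

variable {Δ Γ Θ : (D W).Ctx}

/-- The raw context underlying a context. -/
def rc (Γ : (D W).Ctx) : S.Con := DCtx.raw Γ
/-- The raw substitution underlying a substitution. -/
def rh (σ : Δ ⟶ Γ) : ℕ → S.Tm := DHom.raw σ
/-- The raw type underlying a type. -/
def rt (A : (D W).Ty Γ) : S.Ty := DTy.raw A
/-- The raw term underlying a term. -/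
def rm (a : (D W).Tm Γ) : S.Tm := DTm.raw a

/-- A well-formed raw context as a context. -/
def mkC (Γ : S.Con) (h : WCon W Γ) : (D W).Ctx := (⟨Γ, h⟩ : DCtx W)
/-- A well-typed raw substitution as a substitution. -/
def mkH (σ : ℕ → S.Tm) (h : IsSub W (ctxL (rc Δ)) (rc Γ) σ) : Δ ⟶ Γ := (⟨σ, h⟩ : DHom _ _)
/-- A well-formed raw type as a type. -/
def mkT (A : S.Ty) (h : WTy W (ctxL (rc Γ)) A) : (D W).Ty Γ := (⟨A, h⟩ : DTy _)
/-- A well-typed raw term as a term. -/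
def mkM (t : S.Tm) (A : (D W).Ty Γ) (h : HasTy W (ctxL (rc Γ)) t (rt A)) : (D W).Tm Γ :=
  (⟨t, A, h⟩ : DTm _)

theorem rc_wf (Γ : (D W).Ctx) : WCon W (rc Γ) := DCtx.wf Γ
theorem rh_wf (σ : Δ ⟶ Γ) : IsSub W (ctxL (rc Δ)) (rc Γ) (rh σ) := DHom.wf σ
theorem rt_wf (A : (D W).Ty Γ) : WTy W (ctxL (rc Γ)) (rt A) := DTy.wf A
theorem rm_wf (a : (D W).Tm Γ) : HasTy W (ctxL (rc Γ)) (rm a) (rt ((D W).tp a)) := DTm.wf a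

@[simp] theorem rc_mkC (Γ : S.Con) (h : WCon W Γ) : rc (mkC Γ h) = Γ := rfl
@[simp] theorem rt_mkT (A : S.Ty) (h : WTy W (ctxL (rc Γ)) A) : rt (mkT A h) = A := rfl
theorem rh_comp (σ : Δ ⟶ Γ) (τ : Γ ⟶ Θ) :
    rh (σ ≫ τ) = fun i => (rh τ i).sub (inst (rh σ)) := rfl

@[simp] theorem rh_id : rh (𝟙 Γ) = idS (rc Γ).length := rfl

@[simp] theorem rt_tySub (σ : Δ ⟶ Γ) (A : (D W).Ty Γ) :
    rt ((D W).tySub σ A) = (rt A).sub (inst (rh σ)) := rfl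

@[simp] theorem rm_tmSub (σ : Δ ⟶ Γ) (a : (D W).Tm Γ) :
    rm ((D W).tmSub σ a) = (rm a).sub (inst (rh σ)) := rfl

@[simp] theorem rc_ext (A : (D W).Ty Γ) : rc ((D W).ext A) = rt A :: rc Γ := rfl

@[simp] theorem rh_p (A : (D W).Ty Γ) : rh ((D W).p A) = idS (rc Γ).length := rfl

theorem rh_eqToHom (h : Δ = Γ) : rh (eqToHom h) = idS (rc Γ).length := by subst h; rfl

theorem D.ty_ext {A B : (D W).Ty Γ} (h : rt A = rt B) : A = B := DTy.ext h

theorem D.tm_ext {a b : (D W).Tm Γ} (h : rm a = rm b) : a = b := DTm.ext h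

theorem D.hom_ext {σ τ : Δ ⟶ Γ} (h : ∀ i < (rc Γ).length, rh σ i = rh τ i) : σ = τ :=
  DCtx.hom_ext h

theorem rt_sub_idS {n : ℕ} (hn : (rc Γ).length ≤ n) (A : (D W).Ty Γ) :
    (rt A).sub (inst (idS n)) = rt A := (rt_wf A).sub_idS hn

theorem rh_sub_idS {n : ℕ} (hn : (rc Δ).length ≤ n) (σ : Δ ⟶ Γ) (i : ℕ) :
    (rh σ i).sub (inst (idS n)) = rh σ i := (rh_wf σ).sub_idS hn i

end Raw

/-- The inclusion of syntactic CwFs. -/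
def inc {W W' : Set S.Sym} (h : W ⊆ W') : D W ⟶ D W' where
  obj Γ := mkC (rc Γ) ((rc_wf Γ).mono h)
  map σ := mkH (rh σ) (by rw [rc_mkC, rc_mkC]; exact (rh_wf σ).mono h fun _ _ => id)
  map_id _ := rfl
  map_comp _ _ := rfl
  ty A := mkT (rt A) (by rw [rc_mkC]; exact (rt_wf A).mono h fun _ _ => id)
  ty_sub _ _ := rfl
  tm a := mkM (rm a)
    (mkT (rt ((D W).tp a)) (by rw [rc_mkC]; exact (rt_wf _).mono h fun _ _ => id))
    (by rw [rt_mkT]; exact (rm_wf a).mono h fun _ _ => id)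
  tm_sub _ _ := rfl
  tp_tm _ := rfl
  obj_nil := rfl
  obj_ext _ := rfl
  map_p {Γ} A := D.hom_ext fun i hi => by
    have hi' : i < (rc Γ).length := hi
    refine (idS_of_lt hi').trans ?_
    rw [rh_comp, rh_p]
    refine .trans ?_ (congrArg (fun t : S.Tm => t.sub _) (idS_of_lt hi')).symm
    refine .trans ?_ (congrFun (rh_eqToHom _) i).symm
    exact (idS_of_lt (hi'.trans (Nat.lt_succ_self _))).symm
  tm_q {Γ} A := D.tm_ext <| by
    rw [rm_tmSub]
    refine .trans ?_ (congrFun (rh_eqToHom _) (rc Γ).length).symm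
    exact (idS_of_lt (Nat.lt_succ_self _)).symm

end FreeCwF

namespace FreeCwF

variable {S : Sig.{u}} {E : CwF.{u}}

/-! ### Evaluation of raw syntax in a CwF -/

/-- A relational interpretation of the symbols of a signature in a CwF: contexts with a list
of variables, and a type or a term over this context. -/
structure Val (S : Sig.{u}) (E : CwF.{u}) where
  ty : S.GTy → (Y : E.Ctx) → List (E.Tm Y) → E.Ty Y → Prop
  tm : S.GTm → (Y : E.Ctx) → List (E.Tm Y) → E.Tm Y → Prop

/-- The terms in `v` are jointly monic. -/
def JointlyMonic {Y : E.Ctx} (v : List (E.Tm Y)) : Prop :=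
  ∀ ⦃X : E.Ctx⦄ (m m' : X ⟶ Y),
    (∀ i b, Look v i b → E.tmSub m b = E.tmSub m' b) → m = m'

/-- The interpretation of a symbol is unique, and its variables are jointly monic. -/
structure Val.Functional (M : Val S E) : Prop where
  ty_unique : ∀ {T Y v B Y' v' B'}, M.ty T Y v B → M.ty T Y' v' B' →
    (⟨Y, v, B⟩ : Σ Y : E.Ctx, List (E.Tm Y) × E.Ty Y) = ⟨Y', v', B'⟩
  tm_unique : ∀ {f Y v b Y' v' b'}, M.tm f Y v b → M.tm f Y' v' b' →
    (⟨Y, v, b⟩ : Σ Y : E.Ctx, List (E.Tm Y) × E.Tm Y) = ⟨Y', v', b'⟩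
  ty_monic : ∀ {T Y v B}, M.ty T Y v B → JointlyMonic v
  tm_monic : ∀ {f Y v b}, M.tm f Y v b → JointlyMonic v

instance : LE (Val S E) where
  le M M' := (∀ T Y v B, M.ty T Y v B → M'.ty T Y v B) ∧ ∀ f Y v b, M.tm f Y v b → M'.tm f Y v b

variable {M M' : Val S E} {X Y : E.Ctx}

/-- Evaluation of raw terms in an environment. -/
inductive EvTm (M : Val S E) {X : E.Ctx} (ρ : List (E.Tm X)) : S.Tm → E.Tm X → Prop
  | var {i : ℕ} {a : E.Tm X} : Look ρ i a → EvTm M ρ (.var (.inl i)) a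
  | app {f : S.GTm} {σ : ℕ → S.Tm} {Y : E.Ctx} {v : List (E.Tm Y)} {a : E.Tm Y} (m : X ⟶ Y) :
      M.tm f Y v a → (∀ i b, Look v i b → EvTm M ρ (σ i) (E.tmSub m b)) →
      EvTm M ρ (.app f σ) (E.tmSub m a)

/-- The raw substitution `σ` evaluates to the morphism `m`. -/
def EvSub (M : Val S E) (ρ : List (E.Tm X)) (σ : ℕ → S.Tm) (v : List (E.Tm Y)) (m : X ⟶ Y) : Prop :=
  ∀ i b, Look v i b → EvTm M ρ (σ i) (E.tmSub m b)

/-- Evaluation of raw types in an environment. -/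
inductive EvTy (M : Val S E) {X : E.Ctx} (ρ : List (E.Tm X)) : S.Ty → E.Ty X → Prop
  | mk {A : S.Ty} {Y : E.Ctx} {v : List (E.Tm Y)} {B : E.Ty Y} (m : X ⟶ Y) :
      M.ty A.head Y v B → EvSub M ρ A.args v m → EvTy M ρ A (E.tySub m B)

/-- Evaluation of raw contexts. -/
inductive EvCon (M : Val S E) : S.Con → (Y : E.Ctx) → List (E.Tm Y) → Prop
  | nil : EvCon M [] E.nil []
  | cons {Γ : S.Con} {A : S.Ty} {Y : E.Ctx} {v : List (E.Tm Y)} {B : E.Ty Y} :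
      EvCon M Γ Y v → EvTy M v A B →
      EvCon M (A :: Γ) (E.ext B) (E.q B :: v.map (E.tmSub (E.p B)))

theorem EvTm.mono (hM : M ≤ M') {ρ ρ' : List (E.Tm X)} (hρ : ∀ i a, Look ρ i a → Look ρ' i a)
    {t : S.Tm} {a : E.Tm X} (h : EvTm M ρ t a) : EvTm M' ρ' t a := by
  induction h with
  | var h => exact .var (hρ _ _ h)
  | app m h _ ih => exact .app m (hM.2 _ _ _ _ h) ih

theorem EvSub.mono (hM : M ≤ M') {ρ ρ' : List (E.Tm X)} (hρ : ∀ i a, Look ρ i a → Look ρ' i a)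
    {σ : ℕ → S.Tm} {v : List (E.Tm Y)} {m : X ⟶ Y} (h : EvSub M ρ σ v m) : EvSub M' ρ' σ v m :=
  fun i b hb => (h i b hb).mono hM hρ

theorem EvTy.mono (hM : M ≤ M') {ρ ρ' : List (E.Tm X)} (hρ : ∀ i a, Look ρ i a → Look ρ' i a)
    {A : S.Ty} {B : E.Ty X} (h : EvTy M ρ A B) : EvTy M' ρ' A B := by
  obtain ⟨m, h, hm⟩ := h
  exact ⟨m, hM.1 _ _ _ _ h, hm.mono hM hρ⟩

theorem EvCon.mono (hM : M ≤ M') {Γ : S.Con} {v : List (E.Tm Y)} (h : EvCon M Γ Y v) :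
    EvCon M' Γ Y v := by
  induction h with
  | nil => exact .nil
  | cons _ h ih => exact .cons ih (h.mono hM fun _ _ => id)

theorem Val.le_refl (M : Val S E) : M ≤ M := ⟨fun _ _ _ _ => id, fun _ _ _ _ => id⟩

theorem EvTm.map {ρ : List (E.Tm Y)} {t : S.Tm} {a : E.Tm Y} (h : EvTm M ρ t a) (m : X ⟶ Y) :
    EvTm M (ρ.map (E.tmSub m)) t (E.tmSub m a) := by
  induction h with
  | var h => exact .var h.map
  | app m' h _ ih =>
    rw [← E.tmSub_comp]
    exact .app _ h fun i b hb => by rw [E.tmSub_comp]; exact ih i b hb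

theorem EvTy.map {ρ : List (E.Tm Y)} {A : S.Ty} {B : E.Ty Y} (h : EvTy M ρ A B) (m : X ⟶ Y) :
    EvTy M (ρ.map (E.tmSub m)) A (E.tySub m B) := by
  obtain ⟨m', h, hm⟩ := h
  rw [← E.tySub_comp]
  exact .mk _ h fun i b hb => by rw [E.tmSub_comp]; exact (hm i b hb).map m

theorem EvTm.sub {ρ : List (E.Tm X)} {v : List (E.Tm Y)} {σ : ℕ → S.Tm} {m : X ⟶ Y}
    (hm : EvSub M ρ σ v m) {t : S.Tm} {a : E.Tm Y} (h : EvTm M v t a) :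
    EvTm M ρ (t.sub (inst σ)) (E.tmSub m a) := by
  induction h with
  | var h => exact hm _ _ h
  | app m' h _ ih =>
    rw [← E.tmSub_comp]
    exact .app _ h fun i b hb => by rw [E.tmSub_comp]; exact ih i b hb

theorem EvSub.comp {Z : E.Ctx} {ρ : List (E.Tm X)} {v : List (E.Tm Y)} {w : List (E.Tm Z)}
    {σ τ : ℕ → S.Tm} {m : X ⟶ Y} {m' : Y ⟶ Z}
    (hm : EvSub M ρ σ v m) (hm' : EvSub M v τ w m') :
    EvSub M ρ (fun i => (τ i).sub (inst σ)) w (m ≫ m') := fun i b hb => by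
  rw [E.tmSub_comp]; exact (hm' i b hb).sub hm

theorem EvTy.sub {ρ : List (E.Tm X)} {v : List (E.Tm Y)} {σ : ℕ → S.Tm} {m : X ⟶ Y}
    (hm : EvSub M ρ σ v m) {A : S.Ty} {B : E.Ty Y} (h : EvTy M v A B) :
    EvTy M ρ (A.sub (inst σ)) (E.tySub m B) := by
  obtain ⟨m', h, hm'⟩ := h
  rw [← E.tySub_comp]
  exact .mk _ h (hm.comp hm')

/-- Evaluating the arguments only determines the restrictions of the variables along `m`; joint
monicity recovers `m` itself. -/
theorem EvTm.unique (hM : M.Functional) {ρ : List (E.Tm X)} {t : S.Tm} {a b : E.Tm X}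
    (h : EvTm M ρ t a) (h' : EvTm M ρ t b) : a = b := by
  induction h generalizing b with
  | var h => cases h' with | var h' => exact h.unique h'
  | app m h _ ih =>
    cases h' with | app m' h' hm' =>
    cases hM.tm_unique h h'
    rw [hM.tm_monic h m m' fun i b hb => ih i b hb (hm' i b hb)]

theorem EvSub.unique (hM : M.Functional) {ρ : List (E.Tm X)} {v : List (E.Tm Y)} {σ : ℕ → S.Tm}
    {m m' : X ⟶ Y} (hv : JointlyMonic v) (h : EvSub M ρ σ v m) (h' : EvSub M ρ σ v m') : m = m' :=
  hv m m' fun i b hb => (h i b hb).unique hM (h' i b hb)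

theorem EvTy.unique (hM : M.Functional) {ρ : List (E.Tm X)} {A : S.Ty} {B B' : E.Ty X}
    (h : EvTy M ρ A B) (h' : EvTy M ρ A B') : B = B' := by
  obtain ⟨m, h, hm⟩ := h
  obtain ⟨m', h', hm'⟩ := h'
  cases hM.ty_unique h h'
  rw [hm.unique hM (hM.ty_monic h) hm']

theorem EvCon.unique (hM : M.Functional) {Γ : S.Con} {v : List (E.Tm Y)} {Y' : E.Ctx}
    {v' : List (E.Tm Y')} (h : EvCon M Γ Y v) (h' : EvCon M Γ Y' v') :
    (⟨Y, v⟩ : Σ Y : E.Ctx, List (E.Tm Y)) = ⟨Y', v'⟩ := by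
  induction h generalizing Y' with
  | nil => cases h'; rfl
  | cons _ hA ih =>
    cases h' with | cons h' hA' =>
    cases ih h'
    cases hA.unique hM hA'
    rfl

theorem EvCon.length {Γ : S.Con} {v : List (E.Tm Y)} (h : EvCon M Γ Y v) :
    v.length = Γ.length := by
  induction h with
  | nil => rfl
  | cons _ _ ih => simp [ih]

theorem EvCon.jointlyMonic {Γ : S.Con} {v : List (E.Tm Y)} (h : EvCon M Γ Y v) :
    JointlyMonic v := by
  induction h with
  | nil => exact fun X m m' _ => E.nilTerminal.hom_ext m m'
  | cons _ _ ih =>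
    refine fun X m m' hm => E.ext_hom m m' (ih _ _ fun i b hb => ?_) (hm _ _ .here)
    rw [E.tmSub_comp, E.tmSub_comp]
    exact hm _ _ hb.map.there

/-- The environment `ρ` is a well-typed interpretation of the variables of `Γ`. -/
def EnvOK (M : Val S E) (Γ : S.Con) (ρ : List (E.Tm X)) : Prop :=
  ∀ i A, Look Γ i A → ∃ c, Look ρ i c ∧ EvTy M ρ A (E.tp c)

theorem EvCon.envOK {Γ : S.Con} {v : List (E.Tm Y)} (h : EvCon M Γ Y v) : EnvOK M Γ v := by
  induction h with
  | nil => exact fun _ _ h => h.elim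
  | @cons Γ A Y v B h hA ih =>
    rintro i A' (⟨rfl, rfl⟩ | hA')
    · refine ⟨E.q B, .inl ⟨by simp [h.length], rfl⟩, ?_⟩
      rw [E.tp_q]
      exact (hA.map _).mono M.le_refl fun _ _ => .there
    · obtain ⟨c, hc, hc'⟩ := ih i A' hA'
      refine ⟨_, hc.map.there, ?_⟩
      rw [E.tp_sub]
      exact (hc'.map _).mono M.le_refl fun _ _ => .there

/-- The morphism is built by pairing along the context. The typing condition for a pair holds
because `A.sub (inst σ)` evaluates both to the type of `c` and to the reindexing of `B` along `m`,
and evaluation of types is unique. -/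
theorem EvCon.exists_evSub (hM : M.Functional) {Φ : S.Con} {v : List (E.Tm Y)}
    (h : EvCon M Φ Y v) {ρ : List (E.Tm X)} {σ : ℕ → S.Tm}
    (hσ : ∀ i A, Look Φ i A → ∃ c, EvTm M ρ (σ i) c ∧ EvTy M ρ (A.sub (inst σ)) (E.tp c)) :
    ∃ m : X ⟶ Y, EvSub M ρ σ v m := by
  induction h with
  | nil => exact ⟨E.nilTerminal.from X, fun _ _ h => h.elim⟩
  | @cons Φ A Y v B h hA ih =>
    obtain ⟨m, hm⟩ := ih fun i A' hA' => hσ i A' hA'.there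
    obtain ⟨c, hc, hc'⟩ := hσ _ _ Look.here
    refine ⟨E.pair m c (hc'.unique hM (hA.sub hm)), ?_⟩
    rintro i b (⟨rfl, rfl⟩ | hb)
    · rw [E.q_pair, List.length_map, h.length]; exact hc
    · obtain ⟨b, hb', rfl⟩ := Look.map_iff.1 hb
      rw [← E.tmSub_comp, E.pair_p]
      exact hm i b hb'

/-- An interpretation of all symbols of `W`, compatible with the signature. -/
structure Val.Models (M : Val S E) (W : Set S.Sym) : Prop extends M.Functional where
  ty_total : ∀ T, .inl T ∈ W → ∃ Y v B, M.ty T Y v B ∧ EvCon M (S.bdTy T) Y v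
  tm_total : ∀ f, .inr f ∈ W → ∃ Y v b, M.tm f Y v b ∧ EvCon M (S.bdTm f) Y v ∧
    EvTy M v (S.out f) (E.tp b)

section Models

variable {W : Set S.Sym}

theorem EnvOK.exists_evTm (hM : M.Models W) {Γ : S.Con} {ρ : List (E.Tm X)}
    (hρ : EnvOK M Γ ρ) {t : S.Tm} {A : S.Ty}
    (h : HasTy W (ctxL Γ) t A) : ∃ a, EvTm M ρ t a ∧ EvTy M ρ A (E.tp a) := by
  induction h with
  | var h =>
    obtain ⟨i, rfl, h⟩ := h
    obtain ⟨c, hc, hc'⟩ := hρ i _ h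
    exact ⟨c, .var hc, hc'⟩
  | @app f σ h₁ _ _ ih =>
    obtain ⟨Y, v, b, hf, hv, hb⟩ := hM.tm_total f h₁
    obtain ⟨m, hm⟩ := hv.exists_evSub hM.toFunctional ih
    refine ⟨_, .app m hf hm, ?_⟩
    rw [E.tp_sub]
    exact hb.sub hm

theorem EnvOK.exists_evSub (hM : M.Models W) {Γ Φ : S.Con} {ρ : List (E.Tm X)}
    (hρ : EnvOK M Γ ρ) {σ : ℕ → S.Tm}
    (hσ : IsSub W (ctxL Γ) Φ σ) {v : List (E.Tm Y)} (hv : EvCon M Φ Y v) :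
    ∃ m : X ⟶ Y, EvSub M ρ σ v m :=
  hv.exists_evSub hM.toFunctional fun i A hA => hρ.exists_evTm hM (hσ.typed i A hA)

theorem EnvOK.exists_evTy (hM : M.Models W) {Γ : S.Con} {ρ : List (E.Tm X)}
    (hρ : EnvOK M Γ ρ) {A : S.Ty}
    (h : WTy W (ctxL Γ) A) : ∃ B, EvTy M ρ A B := by
  obtain ⟨Y, v, b, hT, hv⟩ := hM.ty_total _ h.mem
  obtain ⟨m, hm⟩ := hρ.exists_evSub hM h.args hv
  exact ⟨_, .mk m hT hm⟩

theorem WCon.exists_evCon (hM : M.Models W) {Γ : S.Con} (h : WCon W Γ) : ∃ Y v, EvCon M Γ Y v := by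
  induction h with
  | nil => exact ⟨_, _, .nil⟩
  | cons _ hA ih =>
    obtain ⟨Y, v, hv⟩ := ih
    obtain ⟨B, hB⟩ := hv.envOK.exists_evTy hM hA
    exact ⟨_, _, .cons hv hB⟩

end Models

theorem Look.of_sigma_eq {Y Y' : E.Ctx} {v : List (E.Tm Y)} {v' : List (E.Tm Y')}
    (h : (⟨Y, v⟩ : Σ Y : E.Ctx, List (E.Tm Y)) = ⟨Y', v'⟩) (hY : Y = Y') {i : ℕ} {b : E.Tm Y'}
    (hb : Look v' i b) : Look v i (E.tmSub (eqToHom hY) b) := by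
  cases h
  rwa [eqToHom_refl, E.tmSub_id]

-- The morphism determined by an interpretation

namespace Interp

variable {W : Set S.Sym} (hM : M.Models W) {Γ Δ : (D W).Ctx}

/-- The evaluation of a context of the syntactic CwF. -/
noncomputable def obj (Γ : (D W).Ctx) : E.Ctx := ((rc_wf Γ).exists_evCon hM).choose

/-- The variables of the evaluation of a context. -/
noncomputable def vars (Γ : (D W).Ctx) : List (E.Tm (obj hM Γ)) :=
  ((rc_wf Γ).exists_evCon hM).choose_spec.choose

theorem evCon (Γ : (D W).Ctx) : EvCon M (rc Γ) (obj hM Γ) (vars hM Γ) :=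
  ((rc_wf Γ).exists_evCon hM).choose_spec.choose_spec

/-- The evaluation of a type of the syntactic CwF. -/
noncomputable def ty (A : (D W).Ty Γ) : E.Ty (obj hM Γ) :=
  ((evCon hM Γ).envOK.exists_evTy hM (rt_wf A)).choose

theorem evTy (A : (D W).Ty Γ) : EvTy M (vars hM Γ) (rt A) (ty hM A) :=
  ((evCon hM Γ).envOK.exists_evTy hM (rt_wf A)).choose_spec

/-- The evaluation of a term of the syntactic CwF. -/
noncomputable def tm (a : (D W).Tm Γ) : E.Tm (obj hM Γ) :=
  ((evCon hM Γ).envOK.exists_evTm hM (rm_wf a)).choose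

theorem evTm (a : (D W).Tm Γ) : EvTm M (vars hM Γ) (rm a) (tm hM a) :=
  ((evCon hM Γ).envOK.exists_evTm hM (rm_wf a)).choose_spec.1

theorem evTy_tp (a : (D W).Tm Γ) : EvTy M (vars hM Γ) (rt ((D W).tp a)) (E.tp (tm hM a)) :=
  ((evCon hM Γ).envOK.exists_evTm hM (rm_wf a)).choose_spec.2

/-- The evaluation of a substitution of the syntactic CwF. -/
noncomputable def map (σ : Δ ⟶ Γ) : obj hM Δ ⟶ obj hM Γ :=
  ((evCon hM Δ).envOK.exists_evSub hM (rh_wf σ) (evCon hM Γ)).choose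

theorem evSub (σ : Δ ⟶ Γ) : EvSub M (vars hM Δ) (rh σ) (vars hM Γ) (map hM σ) :=
  ((evCon hM Δ).envOK.exists_evSub hM (rh_wf σ) (evCon hM Γ)).choose_spec

theorem map_unique {σ : Δ ⟶ Γ} {m : obj hM Δ ⟶ obj hM Γ}
    (h : EvSub M (vars hM Δ) (rh σ) (vars hM Γ) m) : map hM σ = m :=
  (evSub hM σ).unique hM.toFunctional (evCon hM Γ).jointlyMonic h

theorem tm_unique {a : (D W).Tm Γ} {b : E.Tm (obj hM Γ)} (h : EvTm M (vars hM Γ) (rm a) b) :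
    tm hM a = b := (evTm hM a).unique hM.toFunctional h

theorem ty_unique {A : (D W).Ty Γ} {B : E.Ty (obj hM Γ)} (h : EvTy M (vars hM Γ) (rt A) B) :
    ty hM A = B := (evTy hM A).unique hM.toFunctional h

theorem obj_ext (A : (D W).Ty Γ) :
    (⟨obj hM ((D W).ext A), vars hM ((D W).ext A)⟩ : Σ Y : E.Ctx, List (E.Tm Y)) =
      ⟨E.ext (ty hM A), E.q (ty hM A) :: (vars hM Γ).map (E.tmSub (E.p (ty hM A)))⟩ :=
  (evCon hM _).unique hM.toFunctional (.cons (evCon hM Γ) (evTy hM A))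

end Interp

/-- The morphism out of the syntactic CwF given by an interpretation of the symbols. -/
noncomputable def interp {W : Set S.Sym} (hM : M.Models W) : D W ⟶ E where
  obj := Interp.obj hM
  map := Interp.map hM
  map_id Γ := Interp.map_unique hM fun i b hb => by
    rw [E.tmSub_id, rh_id, idS_of_lt ((Interp.evCon hM Γ).length ▸ hb.lt)]
    exact .var hb
  map_comp σ τ := Interp.map_unique hM ((Interp.evSub hM σ).comp (Interp.evSub hM τ))
  ty := Interp.ty hM
  ty_sub σ A := Interp.ty_unique hM ((Interp.evTy hM A).sub (Interp.evSub hM σ))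
  tm := Interp.tm hM
  tm_sub σ a := Interp.tm_unique hM ((Interp.evTm hM a).sub (Interp.evSub hM σ))
  tp_tm a := (Interp.evTy_tp hM a).unique hM.toFunctional (Interp.evTy hM _)
  obj_nil := congrArg Sigma.fst ((Interp.evCon hM (D W).nil).unique hM.toFunctional .nil)
  obj_ext A := congrArg Sigma.fst (Interp.obj_ext hM A)
  map_p {Γ} A := Interp.map_unique hM fun i b hb => by
    rw [E.tmSub_comp, rh_p, idS_of_lt ((Interp.evCon hM Γ).length ▸ hb.lt)]
    exact .var (.of_sigma_eq (Interp.obj_ext hM A) _ hb.map.there)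
  tm_q {Γ} A := Interp.tm_unique hM <| by
    refine .var (.of_sigma_eq (Interp.obj_ext hM A) _ (.inl ⟨?_, rfl⟩))
    rw [List.length_map, (Interp.evCon hM Γ).length]
    rfl

end FreeCwF

namespace FreeCwF

variable {S : Sig.{u}} {E : CwF.{u}}

/-! ### Morphisms out of the syntactic CwF -/

/-- The boundaries of the symbols in `W'` are well-formed over `W`. -/
structure BoundedBy (W W' : Set S.Sym) : Prop where
  ty : ∀ {T}, .inl T ∈ W' → WCon W (S.bdTy T)
  tm : ∀ {f}, .inr f ∈ W' → WCon W (S.bdTm f)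
  out : ∀ {f}, .inr f ∈ W' → WTy W (ctxL (S.bdTm f)) (S.out f)

section Generic

variable {W : Set S.Sym}

/-- The type `T(id)` over the boundary of the symbol `T`. -/
def genTy {T : S.GTy} (hT : .inl T ∈ W) (h : WCon W (S.bdTy T)) :
    (D W).Ty (mkC (S.bdTy T) h) :=
  mkT ⟨T, idS (S.bdTy T).length⟩ ⟨hT, h.isSub_idS fun _ _ => id⟩

/-- The term `f(id)` over the boundary of the symbol `f`. -/
def genTm {f : S.GTm} (hf : .inr f ∈ W) (h : WCon W (S.bdTm f))
    (h' : WTy W (ctxL (S.bdTm f)) (S.out f)) : (D W).Tm (mkC (S.bdTm f) h) :=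
  mkM (.app f (idS (S.bdTm f).length)) (mkT (S.out f) h') <| by
    have := HasTy.of_isSub hf (h.isSub_idS fun _ _ => id)
    rwa [h'.sub_idS le_rfl] at this

/-- The substitution `Γ ⟶ ∂T` given by the arguments of a type with head `T`. -/
def argsTy {Γ : (D W).Ctx} (A : (D W).Ty Γ) (h : WCon W (S.bdTy (rt A).head)) :
    Γ ⟶ mkC (S.bdTy (rt A).head) h :=
  mkH (rt A).args (rt_wf A).args

/-- Every type is an instance of its own head symbol. Hence a morphism is determined on types by its
values at generic types, and structure on all types can be defined from structure on generic ones.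
-/
theorem tySub_argsTy {Γ : (D W).Ctx} (A : (D W).Ty Γ) (h : WCon W (S.bdTy (rt A).head)) :
    (D W).tySub (argsTy A h) (genTy (rt_wf A).mem h) = A := D.ty_ext <| by
  ext1
  · rfl
  · funext i
    change (idS _ i).sub (inst (rt A).args) = (rt A).args i
    by_cases hi : i < (S.bdTy (rt A).head).length
    · rw [idS_of_lt hi]; rfl
    · rw [idS_of_le (not_lt.1 hi), (rt_wf A).args.junk i (not_lt.1 hi)]; rfl

theorem tmSub_genTm {Γ : (D W).Ctx} {f : S.GTm} (hf : .inr f ∈ W) (h : WCon W (S.bdTm f))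
    (h' : WTy W (ctxL (S.bdTm f)) (S.out f)) (σ : Γ ⟶ mkC (S.bdTm f) h) :
    rm ((D W).tmSub σ (genTm hf h h')) = .app f (rh σ) := by
  change RTm.app f _ = _
  congr 1
  funext i
  change (idS _ i).sub (inst (rh σ)) = rh σ i
  by_cases hi : i < (S.bdTm f).length
  · rw [idS_of_lt hi]; rfl
  · rw [idS_of_le (not_lt.1 hi), (rh_wf σ).junk i (not_lt.1 hi)]; rfl

/-- The list of variables of a context. -/
def dvars : (Γ : S.Con) → (h : WCon W Γ) → List ((D W).Tm (mkC Γ h))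
  | [], _ => []
  | A :: Γ, h =>
    have hΓ : WCon W Γ := by cases h; assumption
    have hA : WTy W (ctxL Γ) A := by cases h; assumption
    let A' : (D W).Ty (mkC Γ hΓ) := mkT A hA
    (D W).q A' :: (dvars Γ hΓ).map ((D W).tmSub ((D W).p A'))

theorem dvars_length (Γ : S.Con) (h : WCon W Γ) : (dvars Γ h).length = Γ.length := by
  induction Γ with
  | nil => rfl
  | cons A Γ ih => exact congrArg Nat.succ ((List.length_map _).trans (ih _))

theorem rm_of_look_dvars {Γ : S.Con} {h : WCon W Γ} {i : ℕ} {a : (D W).Tm (mkC Γ h)}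
    (ha : Look (dvars Γ h) i a) : rm a = .var (.inl i) := by
  induction Γ with
  | nil => exact ha.elim
  | cons A Γ ih =>
    rcases ha with ⟨rfl, rfl⟩ | ha
    · rw [List.length_map, dvars_length]; rfl
    · obtain ⟨b, hb, rfl⟩ := Look.map_iff.1 ha
      have hb' := ih hb
      have hlt := hb.lt
      rw [dvars_length] at hlt
      change (rm b).sub (inst (idS Γ.length)) = _
      rw [hb', RTm.sub_var, inst_inl, idS_of_lt hlt]

theorem look_dvars {Γ : S.Con} {h : WCon W Γ} {a : (D W).Tm (mkC Γ h)} {i : ℕ}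
    (ha : rm a = .var (.inl i)) : Look (dvars Γ h) i a := by
  have hlt : i < (dvars Γ h).length := by
    have := rm_wf a
    rw [ha] at this
    obtain ⟨j, hj, hl⟩ := this.inv_var
    cases hj
    rw [dvars_length]
    exact hl.lt
  obtain ⟨b, hb⟩ := Look.exists_of_lt hlt
  rwa [D.tm_ext (ha.trans (rm_of_look_dvars hb).symm)]

/-- The list of variables of a context of the syntactic CwF. -/
def cvars (Γ : (D W).Ctx) : List ((D W).Tm Γ) := dvars (rc Γ) (rc_wf Γ)

theorem cvars_length (Γ : (D W).Ctx) : (cvars Γ).length = (rc Γ).length := dvars_length _ _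

theorem cvars_ext {Γ : (D W).Ctx} (A : (D W).Ty Γ) :
    cvars ((D W).ext A) = (D W).q A :: (cvars Γ).map ((D W).tmSub ((D W).p A)) := rfl

theorem look_cvars {Γ : (D W).Ctx} {i : ℕ} {a : (D W).Tm Γ} :
    Look (cvars Γ) i a ↔ rm a = .var (.inl i) :=
  ⟨fun h => rm_of_look_dvars h, fun h => look_dvars h⟩

/-- The images of the variables of a context under a morphism. -/
def hvars (H : D W ⟶ E) (Γ : (D W).Ctx) : List (E.Tm (H.obj Γ)) := (cvars Γ).map H.tm

theorem look_hvars {H : D W ⟶ E} {Γ : (D W).Ctx} {i : ℕ} {b : E.Tm (H.obj Γ)} :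
    Look (hvars H Γ) i b ↔ ∃ a : (D W).Tm Γ, rm a = .var (.inl i) ∧ H.tm a = b := by
  simp only [hvars, Look.map_iff, look_cvars]

theorem hvars_length (H : D W ⟶ E) (Γ : (D W).Ctx) : (hvars H Γ).length = (rc Γ).length := by
  rw [hvars, List.length_map, cvars_length]

/-- The interpretation of the symbols in `W` given by a morphism. -/
def genVal (hW : BoundedBy W W) (H : D W ⟶ E) : Val S E where
  ty T Y v B := ∃ hT : .inl T ∈ W,
    (⟨Y, v, B⟩ : Σ Y : E.Ctx, List (E.Tm Y) × E.Ty Y) =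
      ⟨H.obj (mkC _ (hW.ty hT)), hvars H _, H.ty (genTy hT (hW.ty hT))⟩
  tm f Y v b := ∃ hf : .inr f ∈ W,
    (⟨Y, v, b⟩ : Σ Y : E.Ctx, List (E.Tm Y) × E.Tm Y) =
      ⟨H.obj (mkC _ (hW.tm hf)), hvars H _, H.tm (genTm hf (hW.tm hf) (hW.out hf))⟩

variable (hW : BoundedBy W W) (H : D W ⟶ E)

theorem genVal_ty {T : S.GTy} (hT : .inl T ∈ W) : (genVal hW H).ty T (H.obj (mkC _ (hW.ty hT)))
    (hvars H _) (H.ty (genTy hT (hW.ty hT))) := ⟨hT, rfl⟩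

theorem genVal_tm {f : S.GTm} (hf : .inr f ∈ W) : (genVal hW H).tm f (H.obj (mkC _ (hW.tm hf)))
    (hvars H _) (H.tm (genTm hf (hW.tm hf) (hW.out hf))) := ⟨hf, rfl⟩

theorem tm_tmSub_var {Γ Δ : (D W).Ctx} (σ : Δ ⟶ Γ) {i : ℕ} {b : E.Tm (H.obj Γ)}
    (hb : Look (hvars H Γ) i b) :
    ∃ a : (D W).Tm Δ, rm a = rh σ i ∧ E.tmSub (H.map σ) b = H.tm a := by
  obtain ⟨a, ha, rfl⟩ := look_hvars.1 hb
  refine ⟨(D W).tmSub σ a, ?_, (H.tm_sub σ a).symm⟩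
  rw [rm_tmSub, ha]; rfl

/-- A morphism agrees with evaluation in the interpretation that it induces: an application is the
generic term of its symbol substituted along its arguments, and the morphism preserves this
substitution. The morphism is thus recoverable from `genVal`. -/
theorem genVal_evTm {Γ : (D W).Ctx} (a : (D W).Tm Γ) :
    EvTm (genVal hW H) (hvars H Γ) (rm a) (H.tm a) := by
  suffices ∀ t A, HasTy W (ctxL (rc Γ)) t A → ∀ a : (D W).Tm Γ, rm a = t →
      EvTm (genVal hW H) (hvars H Γ) t (H.tm a) from this _ _ (rm_wf a) a rfl
  intro t A h
  induction h with
  | var h =>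
    intro a ha
    obtain ⟨i, rfl, h⟩ := h
    exact .var (look_hvars.2 ⟨a, ha, rfl⟩)
  | @app f σ hf h₂ h₃ ih =>
    intro a ha
    let τ : Γ ⟶ mkC _ (hW.tm hf) := mkH σ ⟨h₂, h₃⟩
    have : a = (D W).tmSub τ (genTm hf (hW.tm hf) (hW.out hf)) :=
      D.tm_ext (ha.trans (tmSub_genTm hf _ _ τ).symm)
    rw [this, H.tm_sub]
    refine .app _ (genVal_tm hW H hf) fun i b hb => ?_
    obtain ⟨c, hc, hc'⟩ := tm_tmSub_var H τ hb
    rw [hc']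
    have hlt := hb.lt
    rw [hvars_length] at hlt
    obtain ⟨B, hB⟩ := Look.exists_of_lt hlt
    exact ih i B hB c hc

theorem genVal_evSub {Γ Δ : (D W).Ctx} (σ : Δ ⟶ Γ) :
    EvSub (genVal hW H) (hvars H Δ) (rh σ) (hvars H Γ) (H.map σ) := fun i b hb => by
  obtain ⟨c, hc, hc'⟩ := tm_tmSub_var H σ hb
  rw [hc', ← hc]
  exact genVal_evTm hW H c

theorem genVal_evTy {Γ : (D W).Ctx} (A : (D W).Ty Γ) :
    EvTy (genVal hW H) (hvars H Γ) (rt A) (H.ty A) := by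
  rw [← congrArg H.ty (tySub_argsTy A (hW.ty (rt_wf A).mem)), H.ty_sub]
  exact .mk _ (genVal_ty hW H (rt_wf A).mem) (genVal_evSub hW H (argsTy A _))

theorem EvCon.of_eq {M : Val S E} {Γ : S.Con} {Y Y' : E.Ctx} {v : List (E.Tm Y)}
    {v' : List (E.Tm Y')} (h : EvCon M Γ Y v) (hY : Y' = Y)
    (hv : v' = v.map (E.tmSub (eqToHom hY))) : EvCon M Γ Y' v' := by
  subst hY
  have : E.tmSub (𝟙 Y') = id := funext fun a => E.tmSub_id a
  rwa [hv, eqToHom_refl, this, List.map_id]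

theorem genVal_evCon (Γ : (D W).Ctx) : EvCon (genVal hW H) (rc Γ) (H.obj Γ) (hvars H Γ) := by
  obtain ⟨Γ, h⟩ : ∃ (Γ' : S.Con) (h : WCon W Γ'), Γ = mkC Γ' h := ⟨rc Γ, rc_wf Γ, rfl⟩
  obtain ⟨h, rfl⟩ := h
  induction Γ with
  | nil => exact EvCon.of_eq .nil H.obj_nil rfl
  | cons A Γ ih =>
    have hΓ : WCon W Γ := by cases h; assumption
    have hA : WTy W (ctxL Γ) A := by cases h; assumption
    let A' : (D W).Ty (mkC Γ hΓ) := mkT A hA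
    change EvCon _ (rc ((D W).ext A')) (H.obj ((D W).ext A')) (hvars H ((D W).ext A'))
    refine EvCon.of_eq (.cons (ih hΓ) (genVal_evTy hW H A')) (H.obj_ext A') ?_
    rw [hvars, cvars_ext, List.map_cons, List.map_cons, ← H.tm_q, List.map_map, List.map_map,
      hvars, List.map_map]
    refine congrArg (_ :: ·) (List.map_congr_left fun b hb => ?_)
    simp only [Function.comp_apply]
    rw [H.tm_sub, H.map_p, E.tmSub_comp]

theorem genVal_functional : (genVal hW H).Functional where
  ty_unique := by
    rintro T Y v B Y' v' B' ⟨_, h⟩ ⟨_, h'⟩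
    exact h.trans h'.symm
  tm_unique := by
    rintro T Y v B Y' v' B' ⟨_, h⟩ ⟨_, h'⟩
    exact h.trans h'.symm
  ty_monic := by
    rintro T Y v B ⟨_, h⟩
    cases h
    exact (genVal_evCon hW H _).jointlyMonic
  tm_monic := by
    rintro T Y v B ⟨_, h⟩
    cases h
    exact (genVal_evCon hW H _).jointlyMonic

theorem genVal_models : (genVal hW H).Models W where
  toFunctional := genVal_functional hW H
  ty_total T hT := ⟨_, _, _, genVal_ty hW H hT, genVal_evCon hW H (mkC _ (hW.ty hT))⟩
  tm_total f hf := ⟨_, _, _, genVal_tm hW H hf, genVal_evCon hW H (mkC _ (hW.tm hf)), by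
    rw [H.tp_tm]; exact genVal_evTy hW H ((D W).tp (genTm hf (hW.tm hf) (hW.out hf)))⟩

end Generic

/-- Equality of morphisms from equality on objects and heterogeneous equality of all data. -/
theorem CwF_hom_ext {A : CwF.{u}} {H H' : A ⟶ E} (hobj : ∀ Γ, H.obj Γ = H'.obj Γ)
    (hmap : ∀ {Δ Γ} (σ : Δ ⟶ Γ), HEq (H.map σ) (H'.map σ))
    (hty : ∀ {Γ} (B : A.Ty Γ), HEq (H.ty B) (H'.ty B))
    (htm : ∀ {Γ} (b : A.Tm Γ), HEq (H.tm b) (H'.tm b)) : H = H' := by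
  obtain ⟨F, ty, _, tm, _, _, _, _, _, _⟩ := H
  obtain ⟨F', ty', _, tm', _, _, _, _, _, _⟩ := H'
  obtain rfl : F = F' := CategoryTheory.Functor.hext hobj fun _ _ σ => hmap σ
  obtain rfl : @ty = @ty' := by
    funext Γ B; exact eq_of_heq (hty B)
  obtain rfl : @tm = @tm' := by
    funext Γ b; exact eq_of_heq (htm b)
  rfl

theorem EvTm.heq {M : Val S E} (hM : M.Functional) {X X' : E.Ctx} {ρ : List (E.Tm X)}
    {ρ' : List (E.Tm X')} (h : (⟨X, ρ⟩ : Σ Y : E.Ctx, List (E.Tm Y)) = ⟨X', ρ'⟩) {t : S.Tm}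
    {a : E.Tm X} {a' : E.Tm X'} (ha : EvTm M ρ t a) (ha' : EvTm M ρ' t a') : HEq a a' := by
  cases h; exact heq_of_eq (ha.unique hM ha')

theorem EvTy.heq {M : Val S E} (hM : M.Functional) {X X' : E.Ctx} {ρ : List (E.Tm X)}
    {ρ' : List (E.Tm X')} (h : (⟨X, ρ⟩ : Σ Y : E.Ctx, List (E.Tm Y)) = ⟨X', ρ'⟩) {t : S.Ty}
    {a : E.Ty X} {a' : E.Ty X'} (ha : EvTy M ρ t a) (ha' : EvTy M ρ' t a') : HEq a a' := by
  cases h; exact heq_of_eq (ha.unique hM ha')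

theorem EvSub.heq {M : Val S E} (hM : M.Functional) {X X' Y Y' : E.Ctx} {ρ : List (E.Tm X)}
    {ρ' : List (E.Tm X')} (h : (⟨X, ρ⟩ : Σ Y : E.Ctx, List (E.Tm Y)) = ⟨X', ρ'⟩)
    {v : List (E.Tm Y)} {v' : List (E.Tm Y')}
    (hv : (⟨Y, v⟩ : Σ Y : E.Ctx, List (E.Tm Y)) = ⟨Y', v'⟩) (hm : JointlyMonic v)
    {σ : ℕ → S.Tm} {m : X ⟶ Y} {m' : X' ⟶ Y'} (h₁ : EvSub M ρ σ v m) (h₂ : EvSub M ρ' σ v' m') :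
    HEq m m' := by
  cases h; cases hv; exact heq_of_eq (h₁.unique hM hm h₂)

/-- Both morphisms compute evaluation in the common interpretation `M`, and evaluation is
deterministic. Only inclusion in `M` is required, so `M` may interpret further symbols. -/
theorem hom_eq_of_genVal_le {W : Set S.Sym} (hW : BoundedBy W W) {H H' : D W ⟶ E} {M : Val S E}
    (hM : M.Functional) (h : genVal hW H ≤ M) (h' : genVal hW H' ≤ M) : H = H' := by
  have key (Γ : (D W).Ctx) : (⟨H.obj Γ, hvars H Γ⟩ : Σ Y : E.Ctx, List (E.Tm Y)) =
      ⟨H'.obj Γ, hvars H' Γ⟩ :=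
    ((genVal_evCon hW H Γ).mono h).unique hM ((genVal_evCon hW H' Γ).mono h')
  refine CwF_hom_ext (fun Γ => congrArg Sigma.fst (key Γ)) (fun σ => ?_) (fun B => ?_) fun b => ?_
  · exact EvSub.heq hM (key _) (key _) (genVal_evCon hW H _).jointlyMonic
      ((genVal_evSub hW H σ).mono h fun _ _ => id) ((genVal_evSub hW H' σ).mono h' fun _ _ => id)
  · exact EvTy.heq hM (key _) ((genVal_evTy hW H B).mono h fun _ _ => id)
      ((genVal_evTy hW H' B).mono h' fun _ _ => id)
  · exact EvTm.heq hM (key _) ((genVal_evTm hW H b).mono h fun _ _ => id)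
      ((genVal_evTm hW H' b).mono h' fun _ _ => id)

theorem hvars_interp {W : Set S.Sym} {M : Val S E} (hM : M.Models W) (Γ : (D W).Ctx) :
    hvars (interp hM) Γ = Interp.vars hM Γ := by
  refine Look.list_ext ?_ fun i a ha => ?_
  · exact (hvars_length _ _).trans (Interp.evCon hM Γ).length.symm
  · obtain ⟨b, hb, rfl⟩ := look_hvars.1 ha
    have := Interp.evTm hM b
    rw [hb] at this
    cases this with | var h => exact h

/-- Evaluating the generic instance of a symbol means evaluating it at the identity substitution,
which returns the value prescribed by `M`. This is the existence half of the universal property;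
`hom_eq_of_genVal_le` is the uniqueness half. -/
theorem genVal_interp_le {W : Set S.Sym} (hW : BoundedBy W W) {M : Val S E} (hM : M.Models W) :
    genVal hW (interp hM) ≤ M := by
  constructor
  · rintro T Y v B ⟨hT, h⟩
    cases h
    rw [hvars_interp]
    obtain ⟨Y', v', B', h', hv'⟩ := hM.ty_total T hT
    cases hv'.unique hM.toFunctional (Interp.evCon hM (mkC _ (hW.ty hT)))
    have hB : (interp hM).ty (genTy hT (hW.ty hT)) = B' := by
      refine Interp.ty_unique hM ?_
      rw [← E.tySub_id B']
      refine .mk _ h' fun i b hb => ?_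
      have := hb.lt
      rw [(Interp.evCon hM _).length, rc_mkC] at this
      rw [E.tmSub_id]
      change EvTm _ _ (idS _ i) _
      rw [idS_of_lt this]
      exact .var hb
    rw [hB]
    exact h'
  · rintro f Y v b ⟨hf, h⟩
    cases h
    rw [hvars_interp]
    obtain ⟨Y', v', b', h', hv', -⟩ := hM.tm_total f hf
    cases hv'.unique hM.toFunctional (Interp.evCon hM (mkC _ (hW.tm hf)))
    have hB : (interp hM).tm (genTm hf (hW.tm hf) (hW.out hf)) = b' := by
      refine Interp.tm_unique hM ?_
      rw [← E.tmSub_id b']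
      refine .app _ h' fun i b hb => ?_
      have := hb.lt
      rw [(Interp.evCon hM _).length, rc_mkC] at this
      rw [E.tmSub_id, idS_of_lt this]
      exact .var hb
    rw [hB]
    exact h'

end FreeCwF

namespace FreeCwF

variable {S : Sig.{u}} {E : CwF.{u}}

/-! ### Cellularity of syntactic CwFs -/

theorem BoundedBy.mono {W₁ W₂ W₁' W₂' : Set S.Sym} (h : BoundedBy W₁ W₂) (h₁ : W₁ ⊆ W₁')
    (h₂ : W₂' ⊆ W₂) : BoundedBy W₁' W₂' where
  ty hT := (h.ty (h₂ hT)).mono h₁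
  tm hf := (h.tm (h₂ hf)).mono h₁
  out hf := (h.out (h₂ hf)).mono h₁ fun _ _ => id

theorem Val.le_trans {M₁ M₂ M₃ : Val S E} (h : M₁ ≤ M₂) (h' : M₂ ≤ M₃) : M₁ ≤ M₃ :=
  ⟨fun _ _ _ _ H => h'.1 _ _ _ _ (h.1 _ _ _ _ H), fun _ _ _ _ H => h'.2 _ _ _ _ (h.2 _ _ _ _ H)⟩

theorem hvars_inc {W W' : Set S.Sym} (h : W ⊆ W') (H : D W' ⟶ E) (Γ : (D W).Ctx) :
    hvars (inc h ≫ H) Γ = hvars H ((inc h).obj Γ) := by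
  refine Look.list_ext ?_ fun i a ha => ?_
  · exact (hvars_length _ _).trans (hvars_length H ((inc h).obj Γ)).symm
  · obtain ⟨b, hb, rfl⟩ := look_hvars.1 ha
    exact look_hvars.2 ⟨(inc h).tm b, hb, rfl⟩

theorem genVal_inc_le {W W' : Set S.Sym} (h : W ⊆ W') (hW : BoundedBy W W) (hW' : BoundedBy W' W')
    (H : D W' ⟶ E) : genVal hW (inc h ≫ H) ≤ genVal hW' H := by
  constructor
  · rintro T Y v B ⟨hT, e⟩
    rw [hvars_inc] at e
    exact ⟨h hT, e⟩
  · rintro f Y v b ⟨hf, e⟩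
    rw [hvars_inc] at e
    exact ⟨h hf, e⟩

theorem genVal_inc_ty {W W' : Set S.Sym} (h : W ⊆ W') (hW : BoundedBy W W)
    (hW' : BoundedBy W' W') {H : D W' ⟶ E} {T : S.GTy} (hT : .inl T ∈ W) {Y : E.Ctx}
    {v : List (E.Tm Y)} {B : E.Ty Y} (hB : (genVal hW' H).ty T Y v B) :
    (genVal hW (inc h ≫ H)).ty T Y v B := by
  refine ⟨hT, ?_⟩
  rw [hvars_inc]
  exact hB.2

theorem genVal_inc_tm {W W' : Set S.Sym} (h : W ⊆ W') (hW : BoundedBy W W)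
    (hW' : BoundedBy W' W') {H : D W' ⟶ E} {f : S.GTm} (hf : .inr f ∈ W) {Y : E.Ctx}
    {v : List (E.Tm Y)} {b : E.Tm Y} (hb : (genVal hW' H).tm f Y v b) :
    (genVal hW (inc h ≫ H)).tm f Y v b := by
  refine ⟨hf, ?_⟩
  rw [hvars_inc]
  exact hb.2

section BasicCellular

variable {W W' : Set S.Sym} (h : W ⊆ W') (hW : BoundedBy W W) (hb : BoundedBy W W')

/-- The symbols of `W'` that are not in `W`, as generators over the syntactic CwF on `W`. -/
def newGens (hb : BoundedBy W W') : CwF.Generators (D W) where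
  GenTy := { T : S.GTy // .inl T ∈ W' ∧ .inl T ∉ W }
  GenTm := { f : S.GTm // .inr f ∈ W' ∧ .inr f ∉ W }
  bdTy T := mkC (S.bdTy T.1) (hb.ty T.2.1)
  bdTm f := mkC (S.bdTm f.1) (hb.tm f.2.1)
  outTy f := mkT (S.out f.1) (hb.out f.2.1)

/-- The new symbols as types and terms of the syntactic CwF on `W'`. -/
def newInterp : (newGens hb).Interp (inc h) where
  ty T := genTy T.2.1 ((hb.ty T.2.1).mono h)
  tm f := genTm f.2.1 ((hb.tm f.2.1).mono h) ((hb.out f.2.1).mono h fun _ _ => id)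
  tp_tm _ := rfl

/-- The extension of the interpretation given by a morphism to the new symbols. -/
def extendVal (K : D W ⟶ E) (k : (newGens hb).Interp K) : Val S E where
  ty T Y v B := (genVal hW K).ty T Y v B ∨ ∃ hT : .inl T ∈ W' ∧ .inl T ∉ W,
    (⟨Y, v, B⟩ : Σ Y : E.Ctx, List (E.Tm Y) × E.Ty Y) =
      ⟨K.obj (mkC (S.bdTy T) (hb.ty hT.1)), hvars K _, k.ty ⟨T, hT⟩⟩
  tm f Y v b := (genVal hW K).tm f Y v b ∨ ∃ hf : .inr f ∈ W' ∧ .inr f ∉ W,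
    (⟨Y, v, b⟩ : Σ Y : E.Ctx, List (E.Tm Y) × E.Tm Y) =
      ⟨K.obj (mkC (S.bdTm f) (hb.tm hf.1)), hvars K _, k.tm ⟨f, hf⟩⟩

theorem genVal_le_extendVal (K : D W ⟶ E) (k : (newGens hb).Interp K) :
    genVal hW K ≤ extendVal hW hb K k :=
  ⟨fun _ _ _ _ => .inl, fun _ _ _ _ => .inl⟩

theorem extendVal_models (K : D W ⟶ E) (k : (newGens hb).Interp K) :
    (extendVal hW hb K k).Models W' where
  ty_unique := by
    rintro T Y v B Y' v' B' (h₁ | ⟨h₁, e₁⟩) (h₂ | ⟨h₂, e₂⟩)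
    · exact (genVal_functional hW K).ty_unique h₁ h₂
    · exact absurd h₁.1 h₂.2
    · exact absurd h₂.1 h₁.2
    · exact e₁.trans e₂.symm
  tm_unique := by
    rintro T Y v B Y' v' B' (h₁ | ⟨h₁, e₁⟩) (h₂ | ⟨h₂, e₂⟩)
    · exact (genVal_functional hW K).tm_unique h₁ h₂
    · exact absurd h₁.1 h₂.2
    · exact absurd h₂.1 h₁.2
    · exact e₁.trans e₂.symm
  ty_monic := by
    rintro T Y v B (h₁ | ⟨h₁, e₁⟩)
    · exact (genVal_functional hW K).ty_monic h₁
    · cases e₁; exact (genVal_evCon hW K _).jointlyMonic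
  tm_monic := by
    rintro T Y v B (h₁ | ⟨h₁, e₁⟩)
    · exact (genVal_functional hW K).tm_monic h₁
    · cases e₁; exact (genVal_evCon hW K _).jointlyMonic
  ty_total T hT := by
    by_cases hT' : .inl T ∈ W
    · obtain ⟨Y, v, B, h₁, h₂⟩ := (genVal_models hW K).ty_total T hT'
      exact ⟨Y, v, B, .inl h₁, h₂.mono (genVal_le_extendVal hW hb K k)⟩
    · exact ⟨_, _, _, .inr ⟨⟨hT, hT'⟩, rfl⟩,
        (genVal_evCon hW K (mkC (S.bdTy T) (hb.ty hT))).mono (genVal_le_extendVal hW hb K k)⟩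
  tm_total f hf := by
    by_cases hf' : .inr f ∈ W
    · obtain ⟨Y, v, B, h₁, h₂, h₃⟩ := (genVal_models hW K).tm_total f hf'
      exact ⟨Y, v, B, .inl h₁, h₂.mono (genVal_le_extendVal hW hb K k),
        h₃.mono (genVal_le_extendVal hW hb K k) fun _ _ => id⟩
    · refine ⟨_, _, _, .inr ⟨⟨hf, hf'⟩, rfl⟩,
        (genVal_evCon hW K (mkC (S.bdTm f) (hb.tm hf))).mono (genVal_le_extendVal hW hb K k), ?_⟩
      exact Eq.mpr (congrArg (EvTy _ _ _) (k.tp_tm ⟨f, hf, hf'⟩))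
        ((genVal_evTy hW K (Γ := mkC (S.bdTm f) (hb.tm hf)) (mkT (S.out f) (hb.out hf))).mono
          (genVal_le_extendVal hW hb K k) fun _ _ => id)

theorem genVal_le_extendVal_inc (hW' : BoundedBy W' W') (H : D W' ⟶ E) :
    genVal hW' H ≤ extendVal hW hb (inc h ≫ H) ((newInterp h hb).map H) := by
  constructor
  · rintro T Y v B ⟨hT, e⟩
    by_cases hT' : .inl T ∈ W
    · exact .inl (genVal_inc_ty h hW hW' hT' ⟨hT, e⟩)
    · refine .inr ⟨⟨hT, hT'⟩, ?_⟩
      rw [hvars_inc]; exact e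
  · rintro f Y v b ⟨hf, e⟩
    by_cases hf' : .inr f ∈ W
    · exact .inl (genVal_inc_tm h hW hW' hf' ⟨hf, e⟩)
    · refine .inr ⟨⟨hf, hf'⟩, ?_⟩
      rw [hvars_inc]; exact e

theorem heq_of_triple_eq {P : E.Ctx → Type u} {Y Y' : E.Ctx} {v : List (E.Tm Y)}
    {v' : List (E.Tm Y')} {B : P Y} {B' : P Y'}
    (e : (⟨Y, v, B⟩ : Σ Y : E.Ctx, List (E.Tm Y) × P Y) = ⟨Y', v', B'⟩) : HEq B B' := by
  cases e; rfl

theorem interp_cast_eq {A B : CwF.{u}} {G : CwF.Generators A} {K K' : A ⟶ B} (e : K = K')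
    (k : G.Interp K) (k' : G.Interp K') (hty : ∀ s, HEq (k.ty s) (k'.ty s))
    (htm : ∀ f, HEq (k.tm f) (k'.tm f)) : e ▸ k = k' := by
  subst e
  obtain ⟨ty, tm, _⟩ := k
  obtain ⟨ty', tm', _⟩ := k'
  obtain rfl : ty = ty' := funext fun s => eq_of_heq (hty s)
  obtain rfl : tm = tm' := funext fun f => eq_of_heq (htm f)
  rfl

/-- A morphism out of `D W'` amounts to an interpretation of the symbols in `W'`. The old symbols
are interpreted by `K`. Boundaries and output types of new symbols are formed over `W`, so `K`
already evaluates them, and values for the new symbols may be given independently of each other by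
`k`. -/
theorem basicCellular_inc (h : W ⊆ W') (hW : BoundedBy W W) (hb : BoundedBy W W') :
    CwF.basicCellular (inc h) := by
  have hW' : BoundedBy W' W' := hb.mono h subset_rfl
  refine ⟨newGens hb, newInterp h hb, fun E K k => ?_⟩
  have hM := extendVal_models hW hb K k
  have hle := genVal_interp_le hW' hM
  refine ⟨interp hM, ⟨?_, ?_⟩, ?_⟩
  -- Restricted to symbols in `W`, the extended interpretation is that of `K`, since its second
  -- alternative concerns only symbols outside `W`.
  · refine hom_eq_of_genVal_le hW (genVal_functional hW K) ?_ (Val.le_refl _)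
    have hle' := genVal_inc_le h hW hW' (interp hM)
    constructor
    · intro T Y v B hT
      rcases hle.1 _ _ _ _ (hle'.1 _ _ _ _ hT) with h₁ | ⟨h₁, -⟩
      · exact h₁
      · exact absurd hT.1 h₁.2
    · intro T Y v B hT
      rcases hle.2 _ _ _ _ (hle'.2 _ _ _ _ hT) with h₁ | ⟨h₁, -⟩
      · exact h₁
      · exact absurd hT.1 h₁.2
  · refine interp_cast_eq _ _ _ (fun s => ?_) fun f => ?_
    · rcases hle.1 _ _ _ _ (genVal_ty hW' (interp hM) s.2.1) with h₁ | ⟨h₁, e⟩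
      · exact absurd h₁.1 s.2.2
      · exact heq_of_triple_eq e
    · rcases hle.2 _ _ _ _ (genVal_tm hW' (interp hM) f.2.1) with h₁ | ⟨h₁, e⟩
      · exact absurd h₁.1 f.2.2
      · exact heq_of_triple_eq e
  · rintro H ⟨e, he⟩
    subst e
    subst he
    exact hom_eq_of_genVal_le hW' hM.toFunctional (genVal_le_extendVal_inc h hW hb hW' H) hle

end BasicCellular

/-! ### The colimit of a sequence of syntactic CwFs -/

section Chain

variable (W : ℕ → Set S.Sym)

/-- An increasing sequence of sets of symbols, each bounded by the previous one. -/
structure IsChain : Prop where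
  zero : W 0 = ∅
  step : ∀ n, W n ⊆ W (n + 1)
  bounded : ∀ n, BoundedBy (W n) (W (n + 1))

variable {W} (hW : IsChain W)

theorem IsChain.mono (hW : IsChain W) {m n : ℕ} (h : m ≤ n) : W m ⊆ W n :=
  monotone_nat_of_le_succ hW.step h

theorem IsChain.boundedBy (hW : IsChain W) (n : ℕ) : BoundedBy (W n) (W n) :=
  (hW.bounded n).mono subset_rfl (hW.step n)

theorem IsChain.boundedBy_iUnion (hW : IsChain W) : BoundedBy (⋃ n, W n) (⋃ n, W n) where
  ty hT := by
    obtain ⟨n, hn⟩ := Set.mem_iUnion.1 hT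
    exact ((hW.boundedBy n).ty hn).mono (Set.subset_iUnion W n)
  tm hT := by
    obtain ⟨n, hn⟩ := Set.mem_iUnion.1 hT
    exact ((hW.boundedBy n).tm hn).mono (Set.subset_iUnion W n)
  out hT := by
    obtain ⟨n, hn⟩ := Set.mem_iUnion.1 hT
    exact ((hW.boundedBy n).out hn).mono (Set.subset_iUnion W n) fun _ _ => id

/-- The sequence of syntactic CwFs. -/
def IsChain.functor : ℕ ⥤ CwF.{u} where
  obj n := D (W n)
  map f := inc (hW.mono (leOfHom f))
  map_id _ := rfl
  map_comp _ _ := rfl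

/-- The cocone on the sequence of syntactic CwFs. -/
def IsChain.incl : hW.functor ⟶ (Functor.const ℕ).obj (D (⋃ n, W n)) where
  app n := inc (Set.subset_iUnion W n)
  naturality _ _ _ := rfl

/-- The interpretation of symbols given by a cocone. -/
def IsChain.coconeVal (s : Limits.Cocone hW.functor) : Val S s.pt where
  ty T Y v B := ∃ n, (genVal (hW.boundedBy n) (s.ι.app n)).ty T Y v B
  tm T Y v B := ∃ n, (genVal (hW.boundedBy n) (s.ι.app n)).tm T Y v B

theorem IsChain.genVal_le (s : Limits.Cocone hW.functor) {m n : ℕ} (h : m ≤ n) :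
    genVal (hW.boundedBy m) (s.ι.app m) ≤ genVal (hW.boundedBy n) (s.ι.app n) := by
  rw [← s.w (homOfLE h)]
  exact genVal_inc_le (hW.mono h) _ _ _

theorem IsChain.genVal_le_coconeVal (s : Limits.Cocone hW.functor) (n : ℕ) :
    genVal (hW.boundedBy n) (s.ι.app n) ≤ hW.coconeVal s :=
  ⟨fun _ _ _ _ h => ⟨n, h⟩, fun _ _ _ _ h => ⟨n, h⟩⟩

theorem IsChain.coconeVal_models (s : Limits.Cocone hW.functor) :
    (hW.coconeVal s).Models (⋃ n, W n) where
  ty_unique := by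
    rintro T Y v B Y' v' B' ⟨m, h₁⟩ ⟨n, h₂⟩
    exact (genVal_functional _ _).ty_unique ((hW.genVal_le s (le_max_left m n)).1 _ _ _ _ h₁)
      ((hW.genVal_le s (le_max_right m n)).1 _ _ _ _ h₂)
  tm_unique := by
    rintro T Y v B Y' v' B' ⟨m, h₁⟩ ⟨n, h₂⟩
    exact (genVal_functional _ _).tm_unique ((hW.genVal_le s (le_max_left m n)).2 _ _ _ _ h₁)
      ((hW.genVal_le s (le_max_right m n)).2 _ _ _ _ h₂)
  ty_monic := by
    rintro T Y v B ⟨n, h⟩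
    exact (genVal_functional _ _).ty_monic h
  tm_monic := by
    rintro T Y v B ⟨n, h⟩
    exact (genVal_functional _ _).tm_monic h
  ty_total T hT := by
    obtain ⟨n, hn⟩ := Set.mem_iUnion.1 hT
    obtain ⟨Y, v, B, h₁, h₂⟩ := (genVal_models (hW.boundedBy n) (s.ι.app n)).ty_total T hn
    exact ⟨Y, v, B, ⟨n, h₁⟩, h₂.mono (hW.genVal_le_coconeVal s n)⟩
  tm_total T hT := by
    obtain ⟨n, hn⟩ := Set.mem_iUnion.1 hT
    obtain ⟨Y, v, B, h₁, h₂, h₃⟩ := (genVal_models (hW.boundedBy n) (s.ι.app n)).tm_total T hn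
    exact ⟨Y, v, B, ⟨n, h₁⟩, h₂.mono (hW.genVal_le_coconeVal s n),
      h₃.mono (hW.genVal_le_coconeVal s n) fun _ _ => id⟩

/-- The syntactic CwF on the union of the sequence is the colimit. -/
noncomputable def IsChain.isColimit :
    Limits.IsColimit (Limits.Cocone.mk (D (⋃ n, W n)) hW.incl) where
  desc s := interp (hW.coconeVal_models s)
  fac s n := by
    refine hom_eq_of_genVal_le (hW.boundedBy n) (hW.coconeVal_models s).toFunctional ?_
      (hW.genVal_le_coconeVal s n)
    exact Val.le_trans (genVal_inc_le (Set.subset_iUnion W n) _ hW.boundedBy_iUnion _)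
      (genVal_interp_le _ _)
  uniq s H hH := by
    refine hom_eq_of_genVal_le hW.boundedBy_iUnion (hW.coconeVal_models s).toFunctional ?_
      (genVal_interp_le _ _)
    constructor
    · rintro T Y v B ⟨hT, e⟩
      obtain ⟨n, hn⟩ := Set.mem_iUnion.1 hT
      refine ⟨n, ?_⟩
      rw [← hH n]
      exact genVal_inc_ty (Set.subset_iUnion W n) _ hW.boundedBy_iUnion hn ⟨hT, e⟩
    · rintro T Y v B ⟨hT, e⟩
      obtain ⟨n, hn⟩ := Set.mem_iUnion.1 hT
      refine ⟨n, ?_⟩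
      rw [← hH n]
      exact genVal_inc_tm (Set.subset_iUnion W n) _ hW.boundedBy_iUnion hn ⟨hT, e⟩

end Chain

theorem models_empty (S : Sig.{u}) (E : CwF.{u}) :
    (Val.mk (fun _ _ _ _ => False) (fun _ _ _ _ => False) : Val S E).Models ∅ where
  ty_unique := False.elim
  tm_unique := False.elim
  ty_monic := False.elim
  tm_monic := False.elim
  ty_total _ := False.elim
  tm_total _ := False.elim

/-- The syntactic CwF on no symbols is initial. -/
noncomputable def isInitialEmpty (S : Sig.{u}) : Limits.IsInitial (D (∅ : Set S.Sym)) := by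
  have hW : BoundedBy (∅ : Set S.Sym) ∅ := ⟨False.elim, False.elim, False.elim⟩
  exact Limits.IsInitial.ofUniqueHom (fun E => interp (models_empty S E)) fun E H =>
    hom_eq_of_genVal_le hW (models_empty S E).toFunctional
      ⟨fun _ _ _ _ h => h.1.elim, fun _ _ _ _ h => h.1.elim⟩ (genVal_interp_le hW _)

theorem IsChain.isCellular {W : ℕ → Set S.Sym} (hW : IsChain W) :
    CwF.IsCellular (D (⋃ n, W n)) := by
  have hZ : Limits.IsInitial (D (W 0)) := by
    rw [hW.zero]; exact isInitialEmpty S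
  refine ⟨D (W 0), hZ, ⟨?_⟩⟩
  exact
    { F := hW.functor
      isoBot := Iso.refl _
      -- The order `ℕ` has no limit elements, so continuity is vacuous.
      isWellOrderContinuous := inferInstance
      incl := hW.incl
      isColimit := hW.isColimit
      fac := hZ.hom_ext _ _
      map_mem := fun n _ => basicCellular_inc (hW.step n) (hW.boundedBy n) (hW.bounded n) }

end FreeCwF

namespace FreeCwF

/-! ### Compactness -/

theorem exists_uniform_bound {P : ℕ → ℕ → Prop} (hP : ∀ i m n, m ≤ n → P m i → P n i) (k : ℕ)
    (h : ∀ i < k, ∃ n, P n i) : ∃ n, ∀ i < k, P n i := by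
  induction k with
  | zero => exact ⟨0, fun i hi => absurd hi (Nat.not_lt_zero i)⟩
  | succ k ih =>
    obtain ⟨m, hm⟩ := ih fun i hi => h i (hi.trans (Nat.lt_succ_self k))
    obtain ⟨n, hn⟩ := h k (Nat.lt_succ_self k)
    refine ⟨max m n, fun i hi => ?_⟩
    rcases Nat.lt_succ_iff_lt_or_eq.1 hi with hi | rfl
    · exact hP _ _ _ (le_max_left m n) (hm i hi)
    · exact hP _ _ _ (le_max_right m n) hn

section Compact

variable {S : Sig.{u}} {W : ℕ → Set S.Sym} {L : ℕ ⊕ ℕ → S.Ty → Prop}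

theorem exists_stage_of_look (hW : Monotone W) {Φ : S.Con} {σ : ℕ → S.Tm}
    (h : ∀ i A, Look Φ i A → ∃ n, HasTy (W n) L (σ i) (A.sub (inst σ))) :
    ∃ n, ∀ i A, Look Φ i A → HasTy (W n) L (σ i) (A.sub (inst σ)) := by
  obtain ⟨n, hn⟩ := exists_uniform_bound
    (P := fun n i => ∀ A, Look Φ i A → HasTy (W n) L (σ i) (A.sub (inst σ)))
    (fun i m n hmn hm A hA => (hm A hA).mono (hW hmn) fun _ _ => id) Φ.length fun i hi => by
      obtain ⟨A, hA⟩ := Look.exists_of_lt hi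
      obtain ⟨n, hn⟩ := h i A hA
      exact ⟨n, fun B hB => hB.unique hA ▸ hn⟩
  exact ⟨n, fun i A hA => hn i hA.lt A hA⟩

/-- Arities are finite, so a derivation uses finitely many symbols and a maximum of stages bounds
them all. This is what lets a symbol be adjoined over an arbitrary context of the union. -/
theorem HasTy.exists_stage (hW : Monotone W) {t : S.Tm} {A : S.Ty}
    (h : HasTy (⋃ n, W n) L t A) :
    ∃ n, HasTy (W n) L t A := by
  induction h with
  | var h => exact ⟨0, .var h⟩
  | app h₁ h₂ _ ih =>
    obtain ⟨m, hm⟩ := Set.mem_iUnion.1 h₁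
    obtain ⟨n, hn⟩ := exists_stage_of_look hW ih
    exact ⟨max m n, .app (hW (le_max_left m n) hm) h₂ fun i A hA =>
      (hn i A hA).mono (hW (le_max_right m n)) fun _ _ => id⟩

theorem WTy.exists_stage (hW : Monotone W) {A : S.Ty} (h : WTy (⋃ n, W n) L A) :
    ∃ n, WTy (W n) L A := by
  obtain ⟨m, hm⟩ := Set.mem_iUnion.1 h.mem
  obtain ⟨n, hn⟩ := exists_stage_of_look hW fun i A hA => (h.args.typed i A hA).exists_stage hW
  exact ⟨max m n, hW (le_max_left m n) hm, h.args.junk, fun i A hA =>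
    (hn i A hA).mono (hW (le_max_right m n)) fun _ _ => id⟩

theorem WCon.exists_stage (hW : Monotone W) {Γ : S.Con} (h : WCon (⋃ n, W n) Γ) :
    ∃ n, WCon (W n) Γ := by
  induction h with
  | nil => exact ⟨0, .nil⟩
  | cons _ hA ih =>
    obtain ⟨m, hm⟩ := ih
    obtain ⟨n, hn⟩ := hA.exists_stage hW
    exact ⟨max m n, .cons (hm.mono (hW (le_max_left m n)))
      (hn.mono (hW (le_max_right m n)) fun _ _ => id)⟩

end Compact

/-! ### The cellular replacement of a CwF -/

mutual

/-- Symbols for types: a type of `C` over a context of `C` with variables, and a raw context. -/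
inductive TyCode (C : CwF.{u}) : Type u
  | mk (X : C.Ctx) (v : List (C.Tm X)) (A : C.Ty X) (Γ : List (RTy (TyCode C) (TmCode C)))

/-- Symbols for terms: a term of `C` over a context of `C` with variables, and a raw context with
a raw type. -/
inductive TmCode (C : CwF.{u}) : Type u
  | mk (X : C.Ctx) (v : List (C.Tm X)) (a : C.Tm X) (Γ : List (RTy (TyCode C) (TmCode C)))
      (B : RTy (TyCode C) (TmCode C))

end

variable (C : CwF.{u})

/-- The signature of all symbols over `C`. -/
def codeSig : Sig.{u} where
  GTy := TyCode C
  GTm := TmCode C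
  bdTy | .mk _ _ _ Γ => Γ
  bdTm | .mk _ _ _ Γ _ => Γ
  out | .mk _ _ _ _ B => B

/-- The interpretation of the symbols in `C`. -/
def codeVal : Val (codeSig C) C where
  ty T Y v B := JointlyMonic v ∧ ∃ Γ, T = TyCode.mk Y v B Γ
  tm f Y v b := JointlyMonic v ∧ ∃ Γ B, f = TmCode.mk Y v b Γ B

/-- A code records its own context, variables and value, and joint monicity is part of `codeVal`.
Functionality thus holds for all codes, before well-formedness is known; `stage` relies on
evaluation in `codeVal` to define well-formedness. -/
theorem codeVal_functional : (codeVal C).Functional where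
  ty_unique := by
    rintro T Y v B Y' v' B' ⟨-, Γ, rfl⟩ ⟨-, Γ', h⟩
    cases h; rfl
  tm_unique := by
    rintro T Y v B Y' v' B' ⟨-, Γ, A, rfl⟩ ⟨-, Γ', A', h⟩
    cases h; rfl
  ty_monic h := h.1
  tm_monic h := h.1

/-- The sets of well-formed symbols: those of stage `n + 1` have well-formed boundaries of stage
`n` whose evaluation in `C` is the given context. -/
def stage : ℕ → Set (codeSig C).Sym
  | 0 => ∅
  | n + 1 => fun s => match s with
    | .inl (.mk X v _ Γ) => WCon (stage n) Γ ∧ EvCon (codeVal C) Γ X v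
    | .inr (.mk X v a Γ B) => WCon (stage n) Γ ∧ EvCon (codeVal C) Γ X v ∧
        WTy (stage n) (ctxL Γ) B ∧ EvTy (codeVal C) v B (C.tp a)

theorem stage_isChain : IsChain (stage C) where
  zero := rfl
  step n := by
    induction n with
    | zero => exact Set.empty_subset _
    | succ n ih =>
      rintro (⟨X, v, A, Γ⟩ | ⟨X, v, a, Γ, B⟩) h
      · exact ⟨h.1.mono ih, h.2⟩
      · exact ⟨h.1.mono ih, h.2.1, h.2.2.1.mono ih fun _ _ => id, h.2.2.2⟩
  bounded n :=
    { ty := by rintro ⟨X, v, A, Γ⟩ h; exact h.1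
      tm := by rintro ⟨X, v, a, Γ, B⟩ h; exact h.1
      out := by rintro ⟨X, v, a, Γ, B⟩ h; exact h.2.2.1 }

/-- All well-formed symbols. -/
def allGens : Set (codeSig C).Sym := ⋃ n, stage C n

theorem mem_allGens {s : (codeSig C).Sym} : s ∈ allGens C ↔ ∃ n, s ∈ stage C (n + 1) := by
  constructor
  · intro h
    obtain ⟨n, hn⟩ := Set.mem_iUnion.1 h
    cases n with
    | zero => exact hn.elim
    | succ n => exact ⟨n, hn⟩
  · rintro ⟨n, hn⟩
    exact Set.mem_iUnion.2 ⟨_, hn⟩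

theorem codeVal_models : (codeVal C).Models (allGens C) where
  toFunctional := codeVal_functional C
  ty_total := by
    rintro ⟨X, v, A, Γ⟩ h
    obtain ⟨n, hn⟩ := (mem_allGens C).1 h
    exact ⟨X, v, A, ⟨hn.2.jointlyMonic, Γ, rfl⟩, hn.2⟩
  tm_total := by
    rintro ⟨X, v, a, Γ, B⟩ h
    obtain ⟨n, hn⟩ := (mem_allGens C).1 h
    exact ⟨X, v, a, ⟨hn.2.1.jointlyMonic, Γ, B, rfl⟩, hn.2.1, hn.2.2.2⟩

theorem boundedBy_allGens : BoundedBy (allGens C) (allGens C) := (stage_isChain C).boundedBy_iUnion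

/-- The cellular replacement of `C`. -/
abbrev Repl : CwF.{u} := D (allGens C)

/-- The projection from the cellular replacement to `C`. -/
noncomputable def proj : Repl C ⟶ C := interp (codeVal_models C)

theorem isCellular_repl : CwF.IsCellular (Repl C) := (stage_isChain C).isCellular

theorem evSub_idS (Γ : (Repl C).Ctx) :
    EvSub (codeVal C) (Interp.vars (codeVal_models C) Γ) (idS (rc Γ).length)
      (Interp.vars (codeVal_models C) Γ) (𝟙 _) := fun i b hb => by
  rw [C.tmSub_id, idS_of_lt ((Interp.evCon (codeVal_models C) Γ).length ▸ hb.lt)]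
  exact .var hb

/-- The lift of `A` over `Γ` is the code with boundary `Γ` and value `A`, applied to the identity
substitution. The lift of a term is obtained in the same way, with the prescribed type as output
type. -/
theorem proj_isTrivialFibration : CwF.Hom.IsTrivialFibration (proj C) where
  ty_lift {Γ} A := by
    have hM := codeVal_models C
    have hE := Interp.evCon hM Γ
    let T : (codeSig C).GTy := .mk (Interp.obj hM Γ) (Interp.vars hM Γ) A (rc Γ)
    have hT : .inl T ∈ allGens C := by
      -- Membership in stage `n + 1` needs `Γ` to be well-formed at a single stage `n`.
      obtain ⟨n, hn⟩ := (rc_wf Γ).exists_stage fun _ _ => (stage_isChain C).mono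
      exact (mem_allGens C).2 ⟨n, hn, hE⟩
    refine ⟨mkT ⟨T, idS (rc Γ).length⟩ ⟨hT, (rc_wf Γ).isSub_idS fun _ _ => id⟩, ?_⟩
    refine Interp.ty_unique hM ?_
    rw [← C.tySub_id A]
    exact .mk (𝟙 _) ⟨hE.jointlyMonic, _, rfl⟩ (evSub_idS C Γ)
  tm_lift {Γ} A a ha := by
    have hM := codeVal_models C
    have hE := Interp.evCon hM Γ
    let f : (codeSig C).GTm := .mk (Interp.obj hM Γ) (Interp.vars hM Γ) a (rc Γ) (rt A)
    have hf : .inr f ∈ allGens C := by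
      obtain ⟨m, hm⟩ := (rc_wf Γ).exists_stage fun _ _ => (stage_isChain C).mono
      obtain ⟨n, hn⟩ := (rt_wf A).exists_stage fun _ _ => (stage_isChain C).mono
      refine (mem_allGens C).2 ⟨max m n, hm.mono ((stage_isChain C).mono (le_max_left m n)), hE,
        hn.mono ((stage_isChain C).mono (le_max_right m n)) fun _ _ => id, ?_⟩
      exact Eq.mpr (congrArg (EvTy _ _ _) ha) (Interp.evTy hM A)
    have ht : HasTy (allGens C) (ctxL (rc Γ)) (.app f (idS (rc Γ).length)) (rt A) := by
      have := HasTy.of_isSub (f := f) hf ((rc_wf Γ).isSub_idS fun _ _ => id)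
      have e : ((codeSig C).out f).sub (inst (idS (rc Γ).length)) = rt A := rt_sub_idS le_rfl A
      exact e ▸ this
    refine ⟨mkM _ A ht, rfl, ?_⟩
    refine Interp.tm_unique hM ?_
    rw [← C.tmSub_id a]
    exact .app (𝟙 _) ⟨hE.jointlyMonic, _, _, rfl⟩ (evSub_idS C Γ)

end FreeCwF

/-! ### Weakly stable identity types in a CwF -/

namespace CwF

theorem pair_congr (C : CwF.{u}) {Δ Γ : C.Ctx} {A : C.Ty Γ} {σ σ' : Δ ⟶ Γ} {a a' : C.Tm Δ}
    (hσ : σ = σ') (ha : a = a') (h : C.tp a = C.tySub σ A) (h' : C.tp a' = C.tySub σ' A) :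
    C.pair σ a h = C.pair σ' a' h' := by
  subst hσ ha; rfl

theorem comp_pair (C : CwF.{u}) {Θ Δ Γ : C.Ctx} {A : C.Ty Γ} (τ : Θ ⟶ Δ) (σ : Δ ⟶ Γ) (a : C.Tm Δ)
    (h : C.tp a = C.tySub σ A) :
    τ ≫ C.pair σ a h = C.pair (τ ≫ σ) (C.tmSub τ a) (by rw [C.tp_sub, h, C.tySub_comp]) := by
  apply C.ext_hom
  · rw [Category.assoc, C.pair_p, C.pair_p]
  · rw [C.tmSub_comp, C.q_pair, C.q_pair]

theorem pair_eta (C : CwF.{u}) {Δ Γ : C.Ctx} {A : C.Ty Γ} (m : Δ ⟶ C.ext A) :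
    C.pair (m ≫ C.p A) (C.tmSub m (C.q A)) (by rw [C.tp_sub, C.tp_q, C.tySub_comp]) = m := by
  apply C.ext_hom
  · rw [C.pair_p]
  · rw [C.q_pair]

theorem sec_comp_lift (C : CwF.{u}) {Δ Γ : C.Ctx} {A : C.Ty Γ} (σ : Δ ⟶ Γ) (a : C.Tm Δ)
    (h : C.tp a = C.tySub σ A) : C.sec (C.tySub σ A) a h ≫ C.lift σ A = C.pair σ a h := by
  apply C.ext_hom
  · rw [Category.assoc, C.lift_p, ← Category.assoc, C.sec_p, Category.id_comp, C.pair_p]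
  · rw [C.tmSub_comp, C.q_lift, C.q_sec, C.q_pair]

theorem comp_sec (C : CwF.{u}) {Δ Γ : C.Ctx} {A : C.Ty Γ} (σ : Δ ⟶ Γ) (a : C.Tm Γ)
    (h : C.tp a = A) : σ ≫ C.sec A a h = C.pair σ (C.tmSub σ a) (C.tp_sub_of σ h) := by
  rw [sec, comp_pair]
  exact C.pair_congr (Category.comp_id σ) rfl _ _

namespace WeaklyStableId

variable {C : CwF.{u}} (I : WeaklyStableId C) {Γ Δ : C.Ctx}

theorem typalEq_congr {A A' : C.Ty Γ} {a a' b b' : C.Tm Γ} {ha : C.tp a = A} {hb : C.tp b = A}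
    (eA : A = A') (ea : a = a') (eb : b = b') (ha' : C.tp a' = A') (hb' : C.tp b' = A')
    (h : I.TypalEq A a b ha hb) : I.TypalEq A' a' b' ha' hb' := by
  subst eA ea eb; exact h

/-- The family `B` with point `b` over `(A, x)` has the elimination principle of the identity
type, with a typal computation rule. -/
def HasJ (A : C.Ty Δ) (x : C.Tm Δ) (hx : C.tp x = A) (B : C.Ty (C.ext A)) (b : C.Tm Δ)
    (hb : C.tp b = C.tySub (C.sec A x hx) B) : Prop :=
  ∀ (P : C.Ty (C.ext B)) (d : C.Tm Δ) (hd : C.tp d = C.tySub (C.pair (C.sec A x hx) b hb) P),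
    ∃ (j : C.Tm (C.ext B)) (hj : C.tp j = P),
      I.TypalEq _ d (C.tmSub (C.pair (C.sec A x hx) b hb) j) hd (C.tp_sub_of _ hj)

/-- Reindexed identity types have the elimination principle. -/
theorem hasJ_of_eq {A : C.Ty Γ} {x : C.Tm Γ} {hx : C.tp x = A} (γ : Δ ⟶ Γ) {A' : C.Ty Δ}
    (hA : A' = C.tySub γ A) {x' : C.Tm Δ} (hx' : x' = C.tmSub γ x) (hx'' : C.tp x' = A')
    {B : C.Ty (C.ext A')}
    (hB : B = C.tySub (C.pair (C.p A' ≫ γ) (C.q A') (by rw [C.tp_q, C.tySub_comp, hA]))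
      (I.Id A x hx)) {b : C.Tm Δ} (hb : b = C.tmSub γ (I.refl A x hx))
    (hb' : C.tp b = C.tySub (C.sec A' x' hx'') B) : I.HasJ A' x' hx'' B b hb' := by
  subst hA hx' hb hB
  exact fun P d hd => ⟨I.J A x hx γ P d hd, I.tp_J A x hx γ P d hd, I.Jβ A x hx γ P d hd,
    I.tp_Jβ A x hx γ P d hd⟩

theorem hasJ_Id (A : C.Ty Γ) (x : C.Tm Γ) (hx : C.tp x = A) :
    I.HasJ A x hx (I.Id A x hx) (I.refl A x hx) (I.tp_refl A x hx) := by
  refine I.hasJ_of_eq (𝟙 Γ) (C.tySub_id A).symm (C.tmSub_id x).symm _ ?_ (C.tmSub_id _).symm _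
  have : C.pair (C.p A ≫ 𝟙 Γ) (C.q A) (by rw [C.tp_q, Category.comp_id]) = 𝟙 (C.ext A) := by
    apply C.ext_hom
    · rw [C.pair_p, Category.comp_id, Category.id_comp]
    · rw [C.q_pair, C.tmSub_id]
  rw [this, C.tySub_id]

variable {I}

/-- Eliminate into `Q(y)`, viewed as a motive that does not depend on the element of `B`. -/
theorem HasJ.transport {A : C.Ty Δ} {x : C.Tm Δ} {hx : C.tp x = A} {B : C.Ty (C.ext A)} {b : C.Tm Δ}
    {hb : C.tp b = C.tySub (C.sec A x hx) B} (hJ : I.HasJ A x hx B b hb) {Q : C.Ty (C.ext A)}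
    (hQ : ∃ u, C.tp u = C.tySub (C.sec A x hx) Q) {y : C.Tm Δ} (hy : C.tp y = A)
    (he : ∃ e, C.tp e = C.tySub (C.sec A y hy) B) : ∃ t, C.tp t = C.tySub (C.sec A y hy) Q := by
  obtain ⟨u, hu⟩ := hQ
  obtain ⟨e, he⟩ := he
  obtain ⟨j, hj, -⟩ := hJ (C.tySub (C.p B) Q) u (by rw [hu, ← C.tySub_comp, C.pair_p])
  refine ⟨C.tmSub (C.pair (C.sec A y hy) e he) j, ?_⟩
  rw [C.tp_sub, hj, ← C.tySub_comp, C.pair_p]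

/-- Both `B` and the chosen identity type eliminate and are inhabited at `x`, so each transports
into the other. Inhabitation of any family with elimination is therefore typal equality. -/
theorem HasJ.exists_tm_iff {A : C.Ty Δ} {x : C.Tm Δ} {hx : C.tp x = A} {B : C.Ty (C.ext A)}
    {b : C.Tm Δ} {hb : C.tp b = C.tySub (C.sec A x hx) B} (hJ : I.HasJ A x hx B b hb) {y : C.Tm Δ}
    (hy : C.tp y = A) :
    (∃ e, C.tp e = C.tySub (C.sec A y hy) B) ↔ I.TypalEq A x y hx hy :=
  ⟨hJ.transport ⟨_, I.tp_refl A x hx⟩ hy, (I.hasJ_Id A x hx).transport ⟨b, hb⟩ hy⟩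

variable (I)

/-- This replaces the missing equation between a substituted identity type and the identity type of
the substituted data. The type `Id[m]` is the fibre, at the last component of `m`, of the identity
type reindexed along `m ≫ p`; that family eliminates by weak stability and can be compared by
`HasJ.exists_tm_iff`. -/
theorem exists_tm_Id_iff {A : C.Ty Γ} {a : C.Tm Γ} (ha : C.tp a = A) (m : Δ ⟶ C.ext A) {A' : C.Ty Δ}
    {x y : C.Tm Δ} (hx : C.tp x = A') (hy : C.tp y = A') (eA : A' = C.tySub (m ≫ C.p A) A)
    (ex : x = C.tmSub (m ≫ C.p A) a) (ey : y = C.tmSub m (C.q A)) :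
    (∃ e, C.tp e = C.tySub m (I.Id A a ha)) ↔ I.TypalEq A' x y hx hy := by
  have h := I.hasJ_of_eq (hx := ha) (m ≫ C.p A) eA ex hx rfl rfl (by
    rw [C.tp_sub, I.tp_refl, ← C.tySub_comp, ← C.tySub_comp, comp_sec, comp_pair]
    congr 1
    apply C.pair_congr
    · rw [← Category.assoc, C.sec_p, Category.id_comp]
    · rw [C.q_sec, ex])
  rw [← h.exists_tm_iff hy, ← C.tySub_comp]
  have : C.sec A' y hy ≫ C.pair (C.p A' ≫ m ≫ C.p A) (C.q A')
      (by rw [C.tp_q, C.tySub_comp, eA]) = m := by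
    rw [comp_pair]
    refine (C.pair_congr ?_ ?_ _ _).trans (C.pair_eta m)
    · rw [← Category.assoc, C.sec_p, Category.id_comp]
    · rw [C.q_sec, ey]
  rw [this]

variable {I}

theorem typalEq_refl {A : C.Ty Γ} {a : C.Tm Γ} (ha : C.tp a = A) : I.TypalEq A a a ha ha :=
  ⟨_, I.tp_refl A a ha⟩

theorem typalEq_trans {A : C.Ty Γ} {a b c : C.Tm Γ} {ha : C.tp a = A} {hb : C.tp b = A}
    {hc : C.tp c = A} (h : I.TypalEq A a b ha hb) (h' : I.TypalEq A b c hb hc) :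
    I.TypalEq A a c ha hc :=
  (I.hasJ_Id A b hb).transport h hc h'

theorem typalEq_symm {A : C.Ty Γ} {a b : C.Tm Γ} {ha : C.tp a = A} {hb : C.tp b = A}
    (h : I.TypalEq A a b ha hb) : I.TypalEq A b a hb ha := by
  -- The motive must be a type varying with `y`, and the types `Id A y` for separate `y` do not form
  -- one. It is obtained from the identity type based at the variable of `Γ.A`, with index the
  -- weakening of `a`; `key` identifies its fibres up to inhabitation.
  have key (y : C.Tm Γ) (hy : C.tp y = A) :
      (∃ e, C.tp e = C.tySub (C.sec A y hy) (C.tySub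
        (C.sec (C.tySub (C.p A) A) (C.tmSub (C.p A) a) (C.tp_sub_of _ ha))
        (I.Id (C.tySub (C.p A) A) (C.q A) (C.tp_q A)))) ↔ I.TypalEq A y a hy ha := by
    rw [← C.tySub_comp]
    apply I.exists_tm_Id_iff
    · rw [Category.assoc, C.sec_p, Category.comp_id, ← C.tySub_comp, C.sec_p, C.tySub_id]
    · rw [Category.assoc, C.sec_p, Category.comp_id, C.q_sec]
    · rw [C.tmSub_comp, C.q_sec, ← C.tmSub_comp, C.sec_p, C.tmSub_id]
  exact (key b hb).1 ((I.hasJ_Id A a ha).transport ((key a ha).2 (typalEq_refl ha)) hb h)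

theorem typalEq_map {A B : C.Ty Γ} {f : C.Tm (C.ext A)} (hf : C.tp f = C.tySub (C.p A) B)
    {a b : C.Tm Γ} {ha : C.tp a = A} {hb : C.tp b = A} (h : I.TypalEq A a b ha hb)
    (ha' : C.tp (C.tmSub (C.sec A a ha) f) = B) (hb' : C.tp (C.tmSub (C.sec A b hb) f) = B) :
    I.TypalEq B (C.tmSub (C.sec A a ha) f) (C.tmSub (C.sec A b hb) f) ha' hb' := by
  -- As for symmetry, the motive is one identity type over `Γ.A`, between the weakening of `f(a)`
  -- and the generic value `f(y)`.
  have key (y : C.Tm Γ) (hy : C.tp y = A) (hy' : C.tp (C.tmSub (C.sec A y hy) f) = B) :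
      (∃ e, C.tp e = C.tySub (C.sec A y hy) (C.tySub (C.sec (C.tySub (C.p A) B) f hf)
        (I.Id (C.tySub (C.p A) B) (C.tmSub (C.p A) (C.tmSub (C.sec A a ha) f))
          (C.tp_sub_of _ ha')))) ↔
        I.TypalEq B (C.tmSub (C.sec A a ha) f) (C.tmSub (C.sec A y hy) f) ha' hy' := by
    rw [← C.tySub_comp]
    apply I.exists_tm_Id_iff
    · rw [Category.assoc, C.sec_p, Category.comp_id, ← C.tySub_comp, C.sec_p, C.tySub_id]
    · rw [Category.assoc, C.sec_p, Category.comp_id, ← C.tmSub_comp (C.sec A y hy), C.sec_p,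
        C.tmSub_id]
    · rw [C.tmSub_comp, C.q_sec]
  exact (key b hb hb').1
    ((I.hasJ_Id A a ha).transport ((key a ha ha').2 (typalEq_refl ha')) hb h)

/-- Maps between two families with elimination principles that preserve the points are inverse to
each other. -/
theorem HasJ.typalEq_mapComp {A : C.Ty Δ} {x : C.Tm Δ} {hx : C.tp x = A} {B₁ B₂ : C.Ty (C.ext A)}
    {b₁ b₂ : C.Tm Δ} {hb₁ : C.tp b₁ = C.tySub (C.sec A x hx) B₁}
    {hb₂ : C.tp b₂ = C.tySub (C.sec A x hx) B₂} (hJ : I.HasJ A x hx B₁ b₁ hb₁)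
    {f : C.Tm (C.ext B₁)} (hf : C.tp f = C.tySub (C.p B₁) B₂)
    {g : C.Tm (C.ext B₂)} (hg : C.tp g = C.tySub (C.p B₂) B₁)
    (hf' : C.tp (C.tmSub (C.pair (C.sec A x hx) b₁ hb₁) f) = C.tySub (C.sec A x hx) B₂)
    (hg' : C.tp (C.tmSub (C.pair (C.sec A x hx) b₂ hb₂) g) = C.tySub (C.sec A x hx) B₁)
    (hfb : I.TypalEq _ (C.tmSub (C.pair (C.sec A x hx) b₁ hb₁) f) b₂ hf' hb₂)
    (hgb : I.TypalEq _ (C.tmSub (C.pair (C.sec A x hx) b₂ hb₂) g) b₁ hg' hb₁) :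
    I.TypalEq (C.tySub (C.p B₁) B₁) (C.mapComp f hf g) (C.q B₁) (C.tp_mapComp f hf g hg)
      (C.tp_q B₁) := by
  set r := C.pair (C.sec A x hx) b₁ hb₁ with hr
  have hG : C.tp (C.tmSub (C.lift (C.sec A x hx) B₂) g) =
      C.tySub (C.p _) (C.tySub (C.sec A x hx) B₁) := by
    rw [C.tp_sub, hg, ← C.tySub_comp, ← C.tySub_comp, C.lift_p]
  have key (c : C.Tm Δ) (hc : C.tp c = C.tySub (C.sec A x hx) B₂) :
      C.tmSub (C.sec _ c hc) (C.tmSub (C.lift (C.sec A x hx) B₂) g) =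
        C.tmSub (C.pair (C.sec A x hx) c hc) g := by
    rw [← C.tmSub_comp, C.sec_comp_lift]
  have key' (c : C.Tm Δ) (hc : C.tp c = C.tySub (C.sec A x hx) B₂) :
      C.tp (C.tmSub (C.sec _ c hc) (C.tmSub (C.lift (C.sec A x hx) B₂) g)) =
        C.tySub (C.sec A x hx) B₁ := by
    rw [key, C.tp_sub, hg, ← C.tySub_comp, C.pair_p]
  -- At the base point, `g(f(b₁)) = g(b₂)` because `f(b₁) = b₂`, and then `g(b₂) = b₁`.
  have h₁ := typalEq_map hG hfb (key' _ hf') (key' _ hb₂)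
  have h₂ := typalEq_trans h₁ (I.typalEq_congr rfl (key _ hb₂).symm rfl (key' _ hb₂) hb₁ hgb)
  have hgf : C.tmSub r (C.mapComp f hf g) =
      C.tmSub (C.sec _ _ hf') (C.tmSub (C.lift (C.sec A x hx) B₂) g) := by
    rw [key, mapComp, ← C.tmSub_comp, comp_pair]
    congr 1
    exact C.pair_congr (C.pair_p _ _ _) rfl _ _
  have hd := (I.exists_tm_Id_iff (C.tp_mapComp f hf g hg)
    (r ≫ C.sec (C.tySub (C.p B₁) B₁) (C.q B₁) (C.tp_q B₁)) (key' _ hf') hb₁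
    (by rw [Category.assoc, C.sec_p, Category.comp_id, ← C.tySub_comp, hr, C.pair_p])
    (by rw [Category.assoc, C.sec_p, Category.comp_id, hgf])
    (by rw [C.tmSub_comp, C.q_sec, hr, C.q_pair])).2 h₂
  obtain ⟨d, hd⟩ := hd
  rw [C.tySub_comp] at hd
  -- The motive is the identity type between `g(f(p))` and `p` over `B₁`. The term `d` settles the
  -- base point, and elimination extends it to all of `B₁`.
  obtain ⟨j, hj, -⟩ := hJ _ d hd
  exact ⟨j, hj⟩

/-- This is the computation rule for `γ = 𝟙`, reversed. The comparison `unbias` only absorbs the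
difference between `A` and `A[id]`. -/
theorem canMap_refl {A : C.Ty Γ} {x : C.Tm Γ} {hx : C.tp x = A} {B : C.Ty (C.ext A)}
    {b : C.Tm Γ} (hb : C.tp b = C.tySub (C.sec A x hx) B)
    (h : C.tp (C.tmSub (C.pair (C.sec A x hx) (I.refl A x hx) (I.tp_refl A x hx))
      (I.canMap A x hx B b hb)) = C.tySub (C.sec A x hx) B) :
    I.TypalEq _ (C.tmSub (C.pair (C.sec A x hx) (I.refl A x hx) (I.tp_refl A x hx))
      (I.canMap A x hx B b hb)) b h hb := by
  have e : C.pair (C.sec A x hx) (I.refl A x hx) (I.tp_refl A x hx) ≫ I.unbias A x hx =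
      I.reflSec A x hx (𝟙 Γ) := by
    rw [unbias, IdIntro.reflSec, comp_pair]
    apply C.pair_congr
    · rw [← Category.assoc, C.pair_p, comp_pair, sec]
      apply C.pair_congr
      · rw [C.pair_p]
      · rw [C.q_pair, C.tmSub_id]
    · rw [C.q_pair, C.tmSub_id]
  refine typalEq_symm (I.typalEq_congr (I.tp_motive A x hx B b hb ▸ hb) rfl ?_ _ _
    ⟨_, I.tp_Jβ A x hx (𝟙 Γ) (I.motive A x hx B) b (I.tp_motive A x hx B b hb)⟩)
  rw [canMap, ← C.tmSub_comp, e]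

/-- The canonical map to a family with the elimination principle is an equivalence. -/
theorem HasJ.isEquiv_canMap {A : C.Ty Γ} {x : C.Tm Γ} {hx : C.tp x = A} {B : C.Ty (C.ext A)}
    {b : C.Tm Γ} {hb : C.tp b = C.tySub (C.sec A x hx) B} (hJ : I.HasJ A x hx B b hb) :
    I.IsEquiv (I.Id A x hx) B (I.canMap A x hx B b hb) (I.tp_canMap A x hx B b hb) := by
  -- The inverse sends the point `b` to `refl`. Both maps then preserve points up to typal equality,
  -- so both composites are typally the identity.
  obtain ⟨g, hg, hgb⟩ := hJ (C.tySub (C.p B) (I.Id A x hx)) (I.refl A x hx) (by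
    rw [← C.tySub_comp, C.pair_p, I.tp_refl])
  have hf' : C.tp (C.tmSub (C.pair (C.sec A x hx) (I.refl A x hx) (I.tp_refl A x hx))
      (I.canMap A x hx B b hb)) = C.tySub (C.sec A x hx) B := by
    rw [C.tp_sub, I.tp_canMap, ← C.tySub_comp, C.pair_p]
  have hg' : C.tp (C.tmSub (C.pair (C.sec A x hx) b hb) g) =
      C.tySub (C.sec A x hx) (I.Id A x hx) := by
    rw [C.tp_sub, hg, ← C.tySub_comp, C.pair_p]
  have hgb' := typalEq_symm (I.typalEq_congr (by rw [← C.tySub_comp, C.pair_p]) rfl rfl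
    (I.tp_refl A x hx) hg' hgb)
  exact ⟨g, hg, (I.hasJ_Id A x hx).typalEq_mapComp _ hg hf' hg' (canMap_refl hb hf') hgb',
    hJ.typalEq_mapComp hg (I.tp_canMap A x hx B b hb) hg' hf' hgb' (canMap_refl hb hf')⟩

end WeaklyStableId

end CwF

namespace FreeCwF

variable {S : Sig.{u}}

theorem HasTy.wty {W : Set S.Sym} (hW : BoundedBy W W) {Γ : S.Con} (hΓ : WCon W Γ) {t : S.Tm}
    {A : S.Ty} (h : HasTy W (ctxL Γ) t A) : WTy W (ctxL Γ) A := by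
  cases h with
  | var h =>
    obtain ⟨i, rfl, h⟩ := h
    exact hΓ.look h
  | app hf h₂ h₃ => exact (hW.out hf).sub (IsSub.mk h₂ h₃).ctxL subset_rfl

/-! ### Accessibility of terms -/

/-- A term is accessible if its arguments and the arguments of its type are accessible. -/
inductive TAcc (W : Set S.Sym) (Γ : S.Con) : S.Tm → Prop
  | mk {t : S.Tm} :
      (∀ f σ, t = .app f σ → ∀ i < (S.bdTm f).length, TAcc W Γ (σ i)) →
      (∀ B, HasTy W (ctxL Γ) t B → ∀ i < (S.bdTy B.head).length, TAcc W Γ (B.args i)) →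
      TAcc W Γ t

/-- Weakening changes neither the raw term nor its type. Typability over `Γ` is needed so that the
types of `t` over the larger context are already types over `Γ`. -/
theorem TAcc.cons {W : Set S.Sym} (hW : BoundedBy W W) {Γ : S.Con} (hΓ : WCon W Γ) {A : S.Ty}
    {t : S.Tm} (h : TAcc W Γ t) (ht : ∃ B, HasTy W (ctxL Γ) t B) : TAcc W (A :: Γ) t := by
  induction h with
  | mk _ _ ih₁ ih₂ =>
    obtain ⟨B, hB⟩ := ht
    refine .mk (fun f σ e i hi => ?_) fun B' hB' i hi => ?_
    · subst e
      obtain ⟨A, hA⟩ := Look.exists_of_lt hi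
      exact ih₁ f σ rfl i hi ⟨_, hB.inv_app.2.1.typed i A hA⟩
    · obtain rfl := (hB.mono subset_rfl ctxL_there).unique ctxL_unique hB'
      obtain ⟨A, hA⟩ := Look.exists_of_lt hi
      exact ih₂ _ hB i hi ⟨_, (hB.wty hW hΓ).args.typed i A hA⟩

section

variable {W : Set S.Sym} {V : Set S.Sym} {Γ : S.Con}

/-- By induction on `t`, the arguments are no obstacle. What remains are the arguments of the type
of an application, which are those of the output type of its symbol after substitution; `hV`
isolates this condition. -/
theorem TAcc.sub_of_out
    (hV : ∀ f, .inr f ∈ V → ∀ σ : ℕ → S.Tm, (∀ i < (S.bdTm f).length, TAcc W Γ (σ i)) →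
      ∀ i < (S.bdTy (S.out f).head).length, TAcc W Γ (((S.out f).args i).sub (inst σ)))
    {Φ : S.Con} {t : S.Tm} {A : S.Ty} (h : HasTy V (ctxL Φ) t A) {ρ : ℕ → S.Tm}
    (hρ : ∀ i < Φ.length, TAcc W Γ (ρ i)) : TAcc W Γ (t.sub (inst ρ)) := by
  induction h with
  | var h =>
    obtain ⟨i, rfl, h⟩ := h
    exact hρ i h.lt
  | @app f σ h₁ h₂ _ ih =>
    have key (i : ℕ) (hi : i < (S.bdTm f).length) : TAcc W Γ ((σ i).sub (inst ρ)) := by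
      obtain ⟨A, hA⟩ := Look.exists_of_lt hi
      exact ih i A hA
    refine .mk (fun g τ e i hi => ?_) fun B hB i hi => ?_
    · cases e
      exact key i hi
    · obtain ⟨-, -, rfl⟩ := HasTy.inv_app hB
      exact hV f h₁ _ key i hi

/-- The output type of a symbol of stage `n + 1` is formed at stage `n`, so the condition on output
types in `TAcc.sub_of_out` is the induction hypothesis. -/
theorem TAcc.sub_of_stage {W : ℕ → Set S.Sym} (hW : IsChain W) (n : ℕ) {V : Set S.Sym}
    {Φ : S.Con} {t : S.Tm} {A : S.Ty} (h : HasTy (W n) (ctxL Φ) t A) {ρ : ℕ → S.Tm}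
    (hρ : ∀ i < Φ.length, TAcc V Γ (ρ i)) : TAcc V Γ (t.sub (inst ρ)) := by
  induction n generalizing Φ t A ρ with
  | zero =>
    refine TAcc.sub_of_out (fun f hf => ?_) h hρ
    rw [hW.zero] at hf
    exact hf.elim
  | succ n ih =>
    refine TAcc.sub_of_out (fun f hf σ hσ i hi => ?_) h hρ
    obtain ⟨B, hB⟩ := Look.exists_of_lt hi
    exact ih (((hW.bounded n).out hf).args.typed i B hB) hσ

/-- A term is its own substitution along the identity, so it is enough to treat variables. The type
of a variable is formed over a shorter context, which gives an induction on the context. -/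
theorem HasTy.tAcc {W : ℕ → Set S.Sym} (hW : IsChain W) (hΓ : WCon (⋃ n, W n) Γ)
    {t : S.Tm} {A : S.Ty} (h : HasTy (⋃ n, W n) (ctxL Γ) t A) : TAcc (⋃ n, W n) Γ t := by
  have key {Δ : S.Con} {Φ : S.Con} {t : S.Tm} {A : S.Ty} (h : HasTy (⋃ n, W n) (ctxL Φ) t A)
      {ρ : ℕ → S.Tm} (hρ : ∀ i < Φ.length, TAcc (⋃ n, W n) Δ (ρ i)) :
      TAcc (⋃ n, W n) Δ (t.sub (inst ρ)) := by
    obtain ⟨n, hn⟩ := h.exists_stage fun _ _ => hW.mono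
    exact TAcc.sub_of_stage hW n hn hρ
  suffices ∀ i < Γ.length, TAcc (⋃ n, W n) Γ (.var (.inl i)) by
    have h' := key h (Δ := Γ) (ρ := idS Γ.length) fun i hi => by
      rw [idS_of_lt hi]; exact this i hi
    rwa [h.sub_idS le_rfl] at h'
  clear h
  induction hΓ with
  | nil => exact fun i hi => absurd hi (Nat.not_lt_zero i)
  | @cons Γ A hΓ hA ih =>
    have key' {t : S.Tm} {B : S.Ty} (h : HasTy (⋃ n, W n) (ctxL Γ) t B) :
        TAcc (⋃ n, W n) (A :: Γ) t := by
      refine TAcc.cons hW.boundedBy_iUnion hΓ ?_ ⟨B, h⟩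
      have h' := key h (Δ := Γ) (ρ := idS Γ.length) fun i hi => by
        rw [idS_of_lt hi]; exact ih i hi
      rwa [h.sub_idS le_rfl] at h'
    intro i hi
    obtain ⟨B, hB⟩ := Look.exists_of_lt hi
    rcases hB with ⟨rfl, rfl⟩ | hB
    · refine .mk (fun f σ e => by cases e) fun B' hB' j hj => ?_
      obtain ⟨_, hj', hl⟩ := hB'.inv_var
      cases hj'
      obtain rfl := hl.unique Look.here
      obtain ⟨A', hA'⟩ := Look.exists_of_lt hj
      exact key' (hA.args.typed j A' hA')
    · exact key' (.var ⟨i, rfl, hB⟩)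

end

/-! ### Scoping and bound variables -/

/-- The context variables of a raw term are less than `n`. -/
def Scoped {G : Type u} (n : ℕ) : RTm G → Prop
  | .junk => True
  | .var (.inl i) => i < n
  | .var (.inr _) => True
  | .app _ σ => ∀ i, Scoped n (σ i)

theorem Scoped.sub {G : Type u} {n : ℕ} {s : ℕ ⊕ ℕ → RTm G} (hs : ∀ v, Scoped n (s v))
    (t : RTm G) : Scoped n (t.sub s) := by
  induction t with
  | junk => trivial
  | var v => exact hs v
  | app f σ ih => exact ih

theorem Scoped.inst {G : Type u} {n : ℕ} {σ : ℕ → RTm G} (hσ : ∀ i, Scoped n (σ i))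
    (v : ℕ ⊕ ℕ) : Scoped n (inst σ v) := by
  cases v with
  | inl i => exact hσ i
  | inr k => trivial

theorem Scoped.sub_congr {G : Type u} {n : ℕ} {γ γ' : ℕ → RTm G} (h : ∀ i < n, γ i = γ' i)
    {t : RTm G} (ht : Scoped n t) : t.sub (up γ) = t.sub (up γ') := by
  induction t with
  | junk => rfl
  | var v =>
    cases v with
    | inl i => exact h i ht
    | inr k => rfl
  | app f σ ih => simp only [RTm.sub_app, RTm.app.injEq, true_and]; funext i; exact ih i (ht i)

theorem Scoped.mono {G : Type u} {m n : ℕ} (h : m ≤ n) {t : RTm G} (ht : Scoped m t) :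
    Scoped n t := by
  induction t with
  | junk => trivial
  | var v =>
    cases v with
    | inl i => exact lt_of_lt_of_le (show i < m from ht) h
    | inr k => trivial
  | app f σ ih => exact fun i => ih i (ht i)

/-- The arguments of a raw type are scoped. -/
def TyScoped (n : ℕ) (A : S.Ty) : Prop := ∀ i, Scoped n (A.args i)

theorem TyScoped.sub_congr {n : ℕ} {γ γ' : ℕ → S.Tm} (h : ∀ i < n, γ i = γ' i)
    {A : S.Ty} (hA : TyScoped n A) : A.sub (up γ) = A.sub (up γ') := by
  ext1
  · rfl
  · funext i; exact (hA i).sub_congr h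

/-- The variables of a raw context `Γ` and bound variables with the types in `Θ`. -/
def bvL (Γ Θ : S.Con) (v : ℕ ⊕ ℕ) (A : S.Ty) : Prop := ctxL Γ v A ∨ ∃ k, v = .inr k ∧ Look Θ k A

theorem bvL_unique {Γ Θ : S.Con} (v : ℕ ⊕ ℕ) (A B : S.Ty) (h : bvL Γ Θ v A) (h' : bvL Γ Θ v B) :
    A = B := by
  rcases h with h | ⟨k, rfl, h⟩
  · rcases h' with h' | ⟨k', rfl, -⟩
    · exact ctxL_unique _ _ _ h h'
    · obtain ⟨i, hi, -⟩ := h; cases hi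
  · rcases h' with ⟨i, hi, -⟩ | ⟨k', hk, h'⟩
    · cases hi
    · cases hk; exact h.unique h'

theorem bvL_of_ctxL {Γ Θ : S.Con} (v : ℕ ⊕ ℕ) (A : S.Ty) (h : ctxL Γ v A) : bvL Γ Θ v A := .inl h

theorem HasTy.to_bvL {W : Set S.Sym} {Γ Θ : S.Con} {t : S.Tm} {A : S.Ty}
    (h : HasTy W (ctxL Γ) t A) : HasTy W (bvL Γ Θ) t A := h.mono subset_rfl bvL_of_ctxL

theorem bvL_nil {Γ : S.Con} : bvL Γ [] = ctxL Γ := by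
  funext v A
  simp [bvL]

theorem HasTy.scoped {W : Set S.Sym} {Γ Θ : S.Con} {t : S.Tm} {A : S.Ty}
    (h : HasTy W (bvL Γ Θ) t A) : Scoped Γ.length t := by
  induction h with
  | var h =>
    rcases h with ⟨i, rfl, h⟩ | ⟨k, rfl, -⟩
    · exact h.lt
    · trivial
  | @app f σ _ h₂ _ ih =>
    intro i
    by_cases hi : i < (S.bdTm f).length
    · obtain ⟨A, hA⟩ := Look.exists_of_lt hi
      exact ih i A hA
    · rw [h₂ i (not_lt.1 hi)]; trivial

theorem IsSub.scoped {W : Set S.Sym} {Γ Θ Φ : S.Con} {σ : ℕ → S.Tm}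
    (h : IsSub W (bvL Γ Θ) Φ σ) (i : ℕ) : Scoped Γ.length (σ i) := by
  by_cases hi : i < Φ.length
  · obtain ⟨A, hA⟩ := Look.exists_of_lt hi
    exact (h.typed i A hA).scoped
  · rw [h.junk i (not_lt.1 hi)]; trivial

theorem WTy.scoped {W : Set S.Sym} {Γ Θ : S.Con} {A : S.Ty} (h : WTy W (bvL Γ Θ) A) :
    TyScoped Γ.length A := h.args.scoped

theorem HasTy.tyScoped {W : Set S.Sym} {Γ Θ : S.Con} (hΓ : WCon W Γ)
    (hΘ : ∀ k A, Look Θ k A → TyScoped Γ.length A) {t : S.Tm} {A : S.Ty}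
    (h : HasTy W (bvL Γ Θ) t A) : TyScoped Γ.length A := by
  cases h with
  | var h =>
    rcases h with ⟨i, rfl, h⟩ | ⟨k, rfl, h⟩
    · exact ((hΓ.look h).mono subset_rfl (bvL_of_ctxL (Θ := []))).scoped
    · exact hΘ k A h
  | app hf h₂ h₃ => exact fun i => Scoped.sub (Scoped.inst (IsSub.mk h₂ h₃).scoped) _

theorem HasTy.sub_up_eq {W : Set S.Sym} {Γ : S.Con} {t : S.Tm} {A : S.Ty}
    (h : HasTy W (ctxL Γ) t A) (δ : ℕ → S.Tm) : t.sub (up δ) = t.sub (inst δ) :=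
  h.sub_congr fun v A hv => by
    obtain ⟨i, rfl, -⟩ := hv; rfl

theorem WTy.sub_up_eq {W : Set S.Sym} {Γ : S.Con} {A : S.Ty}
    (h : WTy W (ctxL Γ) A) (δ : ℕ → S.Tm) : A.sub (up δ) = A.sub (inst δ) :=
  h.sub_congr fun v A hv => by
    obtain ⟨i, rfl, -⟩ := hv; rfl

/-- Substitution of the context variables in the presence of bound variables. -/
theorem IsSub.up {W : Set S.Sym} {Γ Δ Θ : S.Con} (hΓ : WCon W Γ) {δ : ℕ → S.Tm}
    (h : IsSub W (FreeCwF.ctxL Δ) Γ δ) (v : ℕ ⊕ ℕ) (A : S.Ty) (hv : bvL Γ Θ v A) :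
    HasTy W (bvL Δ (Θ.map (RTy.sub (up δ)))) (up δ v) (A.sub (up δ)) := by
  rcases hv with ⟨i, rfl, hA⟩ | ⟨k, rfl, hA⟩
  · rw [(hΓ.look hA).sub_up_eq]
    exact (h.typed i A hA).to_bvL
  · exact .var (.inr ⟨k, rfl, hA.map⟩)

/-- A term with bound variables is typed without them if it is so after a substitution. -/
theorem HasTy.of_sub_up {W : Set S.Sym} {Γ Δ Θ : S.Con} {δ : ℕ → S.Tm} {t : S.Tm} {A B : S.Ty}
    (h : HasTy W (bvL Γ Θ) t A) (h' : HasTy W (ctxL Δ) (t.sub (up δ)) B) :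
    HasTy W (ctxL Γ) t A := by
  induction h generalizing B with
  | var h =>
    rcases h with h | ⟨k, rfl, -⟩
    · exact .var h
    · obtain ⟨i, hi, -⟩ := h'.inv_var; cases hi
  | app h₁ h₂ _ ih =>
    exact .app h₁ h₂ fun i A hA => ih i A hA (h'.inv_app.2.1.typed i A hA)

end FreeCwF

namespace FreeCwF

variable {S : Sig.{u}}

/-! ### Generic contexts -/

/-- A connected diagram of raw contexts and raw substitutions. -/
structure Diagram (W : Set S.Sym) where
  K : Type u
  ctx : K → S.Con
  wf : ∀ k, WCon W (ctx k)
  arr : K → K → (ℕ → S.Tm) → Prop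
  arr_sub : ∀ {k l δ}, arr k l δ → IsSub W (ctxL (ctx k)) (ctx l) δ
  connected : ∀ P : K → Prop, (∀ k l δ, arr k l δ → (P k ↔ P l)) → ∀ k l, P k → P l

variable {W : Set S.Sym} (X : Diagram W)

/-- A family of raw terms, one over each context of a diagram, that is stable under the
substitutions of the diagram. -/
def Diagram.Natural (t : X.K → S.Tm) : Prop :=
  ∀ k l δ, X.arr k l δ → (t l).sub (up δ) = t k

/-- A cone over a diagram of contexts for which a term over the apex is determined by its
restrictions. -/
structure Diagram.Cone where
  apex : S.Con
  wf : WCon W apex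
  leg : X.K → ℕ → S.Tm
  isSub : ∀ k, IsSub W (ctxL (X.ctx k)) apex (leg k)
  nat : ∀ i, X.Natural fun k => leg k i
  inj : ∀ i < apex.length, ∀ j < apex.length, (∀ k, leg k i = leg k j) → i = j
  exists_var : ∀ i < apex.length, ∃ k j, leg k i = .var (.inl j)

variable {X}

namespace Diagram

/-- The cone `c'` extends the cone `c`. -/
structure Cone.Le (c c' : X.Cone) : Prop where
  look : ∀ i A, Look c.apex i A → Look c'.apex i A
  leg : ∀ k, ∀ i < c.apex.length, c'.leg k i = c.leg k i

namespace Cone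

theorem Le.refl (c : X.Cone) : c.Le c := ⟨fun _ _ => id, fun _ _ _ => rfl⟩

theorem Le.length {c c' : X.Cone} (h : c.Le c') : c.apex.length ≤ c'.apex.length := by
  by_contra! hlt
  obtain ⟨A, hA⟩ := Look.exists_of_lt hlt
  exact lt_irrefl _ (h.look _ _ hA).lt

theorem Le.trans {c c' c'' : X.Cone} (h : c.Le c') (h' : c'.Le c'') : c.Le c'' :=
  ⟨fun i A hA => h'.look i A (h.look i A hA),
    fun k i hi => (h'.leg k i (hi.trans_le h.length)).trans (h.leg k i hi)⟩

/-- The empty cone. -/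
def empty (X : Diagram W) : X.Cone where
  apex := []
  wf := .nil
  leg _ _ := .junk
  isSub _ := ⟨fun _ _ => rfl, fun _ _ h => h.elim⟩
  nat _ _ _ _ _ := rfl
  inj _ h := absurd h (Nat.not_lt_zero _)
  exists_var _ h := absurd h (Nat.not_lt_zero _)

/-- Substitution commutes with symbols, so only variables could cause a clash. `inj` separates
distinct variables of the apex, and `exists_var` prevents a variable from having the same
restrictions as a term that is not a variable. The object `k₀` excludes the empty diagram, where the
hypothesis is void. -/
theorem tm_ext (c : X.Cone) {t t' : S.Tm} (h : Scoped c.apex.length t)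
    (h' : Scoped c.apex.length t') (e : ∀ k, t.sub (up (c.leg k)) = t'.sub (up (c.leg k)))
    (k₀ : X.K) : t = t' := by
  have key (i : ℕ) (hi : i < c.apex.length) (t : S.Tm) (h : Scoped c.apex.length t)
      (e : ∀ k, c.leg k i = t.sub (up (c.leg k))) : .var (.inl i) = t := by
    obtain ⟨k, j, hj⟩ := c.exists_var i hi
    have e' := e k
    rw [hj] at e'
    match t, h, e, e' with
    | .var (.inl i'), h, e, _ => rw [c.inj i hi i' h e]
  induction t generalizing t' with
  | junk =>
    match t', h', e with
    | .junk, _, _ => rfl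
    | .var (.inl i), h', e => exact (key i h' _ h fun k => (e k).symm).symm
    | .var (.inr i), _, e => cases e k₀
    | .app g τ, _, e => cases e k₀
  | var v =>
    cases v with
    | inl i => exact key i h _ h' e
    | inr b =>
      match t', h', e with
      | .junk, _, e => cases e k₀
      | .var (.inl i), h', e => exact (key i h' _ h fun k => (e k).symm).symm
      | .var (.inr i), _, e => exact e k₀
      | .app g τ, _, e => cases e k₀
  | app f σ ih =>
    match t', h', e with
    | .junk, _, e => cases e k₀
    | .var (.inl i), h', e => exact (key i h' _ h fun k => (e k).symm).symm
    | .var (.inr i), _, e => cases e k₀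
    | .app g τ, h', e =>
      simp only [RTm.sub_app, RTm.app.injEq] at e
      rw [(e k₀).1]
      congr 1
      funext i
      exact ih i (h i) (h' i) fun k => congrFun (e k).2 i

theorem ty_ext (c : X.Cone) {A A' : S.Ty} (h : TyScoped c.apex.length A)
    (h' : TyScoped c.apex.length A') (e : ∀ k, A.sub (up (c.leg k)) = A'.sub (up (c.leg k)))
    (k₀ : X.K) : A = A' := by
  ext1
  · have e₀ := congrArg RTy.head (e k₀)
    exact e₀
  · funext i
    exact c.tm_ext (h i) (h' i) (fun k => congrFun (congrArg RTy.args (e k)) i) k₀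

/-- The restrictions to the contexts of the diagram of the types of bound variables. -/
def bd (c : X.Cone) (Θ : S.Con) (k : X.K) : S.Con := Θ.map (RTy.sub (up (c.leg k)))

theorem Le.bd {c c' : X.Cone} (h : c.Le c') {Θ : S.Con}
    (hΘ : ∀ b A, Look Θ b A → TyScoped c.apex.length A) (k : X.K) : c'.bd Θ k = c.bd Θ k := by
  refine Look.list_ext (by simp [Cone.bd]) fun i A hA => ?_
  obtain ⟨B, hB, rfl⟩ := Look.map_iff.1 hA
  rw [(hΘ i B hB).sub_congr (h.leg k)]
  exact hB.map

/-- A family of raw terms over the diagram comes from a term over the apex of an extension. -/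
def Amal (c : X.Cone) (Θ : S.Con) (t : X.K → S.Tm) : Prop :=
  ∃ c' : X.Cone, c.Le c' ∧ ∃ t' A', HasTy W (bvL c'.apex Θ) t' A' ∧
    ∀ k, t'.sub (up (c'.leg k)) = t k

theorem restrict {c : X.Cone} {Θ : S.Con} {t : S.Tm} {A : S.Ty} (h : HasTy W (bvL c.apex Θ) t A)
    (k : X.K) : HasTy W (bvL (X.ctx k) (c.bd Θ k)) (t.sub (up (c.leg k))) (A.sub (up (c.leg k))) :=
  h.sub (IsSub.up c.wf (c.isSub k)) subset_rfl

theorem tyScoped_mono {c c' : X.Cone} (h : c.Le c') {Θ : S.Con}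
    (hΘ : ∀ b A, Look Θ b A → TyScoped c.apex.length A) (b : ℕ) (A : S.Ty) (hb : Look Θ b A) :
    TyScoped c'.apex.length A := fun i => (hΘ b A hb i).mono h.length

/-- The entries are amalgamated one after another, each possibly enlarging the apex; hence `h` has
to be available for every extension of `c`. Earlier entries survive, because their restrictions
depend only on the old part of the legs. -/
theorem amal_isSub (k₀ : X.K) {c : X.Cone} {Θ : S.Con}
    (hΘ : ∀ b A, Look Θ b A → TyScoped c.apex.length A) {Φ : S.Con} {σ : X.K → ℕ → S.Tm}
    (hσ : ∀ k, IsSub W (bvL (X.ctx k) (c.bd Θ k)) Φ (σ k))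
    (h : ∀ i < Φ.length, ∀ c' : X.Cone, c.Le c' → c'.Amal Θ fun k => σ k i) :
    ∃ c' : X.Cone, c.Le c' ∧ ∃ σ', IsSub W (bvL c'.apex Θ) Φ σ' ∧
      ∀ k i, (σ' i).sub (up (c'.leg k)) = σ k i := by
  have key (n : ℕ) (hn : n ≤ Φ.length) : ∃ c' : X.Cone, c.Le c' ∧ ∃ σ' : ℕ → S.Tm,
      (∀ i < n, ∃ A, HasTy W (bvL c'.apex Θ) (σ' i) A) ∧ (∀ i, n ≤ i → σ' i = .junk) ∧
      ∀ k, ∀ i < n, (σ' i).sub (up (c'.leg k)) = σ k i := by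
    induction n with
    | zero => exact ⟨c, .refl c, fun _ => .junk, by simp, by simp, by simp⟩
    | succ n ih =>
      obtain ⟨c₁, h₁, σ', hσ', hj, e⟩ := ih (Nat.le_of_succ_le hn)
      obtain ⟨c₂, h₂, t, A, ht, et⟩ := h n hn c₁ h₁
      refine ⟨c₂, h₁.trans h₂, Function.update σ' n t, fun i hi => ?_, fun i hi => ?_,
        fun k i hi => ?_⟩
      · rcases Nat.lt_succ_iff_lt_or_eq.1 hi with hi | rfl
        · obtain ⟨B, hB⟩ := hσ' i hi
          rw [Function.update_of_ne hi.ne]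
          refine ⟨B, hB.mono subset_rfl ?_⟩
          rintro v A (⟨i, rfl, hA⟩ | hv)
          · exact .inl ⟨i, rfl, h₂.look i A hA⟩
          · exact .inr hv
        · rw [Function.update_self]; exact ⟨A, ht⟩
      · rw [Function.update_of_ne (by omega)]; exact hj i (by omega)
      · rcases Nat.lt_succ_iff_lt_or_eq.1 hi with hi | rfl
        · obtain ⟨B, hB⟩ := hσ' i hi
          rw [Function.update_of_ne hi.ne, ← e k i hi]
          exact hB.scoped.sub_congr (h₂.leg k)
        · rw [Function.update_self]; exact et k
  obtain ⟨c', hc, σ', hσ', hj, e⟩ := key _ le_rfl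
  have e' (k : X.K) (i : ℕ) : (σ' i).sub (up (c'.leg k)) = σ k i := by
    by_cases hi : i < Φ.length
    · exact e k i hi
    · rw [hj i (not_lt.1 hi), (hσ k).junk i (not_lt.1 hi)]; rfl
  have hsc (i : ℕ) : Scoped c'.apex.length (σ' i) := by
    by_cases hi : i < Φ.length
    · exact (hσ' i hi).choose_spec.scoped
    · rw [hj i (not_lt.1 hi)]; trivial
  refine ⟨c', hc, σ', ⟨hj, fun i A hA => ?_⟩, e'⟩
  obtain ⟨B, hB⟩ := hσ' i hA.lt
  -- Amalgamation yields some type `B` for the entry. It has the same restrictions as the expected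
  -- type, hence is equal to it.
  obtain rfl : B = A.sub (inst σ') := by
    refine c'.ty_ext (hB.tyScoped c'.wf (tyScoped_mono hc hΘ))
      (fun j => Scoped.sub (Scoped.inst hsc) _) (fun k => ?_) k₀
    have h₁ := restrict hB k
    rw [hc.bd hΘ, e'] at h₁
    rw [h₁.unique bvL_unique ((hσ k).typed i A hA), RTy.sub_inst_sub]
    simp only [e']
  exact hB

end Cone

/-- Along an arrow, `t k` is a substitution instance of `t l`. Such an instance keeps the head of `t
l` unless `t l` is a context variable. If no member is a context variable, heads agree along every
arrow in both directions and are constant by connectedness. -/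
theorem Natural.classify {t : X.K → S.Tm} (ht : X.Natural t) (h : ∀ k, t k ≠ .junk) (k₀ : X.K) :
    (∃ k j, t k = .var (.inl j)) ∨ (∃ b, ∀ k, t k = .var (.inr b)) ∨
      ∃ f, ∃ τ : X.K → ℕ → S.Tm, ∀ k, t k = .app f (τ k) := by
  by_cases hv : ∃ k j, t k = .var (.inl j)
  · exact .inl hv
  push Not at hv
  match h₀ : t k₀ with
  | .junk => exact absurd h₀ (h k₀)
  | .var (.inl j) => exact absurd h₀ (hv k₀ j)
  | .var (.inr b) =>
    refine .inr (.inl ⟨b, fun k => X.connected (fun k => t k = .var (.inr b)) ?_ k₀ k h₀⟩)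
    refine fun k l δ hδ => ⟨fun e => ?_, fun e => by rw [← ht k l δ hδ, e]; rfl⟩
    have e' := ht k l δ hδ
    rw [e] at e'
    match hl : t l with
    | .junk => exact absurd hl (h l)
    | .var (.inl j) => exact absurd hl (hv l j)
    | .var (.inr b') => rw [hl] at e'; exact e'
    | .app f τ => rw [hl] at e'; cases e'
  | .app f τ =>
    have key (k : X.K) : ∃ τ, t k = .app f τ := by
      refine X.connected (fun k => ∃ τ, t k = .app f τ) ?_ k₀ k ⟨τ, h₀⟩
      refine fun k l δ hδ => ⟨?_, ?_⟩
      · rintro ⟨τ, e⟩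
        have e' := ht k l δ hδ
        rw [e] at e'
        match hl : t l with
        | .junk => exact absurd hl (h l)
        | .var (.inl j) => exact absurd hl (hv l j)
        | .var (.inr b') => rw [hl] at e'; cases e'
        | .app g τ' => rw [hl] at e'; cases e'; exact ⟨_, rfl⟩
      · rintro ⟨τ, e⟩
        exact ⟨_, by rw [← ht k l δ hδ, e]; rfl⟩
    choose τ hτ using key
    exact .inr (.inr ⟨f, τ, hτ⟩)

theorem Natural.args {t : X.K → S.Tm} (ht : X.Natural t) {f : S.GTm} {τ : X.K → ℕ → S.Tm}
    (e : ∀ k, t k = .app f (τ k)) (i : ℕ) : X.Natural fun k => τ k i := fun k l δ hδ => by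
  have := ht k l δ hδ
  rw [e, e] at this
  simp only [RTm.sub_app, RTm.app.injEq, true_and] at this
  exact congrFun this i

/-- Extension of a cone by a natural family of terms that is a variable somewhere. -/
theorem Cone.exists_snoc (c : X.Cone) {A : S.Ty} (hA : WTy W (ctxL c.apex) A) {t : X.K → S.Tm}
    (ht : X.Natural t) (hv : ∃ k j, t k = .var (.inl j))
    (h : ∀ k, HasTy W (ctxL (X.ctx k)) (t k) (A.sub (up (c.leg k)))) : c.Amal [] t := by
  -- If an existing variable already restricts to `t` it is reused; a second copy would violate
  -- `inj`.
  by_cases hi : ∃ i < c.apex.length, ∀ k, c.leg k i = t k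
  · obtain ⟨i, hi, e⟩ := hi
    obtain ⟨B, hB⟩ := Look.exists_of_lt hi
    exact ⟨c, .refl c, .var (.inl i), B, .var (.inl ⟨i, rfl, hB⟩), e⟩
  push Not at hi
  refine ⟨{
      apex := A :: c.apex
      wf := .cons c.wf hA
      leg := fun k => Function.update (c.leg k) c.apex.length (t k)
      isSub := fun k => (c.isSub k).update (.cons c.wf hA) (by
        rw [← hA.sub_up_eq]; exact h k)
      nat := fun i k l δ hδ => ?_
      inj := fun i hi' j hj' e => ?_
      exists_var := fun i hi' => ?_ }, ⟨fun i B hB => hB.there, fun k i hi => ?_⟩,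
    .var (.inl c.apex.length), A, .var (.inl ⟨_, rfl, Look.here⟩), fun k => ?_⟩
  · by_cases hi : i = c.apex.length
    · subst hi
      simp only [Function.update_self]
      exact ht k l δ hδ
    · simp only [Function.update_of_ne hi]
      exact c.nat i k l δ hδ
  · simp only [List.length_cons] at hi' hj'
    rcases Nat.lt_succ_iff_lt_or_eq.1 hi' with h₁ | rfl <;>
      rcases Nat.lt_succ_iff_lt_or_eq.1 hj' with h₂ | rfl
    · simp only [Function.update_of_ne h₁.ne, Function.update_of_ne h₂.ne] at e
      exact c.inj i h₁ j h₂ e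
    · simp only [Function.update_of_ne h₁.ne, Function.update_self] at e
      obtain ⟨k, hk⟩ := hi i h₁
      exact absurd (e k) hk
    · simp only [Function.update_of_ne h₂.ne, Function.update_self] at e
      obtain ⟨k, hk⟩ := hi j h₂
      exact absurd (e k).symm hk
    · rfl
  · simp only [List.length_cons] at hi'
    rcases Nat.lt_succ_iff_lt_or_eq.1 hi' with h₁ | rfl
    · simp only [Function.update_of_ne h₁.ne]
      exact c.exists_var i h₁
    · simpa only [Function.update_self] using hv
  · exact Function.update_of_ne hi.ne _ _
  · exact Function.update_self ..

/-- A natural family of terms without bound variables can be amalgamated. -/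
theorem Cone.amal_of_tAcc (hW : BoundedBy W W) {k₀ : X.K} {t : X.K → S.Tm}
    (hacc : TAcc W (X.ctx k₀) (t k₀)) (h : ∀ k, ∃ B, HasTy W (ctxL (X.ctx k)) (t k) B)
    (ht : X.Natural t) (c : X.Cone) : c.Amal [] t := by
  generalize e₀ : t k₀ = t₀ at hacc
  induction hacc generalizing t c with
  | mk _ _ ih₁ ih₂ =>
    subst e₀
    rcases ht.classify (fun k => (h k).choose_spec.ne_junk) k₀ with hv | ⟨b, e⟩ | ⟨f, τ, e⟩
    -- Variable case: by uniqueness of typing the types of the `t k` form a natural family with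
    -- constant head. Their arguments at `k₀` are accessibility predecessors, so they amalgamate to
    -- a type over the apex, and `t` is adjoined as a variable of that type.
    · choose B hB using h
      have hBn (k l : X.K) (δ : ℕ → S.Tm) (hδ : X.arr k l δ) : (B l).sub (up δ) = B k := by
        have h₁ := (hB l).sub (X.arr_sub hδ).ctxL subset_rfl
        rw [← (hB l).sub_up_eq, ht k l δ hδ] at h₁
        rw [((hB l).wty hW (X.wf l)).sub_up_eq]
        exact h₁.unique ctxL_unique (hB k)
      have hh (k : X.K) : (B k).head = (B k₀).head := by
        refine X.connected (fun k => (B k).head = (B k₀).head) (fun k l δ hδ => ?_) k₀ k rfl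
        rw [← hBn k l δ hδ]; rfl
      have hBw (k : X.K) : WTy W (ctxL (X.ctx k)) (B k) := (hB k).wty hW (X.wf k)
      have hBs (k : X.K) : IsSub W (ctxL (X.ctx k)) (S.bdTy (B k₀).head) (B k).args := by
        rw [← hh k]; exact (hBw k).args
      obtain ⟨c', hc, σ', hσ', e⟩ := c.amal_isSub k₀ (Θ := []) (Φ := S.bdTy (B k₀).head)
        (σ := fun k => (B k).args) (fun _ _ h => h.elim)
        (fun k => (hBs k).mono subset_rfl bvL_of_ctxL)
        (fun i hi c' _ => by
          obtain ⟨A, hA⟩ := Look.exists_of_lt hi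
          exact ih₂ (B k₀) (hB k₀) i hi (fun k => ⟨_, (hBs k).typed i A hA⟩)
            (fun k l δ hδ => congrFun (congrArg RTy.args (hBn k l δ hδ)) i) c' rfl)
      obtain ⟨c'', hc', r⟩ := c'.exists_snoc (A := ⟨(B k₀).head, σ'⟩)
        ⟨(hBw k₀).mem, by rwa [bvL_nil] at hσ'⟩ ht hv (fun k => by
          convert hB k using 1
          ext1
          · exact (hh k).symm
          · funext i; exact e k i)
      exact ⟨c'', hc.trans hc', r⟩
    · obtain ⟨B, hB⟩ := h k₀
      rw [e] at hB
      obtain ⟨i, hi, -⟩ := hB.inv_var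
      cases hi
    -- Application case: the arguments at `k₀` are accessibility predecessors, and no type has to be
    -- amalgamated.
    · have hs (k : X.K) : .inr f ∈ W ∧ IsSub W (ctxL (X.ctx k)) (S.bdTm f) (τ k) := by
        obtain ⟨B, hB⟩ := h k
        rw [e] at hB
        exact ⟨hB.inv_app.1, hB.inv_app.2.1⟩
      obtain ⟨c', hc, σ', hσ', e'⟩ := c.amal_isSub k₀ (Θ := []) (Φ := S.bdTm f)
        (σ := τ) (fun _ _ h => h.elim)
        (fun k => (hs k).2.mono subset_rfl bvL_of_ctxL)
        (fun i hi c' _ => by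
          obtain ⟨A, hA⟩ := Look.exists_of_lt hi
          exact ih₁ f (τ k₀) (e k₀) i hi (fun k => ⟨_, (hs k).2.typed i A hA⟩)
            (ht.args e i) c' rfl)
      exact ⟨c', hc, _, _, .of_isSub (hs k₀).1 hσ', fun k => by
        rw [e, RTm.sub_app]; simp only [e']⟩

/-- Substitution of context variables neither creates nor removes occurrences of bound variables.
Their absence at one object therefore spreads along arrows in both directions. -/
theorem Natural.hasTy_ctxL {t : X.K → S.Tm} (ht : X.Natural t) {Θ : X.K → S.Con}
    (h : ∀ k, ∃ B, HasTy W (bvL (X.ctx k) (Θ k)) (t k) B) {k₁ : X.K}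
    (h₁ : ∃ B, HasTy W (ctxL (X.ctx k₁)) (t k₁) B) (k : X.K) :
    ∃ B, HasTy W (ctxL (X.ctx k)) (t k) B := by
  refine X.connected (fun k => ∃ B, HasTy W (ctxL (X.ctx k)) (t k) B) ?_ k₁ k h₁
  refine fun k l δ hδ => ⟨?_, ?_⟩
  · rintro ⟨B, hB⟩
    obtain ⟨A, hA⟩ := h l
    rw [← ht k l δ hδ] at hB
    exact ⟨A, hA.of_sub_up hB⟩
  · rintro ⟨B, hB⟩
    have h₂ := hB.sub (X.arr_sub hδ).ctxL subset_rfl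
    rw [← hB.sub_up_eq, ht k l δ hδ] at h₂
    exact ⟨_, h₂⟩

/-- A natural family of terms with bound variables can be amalgamated. -/
theorem Cone.amal (hW : BoundedBy W W)
    (hacc : ∀ Γ t A, WCon W Γ → HasTy W (ctxL Γ) t A → TAcc W Γ t) (k₀ : X.K) {Θ : S.Con}
    {t : X.K → S.Tm} (ht : X.Natural t) (c : X.Cone)
    (hΘ : ∀ b A, Look Θ b A → TyScoped c.apex.length A)
    (h : ∀ k, ∃ B, HasTy W (bvL (X.ctx k) (c.bd Θ k)) (t k) B) : c.Amal Θ t := by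
  -- A context variable at some `k₁` contains no bound variable, so no member of the family does.
  -- The previous case applies, with accessibility taken at `k₁`.
  have of_var {t : X.K → S.Tm} (ht : X.Natural t) (c : X.Cone)
      (h : ∀ k, ∃ B, HasTy W (bvL (X.ctx k) (c.bd Θ k)) (t k) B)
      (hv : ∃ k j, t k = .var (.inl j)) : c.Amal Θ t := by
    obtain ⟨k₁, j, hv⟩ := hv
    have h₁ : ∃ B, HasTy W (ctxL (X.ctx k₁)) (t k₁) B := by
      obtain ⟨B, hB⟩ := h k₁
      rw [hv] at hB ⊢
      rcases hB.inv_var with hB | ⟨b, hb, -⟩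
      · exact ⟨B, .var hB⟩
      · cases hb
    obtain ⟨c', hc, t', A', h', e'⟩ := c.amal_of_tAcc hW (k₀ := k₁) (t := t)
      (hacc _ _ _ (X.wf k₁) h₁.choose_spec) (ht.hasTy_ctxL h h₁) ht
    exact ⟨c', hc, t', A', (show HasTy W (ctxL c'.apex) t' A' by rwa [bvL_nil] at h').to_bvL, e'⟩
  -- Types are only needed in the variable case, which `of_var` settles, so structural induction on
  -- the member at `k₀` suffices here.
  generalize e₀ : t k₀ = t₀
  induction t₀ generalizing t c with
  | junk => exact absurd e₀ (h k₀).choose_spec.ne_junk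
  | var v =>
    rcases ht.classify (fun k => (h k).choose_spec.ne_junk) k₀ with hv | ⟨b, e⟩ | ⟨f, τ, e⟩
    · exact of_var ht c h hv
    · obtain ⟨B, hB⟩ := h k₀
      rw [e] at hB
      rcases hB.inv_var with ⟨i, hi, -⟩ | ⟨b', hb, hl⟩
      · cases hi
      · cases hb
        obtain ⟨A, hA, -⟩ := Look.map_iff.1 hl
        exact ⟨c, .refl c, .var (.inr b), A, .var (.inr ⟨b, rfl, hA⟩), fun k => (e k).symm⟩
    · rw [e] at e₀; cases e₀
  | app f₀ τ₀ ih =>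
    rcases ht.classify (fun k => (h k).choose_spec.ne_junk) k₀ with hv | ⟨b, e⟩ | ⟨f, τ, e⟩
    · exact of_var ht c h hv
    · rw [e] at e₀; cases e₀
    · have hs (k : X.K) :
          .inr f ∈ W ∧ IsSub W (bvL (X.ctx k) (c.bd Θ k)) (S.bdTm f) (τ k) := by
        obtain ⟨B, hB⟩ := h k
        rw [e] at hB
        exact ⟨hB.inv_app.1, hB.inv_app.2.1⟩
      obtain ⟨c', hc, σ', hσ', e'⟩ := c.amal_isSub k₀ hΘ (fun k => (hs k).2)
        (fun i hi c' hc => by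
          obtain ⟨A, hA⟩ := Look.exists_of_lt hi
          refine ih i (ht.args e i) c' (tyScoped_mono hc hΘ) (fun k => ?_) ?_
          · rw [hc.bd hΘ]
            exact ⟨_, (hs k).2.typed i A hA⟩
          · rw [e] at e₀; cases e₀; rfl)
      exact ⟨c', hc, _, _, .of_isSub (hs k₀).1 hσ', fun k => by
        rw [e, RTm.sub_app]; simp only [e']⟩

end Diagram

end FreeCwF

/-! ### Lifting identity types along a trivial fibration -/

namespace CwF

namespace Hom

variable {D C : CwF.{u}} {F : D ⟶ C}

/-- The image under `F` of a substitution into `Γ.A`. -/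
theorem map_pair {Δ Γ : D.Ctx} {A : D.Ty Γ} (σ : Δ ⟶ Γ) (a : D.Tm Δ)
    (h : D.tp a = D.tySub σ A) :
    F.map (D.pair σ a h) ≫ eqToHom (F.obj_ext A) = C.pair (F.map σ) (F.tm a)
      (by rw [F.tp_tm, h, F.ty_sub]) := by
  apply C.ext_hom
  · rw [Category.assoc, ← F.map_p, ← F.map_comp, D.pair_p, C.pair_p]
  · rw [C.tmSub_comp, ← F.tm_q, ← F.tm_sub, D.q_pair, C.q_pair]

theorem map_sec_tyExt {Γ : D.Ctx} {A : D.Ty Γ} {x : D.Tm Γ} (hx : D.tp x = A) (B : D.Ty (D.ext A)) :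
    C.tySub (C.sec (F.ty A) (F.tm x) (tp_tm_of F hx)) (tyExt F B) =
      F.ty (D.tySub (D.sec A x hx) B) := by
  rw [F.ty_sub, map_sec, C.tySub_comp, tyExt]

section

variable (I : WeaklyStableId C) {Γ : D.Ctx} (G : D.Ty Γ)

theorem exists_idLift (hF : IsTrivialFibration F) : ∃ B : D.Ty (D.ext (D.tySub (D.p G) G)), F.ty B =
    C.tySub (eqToHom (F.obj_ext _))
      (I.Id (F.ty (D.tySub (D.p G) G)) (F.tm (D.q G)) (tp_tm_of F (D.tp_q G))) :=
  hF.ty_lift _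

/-- A lift of the identity type on the family `G` to the context `Γ.(x : G).(y : G)`. -/
noncomputable def idLift (hF : IsTrivialFibration F) : D.Ty (D.ext (D.tySub (D.p G) G)) :=
  (exists_idLift I G hF).choose

theorem ty_idLift (hF : IsTrivialFibration F) : F.ty (idLift I G hF) =
    C.tySub (eqToHom (F.obj_ext _))
      (I.Id (F.ty (D.tySub (D.p G) G)) (F.tm (D.q G)) (tp_tm_of F (D.tp_q G))) :=
  (exists_idLift I G hF).choose_spec

theorem exists_reflLift (hF : IsTrivialFibration F) : ∃ b : D.Tm (D.ext G),
    D.tp b = D.tySub (D.sec _ (D.q G) (D.tp_q G)) (idLift I G hF) ∧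
      F.tm b = I.refl (F.ty (D.tySub (D.p G) G)) (F.tm (D.q G)) (tp_tm_of F (D.tp_q G)) := by
  apply hF.tm_lift
  rw [I.tp_refl, ← map_sec_tyExt, tyExt, ty_idLift, ← C.tySub_comp (eqToHom _), eqToHom_trans,
    eqToHom_refl, C.tySub_id]

/-- A lift of the reflexivity term to the context `Γ.(x : G)`. -/
noncomputable def reflLift (hF : IsTrivialFibration F) : D.Tm (D.ext G) :=
  (exists_reflLift I G hF).choose

theorem tp_reflLift (hF : IsTrivialFibration F) : D.tp (reflLift I G hF) =
    D.tySub (D.sec _ (D.q G) (D.tp_q G)) (idLift I G hF) :=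
  (exists_reflLift I G hF).choose_spec.1

theorem tm_reflLift (hF : IsTrivialFibration F) : F.tm (reflLift I G hF) =
    I.refl (F.ty (D.tySub (D.p G) G)) (F.tm (D.q G)) (tp_tm_of F (D.tp_q G)) :=
  (exists_reflLift I G hF).choose_spec.2

end

variable (hF : IsTrivialFibration F) (I : WeaklyStableId C) {Δ Γ : D.Ctx}

/-- The substitution `⟨σ, x, y⟩ : Δ ⟶ Γ.(x : G).(y : G)`. -/
def pair₂ {G : D.Ty Γ} (σ : Δ ⟶ Γ) (x y : D.Tm Δ) (hx : D.tp x = D.tySub σ G)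
    (hy : D.tp y = D.tySub σ G) : Δ ⟶ D.ext (D.tySub (D.p G) G) :=
  D.pair (D.pair σ x hx) y (by rw [hy, ← D.tySub_comp, D.pair_p])

theorem comp_pair₂ {Θ : D.Ctx} {G : D.Ty Γ} (τ : Θ ⟶ Δ) (σ : Δ ⟶ Γ) (x y : D.Tm Δ)
    (hx : D.tp x = D.tySub σ G) (hy : D.tp y = D.tySub σ G) :
    τ ≫ pair₂ σ x y hx hy = pair₂ (τ ≫ σ) (D.tmSub τ x) (D.tmSub τ y)
      (by rw [D.tp_sub, hx, D.tySub_comp]) (by rw [D.tp_sub, hy, D.tySub_comp]) := by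
  rw [pair₂, D.comp_pair]
  exact D.pair_congr (D.comp_pair _ _ _ _) rfl _ _

theorem tp_tmSub_reflLift {G : D.Ty Γ} (σ : Δ ⟶ Γ) (x : D.Tm Δ) (hx : D.tp x = D.tySub σ G) :
    D.tp (D.tmSub (D.pair σ x hx) (reflLift I G hF)) =
      D.tySub (pair₂ σ x x hx hx) (idLift I G hF) := by
  rw [D.tp_sub, tp_reflLift, ← D.tySub_comp, D.comp_sec]
  congr 1
  exact D.pair_congr rfl (D.q_pair _ _ _) _ _

/-- The image of a substituted lift is the chosen identity type of `C` at the generic point,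
reindexed along the image of `⟨σ, x⟩`. This is the shape required by `hasJ_of_eq`. -/
theorem tyExt_idLift {G : D.Ty Γ} {A : D.Ty Δ} (x : D.Tm Δ) (σ : Δ ⟶ Γ) (hA : A = D.tySub σ G)
    (hx : D.tp x = A) (hx' : D.tp (D.tmSub (D.p A) x) = D.tySub (D.p A ≫ σ) G)
    (hq : D.tp (D.q A) = D.tySub (D.p A ≫ σ) G)
    (h : C.tp (C.q (F.ty A)) = C.tySub (C.p (F.ty A) ≫ F.map (D.pair σ x (hx.trans hA)))
      (F.ty (D.tySub (D.p G) G))) :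
    tyExt F (D.tySub (pair₂ (D.p A ≫ σ) (D.tmSub (D.p A) x) (D.q A) hx' hq) (idLift I G hF)) =
      C.tySub (C.pair (C.p (F.ty A) ≫ F.map (D.pair σ x (hx.trans hA))) (C.q (F.ty A)) h)
        (I.Id (F.ty (D.tySub (D.p G) G)) (F.tm (D.q G)) (tp_tm_of F (D.tp_q G))) := by
  rw [tyExt, F.ty_sub, ty_idLift, ← C.tySub_comp, ← C.tySub_comp, Category.assoc, pair₂, map_pair,
    C.comp_pair]
  congr 1
  apply C.pair_congr
  · rw [← D.comp_pair (D.p A) σ x (hx.trans hA), F.map_comp, F.map_p, ← Category.assoc,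
      ← Category.assoc, eqToHom_trans, eqToHom_refl, Category.id_comp]
  · rw [F.tm_q, ← C.tmSub_comp, eqToHom_trans, eqToHom_refl, C.tmSub_id]

variable {I : WeaklyStableId C} {S : StableIdIntro D}

theorem tp_tm_stableRefl (F : D ⟶ C) (S : StableIdIntro D) {Γ : D.Ctx} (A : D.Ty Γ) (x : D.Tm Γ)
    (hx : D.tp x = A) : C.tp (F.tm (S.refl A x hx)) =
      C.tySub (C.sec (F.ty A) (F.tm x) (tp_tm_of F hx)) (tyExt F (S.fam A x hx)) :=
  tp_tm_refl F S.toIdIntro A x hx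

/-- The images of the lifted identity types have the elimination principle. -/
def MapsToHasJ (F : D ⟶ C) (I : WeaklyStableId C) (S : StableIdIntro D) : Prop :=
  ∀ ⦃Γ : D.Ctx⦄ (A : D.Ty Γ) (x : D.Tm Γ) (hx : D.tp x = A),
    I.HasJ (F.ty A) (F.tm x) (tp_tm_of F hx) (tyExt F (S.fam A x hx))
      (F.tm (S.refl A x hx)) (tp_tm_stableRefl F S A x hx)

/-- The image of the identity type of `D` eliminates, so a typal equality in `C` inhabits it; the
inhabitant lifts along `F`. -/
theorem exists_tm_Id (hF : IsTrivialFibration F) (hS : MapsToHasJ F I S) {A : D.Ty Γ}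
    {x y : D.Tm Γ} (hx : D.tp x = A) (hy : D.tp y = A)
    (h : I.TypalEq (F.ty A) (F.tm x) (F.tm y) (tp_tm_of F hx) (tp_tm_of F hy)) :
    ∃ e, D.tp e = S.Id A x y hx hy := by
  obtain ⟨e, he⟩ := ((hS A x hx).exists_tm_iff (tp_tm_of F hy)).2 h
  rw [map_sec_tyExt hy] at he
  obtain ⟨e', he', -⟩ := hF.tm_lift _ e he
  exact ⟨e', he'.trans (S.fam_sec A x y hx hy)⟩

/-- Eliminate in `C`, lift the resulting term to `j` of type `P`, and lift its typal computation
rule by `exists_tm_Id`. Nothing makes these choices stable under substitution. -/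
theorem exists_J (hF : IsTrivialFibration F) (hS : MapsToHasJ F I S) {A : D.Ty Γ}
    {x : D.Tm Γ} (hx : D.tp x = A)
    (P : D.Ty (D.ext (S.fam A x hx))) (d : D.Tm Γ) (hd : D.tp d = D.tySub (S.reflSec A x hx) P) :
    ∃ (j : D.Tm (D.ext (S.fam A x hx))) (hj : D.tp j = P), ∃ e, D.tp e =
      S.Id _ (D.tmSub (S.reflSec A x hx) j) d (D.tp_sub_of _ hj) hd := by
  let B := S.fam A x hx
  -- `F` preserves extensions up to equality of objects only, so `s` and `s'` translate between the
  -- image of the double extension and the double extension of the images.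
  let s : C.ext (tyExt F B) ⟶ F.obj (D.ext B) :=
    C.pair (C.p (tyExt F B) ≫ eqToHom (F.obj_ext A).symm) (C.q (tyExt F B))
      (by rw [C.tp_q, C.tySub_comp]; rfl) ≫ eqToHom (F.obj_ext B).symm
  let s' : F.obj (D.ext B) ⟶ C.ext (tyExt F B) :=
    C.pair (F.map (D.p B) ≫ eqToHom (F.obj_ext A)) (F.tm (D.q B)) (by
      rw [tp_tm_of F (D.tp_q B), F.ty_sub, tyExt, ← C.tySub_comp, Category.assoc, eqToHom_trans,
        eqToHom_refl, Category.comp_id])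
  have hs's : s' ≫ s = 𝟙 _ := by
    rw [← Category.assoc, C.comp_pair, ← cancel_mono (eqToHom (F.obj_ext B)), Category.assoc,
      eqToHom_trans, eqToHom_refl, Category.comp_id, Category.id_comp]
    apply C.ext_hom
    · rw [C.pair_p, ← Category.assoc, C.pair_p, Category.assoc, eqToHom_trans, eqToHom_refl,
        Category.comp_id, F.map_p]
    · rw [C.q_pair, C.q_pair, F.tm_q]
  have hr : F.map (S.reflSec A x hx) ≫ s' = C.pair (C.sec (F.ty A) (F.tm x) (tp_tm_of F hx))
      (F.tm (S.refl A x hx)) (tp_tm_stableRefl F S A x hx) := by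
    rw [C.comp_pair]
    apply C.pair_congr
    · rw [← Category.assoc, ← F.map_comp, StableIdIntro.reflSec, D.pair_p, map_sec, Category.assoc,
        eqToHom_trans, eqToHom_refl, Category.comp_id]
    · rw [← F.tm_sub, StableIdIntro.reflSec, D.q_pair]
  have hr' : C.pair (C.sec (F.ty A) (F.tm x) (tp_tm_of F hx))
      (F.tm (S.refl A x hx)) (tp_tm_stableRefl F S A x hx) ≫ s =
        F.map (S.reflSec A x hx) := by
    rw [← hr, Category.assoc, hs's, Category.comp_id]
  obtain ⟨j', hj', e⟩ := hS A x hx (C.tySub s (F.ty P)) (F.tm d) (by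
    rw [tp_tm_of F hd, F.ty_sub, ← C.tySub_comp, hr'])
  obtain ⟨j, hj, ej⟩ := hF.tm_lift P (C.tmSub s' j') (by
    rw [C.tp_sub, hj', ← C.tySub_comp, hs's, C.tySub_id])
  -- The computation rule in `C` has base point `d`, the one in `D` has `d` as its endpoint; hence
  -- the symmetry.
  refine ⟨j, hj, exists_tm_Id hF hS _ _
    (WeaklyStableId.typalEq_symm (I.typalEq_congr ?_ rfl ?_ _ _ e))⟩
  · rw [F.ty_sub, ← C.tySub_comp, hr']
  · rw [F.tm_sub, ej, ← C.tmSub_comp, hr]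

theorem MapsToHasJ.weaklyPreservesId (hS : MapsToHasJ F I S) :
    WeaklyPreservesId F S.toIdIntro I := fun A x hx => (hS A x hx).isEquiv_canMap

end Hom

end CwF

-- Strictly stable identity types on a syntactic CwF

namespace FreeCwF

variable {S : Sig.{u}} {W : Set S.Sym} {C : CwF.{u}} {F : D W ⟶ C}
  (hF : CwF.Hom.IsTrivialFibration F) (I : CwF.WeaklyStableId C) (hW : BoundedBy W W)

theorem tp_eq_tySub_argsTy {Γ : (D W).Ctx} {A : (D W).Ty Γ} {x : (D W).Tm Γ}
    (hx : (D W).tp x = A) (h : WCon W (S.bdTy (rt A).head)) :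
    (D W).tp x = (D W).tySub (argsTy A h) (genTy (rt_wf A).mem h) :=
  hx.trans (tySub_argsTy A h).symm

/-- Strictly stable identity types and reflexivity terms on the syntactic CwF: for a type `T(σ)`
they are instances of those for the symbol `T`. -/
noncomputable def synId : CwF.StableIdIntro (D W) where
  Id A x y hx hy := (D W).tySub (CwF.Hom.pair₂ (argsTy A (hW.ty (rt_wf A).mem)) x y
    (tp_eq_tySub_argsTy hx _) (tp_eq_tySub_argsTy hy _)) (CwF.Hom.idLift I _ hF)
  Id_sub σ A x y hx hy := by
    -- Substituting in a type keeps its head and composes its arguments, definitionally. Hence both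
    -- sides are instances of the same lift.
    rw [← (D W).tySub_comp, CwF.Hom.comp_pair₂]; rfl
  refl A x hx := (D W).tmSub ((D W).pair (argsTy A (hW.ty (rt_wf A).mem)) x
    (tp_eq_tySub_argsTy hx _)) (CwF.Hom.reflLift I _ hF)
  tp_refl A x hx := CwF.Hom.tp_tmSub_reflLift hF I _ x _
  refl_sub σ A x hx := by
    rw [← (D W).tmSub_comp, (D W).comp_pair]; rfl

/-- For `A = T(σ)`, the image of the identity family is the reindexing, along the image of `⟨σ, x⟩`,
of the identity type of `C` at the generic variable of type `T`. Weak stability provides elimination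
for precisely such reindexings. -/
theorem synId_mapsToHasJ : CwF.Hom.MapsToHasJ F I (synId hF I hW) := fun Γ A x hx => by
  have h := hW.ty (rt_wf A).mem
  have hA : F.ty A = C.tySub (F.map ((D W).pair (argsTy A h) x (tp_eq_tySub_argsTy hx h)))
      (F.ty ((D W).tySub ((D W).p (genTy (rt_wf A).mem h)) (genTy (rt_wf A).mem h))) := by
    rw [← F.ty_sub, ← (D W).tySub_comp, (D W).pair_p, tySub_argsTy]
  refine I.hasJ_of_eq
    (hx := CwF.Hom.tp_tm_of F ((D W).tp_q (genTy (rt_wf A).mem h)))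
    (F.map ((D W).pair (argsTy A h) x (tp_eq_tySub_argsTy hx h))) hA ?_ _ ?_ ?_ _
  · rw [← F.tm_sub, (D W).q_pair]
  · exact CwF.Hom.tyExt_idLift hF I x (argsTy A h) (tySub_argsTy A h).symm hx _ _ _
  · rw [← CwF.Hom.tm_reflLift I _ hF, ← F.tm_sub]; rfl

end FreeCwF

namespace FreeCwF

variable {S : Sig.{u}} {W : Set S.Sym}

/-! ### Binding the last two variables -/

/-- The raw substitution `γ⁺⁺` of contexts of length `n` and `m`, extended by two variables. -/
def liftS {G : Type u} (m n : ℕ) (γ : ℕ → RTm G) : ℕ → RTm G :=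
  Function.update (Function.update γ m (.var (.inl n))) (m + 1) (.var (.inl (n + 1)))

theorem liftS_of_lt {G : Type u} {m n i : ℕ} (γ : ℕ → RTm G) (h : i < m) :
    liftS m n γ i = γ i := by
  rw [liftS, Function.update_of_ne (by omega), Function.update_of_ne (by omega)]

@[simp] theorem liftS_self {G : Type u} {m n : ℕ} (γ : ℕ → RTm G) :
    liftS m n γ m = .var (.inl n) := by
  rw [liftS, Function.update_of_ne (by omega), Function.update_self]

@[simp] theorem liftS_succ {G : Type u} {m n : ℕ} (γ : ℕ → RTm G) :
    liftS m n γ (m + 1) = .var (.inl (n + 1)) := Function.update_self ..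

/-- The substitution that turns the variables `n` and `n + 1` into bound variables. -/
def closeS {G : Type u} (n : ℕ) : ℕ ⊕ ℕ → RTm G
  | .inl i => if i < n then .var (.inl i) else .var (.inr (i - n))
  | .inr _ => .junk

/-- The substitution that turns the bound variables into the variables `n` and `n + 1`. -/
def openS {G : Type u} (n : ℕ) : ℕ ⊕ ℕ → RTm G
  | .inl i => .var (.inl i)
  | .inr k => .var (.inl (n + k))

theorem closeS_of_lt {G : Type u} {n i : ℕ} (h : i < n) :
    (closeS n (.inl i) : RTm G) = .var (.inl i) := if_pos h

theorem closeS_add {G : Type u} (n k : ℕ) :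
    (closeS n (.inl (n + k)) : RTm G) = .var (.inr k) := by
  rw [closeS, if_neg (by omega), Nat.add_sub_cancel_left]

theorem closeS_self {G : Type u} (n : ℕ) : (closeS n (.inl n) : RTm G) = .var (.inr 0) :=
  closeS_add n 0

theorem closeS_ctxL {Γ : S.Con} (v : ℕ ⊕ ℕ) (A : S.Ty) (h : ctxL Γ v A) :
    (closeS Γ.length v : S.Tm) = .var v := by
  obtain ⟨i, rfl, h⟩ := h
  exact closeS_of_lt h.lt

theorem openS_ctxL {Γ : S.Con} (n : ℕ) (v : ℕ ⊕ ℕ) (A : S.Ty) (h : ctxL Γ v A) :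
    (openS n v : S.Tm) = .var v := by
  obtain ⟨i, rfl, h⟩ := h
  rfl

theorem WTy.sub_closeS {Γ : S.Con} {A : S.Ty} (h : WTy W (ctxL Γ) A) :
    A.sub (closeS Γ.length) = A := (h.sub_congr closeS_ctxL).trans (RTy.sub_var_id A)

theorem WTy.sub_openS {Γ : S.Con} {A : S.Ty} (h : WTy W (ctxL Γ) A) (n : ℕ) :
    A.sub (openS n) = A := (h.sub_congr (openS_ctxL n)).trans (RTy.sub_var_id A)

theorem WTy.sub_closeS_openS {Γ : S.Con} {A : S.Ty} (h : WTy W (ctxL Γ) A) (n : ℕ) :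
    (A.sub (closeS n)).sub (openS n) = A := by
  rw [RTy.sub_sub]
  refine (h.sub_congr (s' := .var) ?_).trans (RTy.sub_var_id A)
  rintro _ B ⟨i, rfl, -⟩
  by_cases hi : i < n
  · rw [closeS_of_lt hi]; rfl
  · obtain ⟨k, rfl⟩ := Nat.exists_eq_add_of_le (not_lt.1 hi)
    rw [closeS_add]; rfl

/-- Binding variables commutes with substitution. -/
theorem WTy.sub_closeS_up {Γ Δ Γ' : S.Con} {A : S.Ty} (h : WTy W (ctxL Γ') A) {γ : ℕ → S.Tm}
    (hγ : IsSub W (ctxL Δ) Γ γ) (hΓ' : Γ'.length ≤ Γ.length + 2) :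
    (A.sub (closeS Γ.length)).sub (up γ) =
      (A.sub (inst (liftS Γ.length Δ.length γ))).sub (closeS Δ.length) := by
  rw [RTy.sub_sub, RTy.sub_sub]
  refine h.sub_congr ?_
  rintro _ B ⟨i, rfl, hi⟩
  have hi := hi.lt
  rcases lt_or_ge i Γ.length with h₁ | h₁
  · obtain ⟨C, hC⟩ := Look.exists_of_lt h₁
    rw [closeS_of_lt h₁, inst_inl, liftS_of_lt _ h₁, RTm.sub_var, up_inl]
    exact (((hγ.typed i C hC).sub_congr closeS_ctxL).trans (RTm.sub_var_id _)).symm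
  · obtain rfl | rfl : i = Γ.length ∨ i = Γ.length + 1 := by omega
    · rw [closeS_self, inst_inl, liftS_self, RTm.sub_var, RTm.sub_var, closeS_self]; rfl
    · rw [closeS_add, inst_inl, liftS_succ, RTm.sub_var, RTm.sub_var, closeS_add]; rfl

/-- Releasing bound variables commutes with substitution. -/
theorem WTy.sub_openS_inst {Γ Δ Θ : S.Con} {A : S.Ty} (h : WTy W (bvL Γ Θ) A) {γ : ℕ → S.Tm}
    (hγ : IsSub W (ctxL Δ) Γ γ) (hΘ : Θ.length ≤ 2) :
    (A.sub (openS Γ.length)).sub (inst (liftS Γ.length Δ.length γ)) =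
      (A.sub (up γ)).sub (openS Δ.length) := by
  rw [RTy.sub_sub, RTy.sub_sub]
  refine h.sub_congr ?_
  rintro _ B (⟨i, rfl, hi⟩ | ⟨k, rfl, hk⟩)
  · change liftS Γ.length Δ.length γ i = (γ i).sub _
    rw [liftS_of_lt _ hi.lt]
    exact (((hγ.typed i B hi).sub_congr (openS_ctxL _)).trans (RTm.sub_var_id _)).symm
  · have hk := hk.lt
    change liftS Γ.length Δ.length γ (Γ.length + k) = .var (.inl (Δ.length + k))
    obtain rfl | rfl : k = 0 ∨ k = 1 := by omega
    · exact liftS_self γ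
    · exact liftS_succ γ

theorem liftS_comp {Γ Δ : S.Con} {γ δ : ℕ → S.Tm} (hγ : IsSub W (ctxL Δ) Γ γ) (n : ℕ) {i : ℕ}
    (hi : i < Γ.length + 2) :
    (liftS Γ.length Δ.length γ i).sub (inst (liftS Δ.length n δ)) =
      liftS Γ.length n (fun i => (γ i).sub (inst δ)) i := by
  rcases lt_or_ge i Γ.length with h₁ | h₁
  · obtain ⟨C, hC⟩ := Look.exists_of_lt h₁
    rw [liftS_of_lt _ h₁, liftS_of_lt _ h₁]
    refine (hγ.typed i C hC).sub_congr ?_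
    rintro _ B ⟨j, rfl, hj⟩
    exact liftS_of_lt _ hj.lt
  · obtain rfl | rfl : i = Γ.length ∨ i = Γ.length + 1 := by omega
    · rw [liftS_self, liftS_self]; exact liftS_self δ
    · rw [liftS_succ, liftS_succ]; exact liftS_succ δ

/-! ### Elimination data -/

variable {Q : CwF.StableIdIntro (D W)} {Δ Γ : (D W).Ctx}

theorem rh_lift (γ : Δ ⟶ Γ) (A : (D W).Ty Γ) :
    rh ((D W).lift γ A) = Function.update (rh γ) (rc Γ).length (.var (.inl (rc Δ).length)) := by
  change Function.update (fun i => (rh γ i).sub (inst (idS (rc Δ).length))) _ _ = _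
  congr 1
  funext i
  exact rh_sub_idS le_rfl γ i

theorem rh_lift₂ (γ : Δ ⟶ Γ) (A : (D W).Ty Γ) (x : (D W).Tm Γ) (hx : (D W).tp x = A) :
    rh (Q.lift₂ γ A x hx) = liftS (rc Γ).length (rc Δ).length (rh γ) := by
  rw [liftS, ← rh_lift γ A]
  change Function.update
    (fun i => (rh ((D W).lift γ A) i).sub (inst (idS ((rc Δ).length + 1)))) _ _ = _
  congr 1
  funext i
  exact rh_sub_idS le_rfl ((D W).lift γ A) i

/-- A motive for the elimination principle of identity types. -/
structure Motive (Q : CwF.StableIdIntro (D W)) (Γ : (D W).Ctx) : Type u where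
  A : (D W).Ty Γ
  x : (D W).Tm Γ
  hx : (D W).tp x = A
  P : (D W).Ty ((D W).ext (Q.fam A x hx))

namespace Motive

/-- Restriction of motives. -/
def sub (γ : Δ ⟶ Γ) (M : Motive Q Γ) : Motive Q Δ where
  A := (D W).tySub γ M.A
  x := (D W).tmSub γ M.x
  hx := (D W).tp_sub_of γ M.hx
  P := (D W).tySub (Q.lift₂ γ M.A M.x M.hx) M.P

/-- The substitution `⟨id, x, refl⟩`. -/
def reflSec (M : Motive Q Γ) : Γ ⟶ (D W).ext (Q.fam M.A M.x M.hx) := Q.reflSec M.A M.x M.hx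

/-- The type `P(x, refl)`. -/
def base (M : Motive Q Γ) : (D W).Ty Γ := (D W).tySub M.reflSec M.P

theorem base_sub (γ : Δ ⟶ Γ) (M : Motive Q Γ) : (M.sub γ).base = (D W).tySub γ M.base := by
  rw [base, base, reflSec, reflSec, ← (D W).tySub_comp, ← Q.reflSec_lift₂, (D W).tySub_comp]
  rfl

theorem eq_sub {M : Motive Q Δ} {N : Motive Q Γ} (γ : Δ ⟶ Γ)
    (hA : rt M.A = (rt N.A).sub (inst (rh γ))) (hx : rm M.x = (rm N.x).sub (inst (rh γ)))
    (hP : rt M.P = (rt N.P).sub (inst (liftS (rc Γ).length (rc Δ).length (rh γ)))) :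
    M = N.sub γ := by
  obtain ⟨A, x, hx', P⟩ := M
  obtain rfl : A = (D W).tySub γ N.A := D.ty_ext hA
  obtain rfl : x = (D W).tmSub γ N.x := D.tm_ext hx
  obtain rfl : P = (D W).tySub (Q.lift₂ γ N.A N.x N.hx) N.P := D.ty_ext (by
    rw [rt_tySub, rh_lift₂]; exact hP)
  rfl

theorem rt_P_sub (γ : Δ ⟶ Γ) (M : Motive Q Γ) : rt (M.sub γ).P =
    (rt M.P).sub (inst (liftS (rc Γ).length (rc Δ).length (rh γ))) := by
  rw [← rh_lift₂ (Q := Q) γ M.A M.x M.hx]; rfl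

/-- The motive with its last two variables bound. -/
def closed (M : Motive Q Γ) : S.Ty := (rt M.P).sub (closeS (rc Γ).length)

/-- With its last two variables bound, a motive restricts along `γ` itself and not along `γ⁺⁺`.
Motives thus form natural families over the same diagram of contexts as `A`, `x` and `d`. -/
theorem closed_sub (γ : Δ ⟶ Γ) (M : Motive Q Γ) : (M.sub γ).closed = M.closed.sub (up (rh γ)) := by
  rw [closed, rt_P_sub]
  exact ((rt_wf M.P).sub_closeS_up (rh_wf γ) le_rfl).symm

end Motive

/-- The types of the bound variables of a motive. -/
def bvs (Q : CwF.StableIdIntro (D W)) (A : (D W).Ty Γ) (x : (D W).Tm Γ) (hx : (D W).tp x = A) :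
    S.Con := [(rt (Q.fam A x hx)).sub (closeS (rc Γ).length), rt A]

theorem bvs_sub (γ : Δ ⟶ Γ) (A : (D W).Ty Γ) (x : (D W).Tm Γ) (hx : (D W).tp x = A) :
    bvs Q ((D W).tySub γ A) ((D W).tmSub γ x) ((D W).tp_sub_of γ hx) =
      (bvs Q A x hx).map (RTy.sub (up (rh γ))) := by
  rw [bvs, bvs, ← Q.fam_sub, List.map_cons, List.map_cons, List.map_nil, (rt_wf A).sub_up_eq,
    (rt_wf (Q.fam A x hx)).sub_closeS_up (rh_wf γ) (Nat.le_succ _), rt_tySub, rh_lift]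
  congr 2
  refine (rt_wf (Q.fam A x hx)).sub_congr ?_
  rintro _ B ⟨i, rfl, hi⟩
  have hi := hi.lt
  rw [rc_ext, List.length_cons] at hi
  rw [inst_inl, inst_inl, liftS, Function.update_of_ne (by omega : i ≠ (rc Γ).length + 1)]

theorem Motive.closed_wf (M : Motive Q Γ) :
    WTy W (bvL (rc Γ) (bvs Q M.A M.x M.hx)) M.closed := by
  refine (rt_wf M.P).sub ?_ subset_rfl
  rintro _ B ⟨i, rfl, h | h | h⟩
  · obtain ⟨rfl, rfl⟩ := h
    exact (congrArg (HasTy W _ · _) (closeS_add (rc Γ).length 1)).mpr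
      (.var (.inr ⟨1, rfl, Look.here⟩))
  · obtain ⟨rfl, rfl⟩ := h
    change HasTy W _ (closeS (rc Γ).length (.inl (rc Γ).length))
      ((rt M.A).sub (closeS (rc Γ).length))
    rw [closeS_self, (rt_wf M.A).sub_closeS]
    exact .var (.inr ⟨0, rfl, Look.here.there⟩)
  · have h : Look (rc Γ) i B := h
    rw [closeS_of_lt h.lt, ((rc_wf Γ).look h).sub_closeS]
    exact .var (.inl ⟨i, rfl, h⟩)

theorem open_wf {A : (D W).Ty Γ} {x : (D W).Tm Γ} {hx : (D W).tp x = A} {R : S.Ty}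
    (h : WTy W (bvL (rc Γ) (bvs Q A x hx)) R) :
    WTy W (ctxL (rc ((D W).ext (Q.fam A x hx)))) (R.sub (openS (rc Γ).length)) := by
  refine h.sub ?_ subset_rfl
  rintro _ B (⟨i, rfl, h⟩ | ⟨k, rfl, h | h | h⟩)
  · rw [((rc_wf Γ).look h).sub_openS]
    exact .var ⟨i, rfl, h.there.there⟩
  · obtain ⟨rfl, rfl⟩ := h
    rw [(rt_wf (Q.fam A x hx)).sub_closeS_openS]
    exact .var ⟨_, rfl, Look.here⟩
  · obtain ⟨rfl, rfl⟩ := h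
    rw [(rt_wf A).sub_openS]
    exact .var ⟨_, rfl, Look.here.there⟩
  · exact h.elim

end FreeCwF

-- Generic elimination data

namespace FreeCwF

variable {S : Sig.{u}} {W : Set S.Sym}

theorem WTy.scoped_ctxL {Γ : S.Con} {A : S.Ty} (h : WTy W (ctxL Γ) A) : TyScoped Γ.length A :=
  (h.mono subset_rfl (bvL_of_ctxL (Θ := []))).scoped

theorem TyScoped.sub_up_idS {n : ℕ} {A : S.Ty} (h : TyScoped n A) : A.sub (up (idS n)) = A := by
  rw [h.sub_congr (γ' := fun i => .var (.inl i)) fun i hi => idS_of_lt hi]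
  have e : (up fun i => .var (.inl i) : ℕ ⊕ ℕ → S.Tm) = .var := by
    funext v; cases v <;> rfl
  rw [e, RTy.sub_var_id]

namespace Diagram

variable {X : Diagram W}

/-- A natural family of types with bound variables can be amalgamated. -/
theorem Cone.amal_ty (hW : BoundedBy W W)
    (hacc : ∀ Γ t A, WCon W Γ → HasTy W (ctxL Γ) t A → TAcc W Γ t) (k₀ : X.K) {Θ : S.Con}
    {B : X.K → S.Ty} (hB : ∀ k l δ, X.arr k l δ → (B l).sub (up δ) = B k) (c : X.Cone)
    (hΘ : ∀ b A, Look Θ b A → TyScoped c.apex.length A)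
    (h : ∀ k, WTy W (bvL (X.ctx k) (c.bd Θ k)) (B k)) :
    ∃ c' : X.Cone, c.Le c' ∧ ∃ B', WTy W (bvL c'.apex Θ) B' ∧
      ∀ k, B'.sub (up (c'.leg k)) = B k := by
  have hh (k : X.K) : (B k).head = (B k₀).head := by
    refine X.connected (fun k => (B k).head = (B k₀).head) (fun k l δ hδ => ?_) k₀ k rfl
    rw [← hB k l δ hδ]; rfl
  have hs (k : X.K) : IsSub W (bvL (X.ctx k) (c.bd Θ k)) (S.bdTy (B k₀).head) (B k).args := by
    rw [← hh k]; exact (h k).args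
  obtain ⟨c', hc, σ', hσ', e⟩ := c.amal_isSub k₀ hΘ hs (fun i hi c' hc => by
    obtain ⟨A, hA⟩ := Look.exists_of_lt hi
    refine Cone.amal hW hacc k₀ (fun k l δ hδ => congrFun (congrArg RTy.args (hB k l δ hδ)) i) c'
      (tyScoped_mono hc hΘ) fun k => ?_
    rw [hc.bd hΘ]
    exact ⟨_, (hs k).typed i A hA⟩)
  refine ⟨c', hc, ⟨(B k₀).head, σ'⟩, ⟨(h k₀).mem, hσ'⟩, fun k => ?_⟩
  ext1
  · exact (hh k).symm
  · funext i; exact e k i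

theorem Cone.Le.ctxL {c c' : X.Cone} (h : c.Le c') (v : ℕ ⊕ ℕ) (A : S.Ty)
    (hv : FreeCwF.ctxL c.apex v A) : FreeCwF.ctxL c'.apex v A := by
  obtain ⟨i, rfl, hA⟩ := hv
  exact ⟨i, rfl, h.look i A hA⟩

/-- A natural family of terms without bound variables can be amalgamated. -/
theorem Cone.amal_tm (hW : BoundedBy W W)
    (hacc : ∀ Γ t A, WCon W Γ → HasTy W (ctxL Γ) t A → TAcc W Γ t) (k₀ : X.K)
    {t : X.K → S.Tm} (ht : X.Natural t) (c : X.Cone)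
    (h : ∀ k, ∃ B, HasTy W (ctxL (X.ctx k)) (t k) B) :
    ∃ c' : X.Cone, c.Le c' ∧ ∃ t' A', HasTy W (ctxL c'.apex) t' A' ∧
      ∀ k, t'.sub (up (c'.leg k)) = t k := by
  obtain ⟨c', hc, t', A', h', e⟩ := Cone.amal hW hacc k₀ (Θ := []) ht c (fun _ _ h => h.elim)
    (fun k => (h k).imp fun B hB => hB.to_bvL)
  rw [bvL_nil] at h'
  exact ⟨c', hc, t', A', h', e⟩

theorem Cone.le_sub {c c' : X.Cone} (h : c.Le c') {t : S.Tm} {A : S.Ty}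
    (ht : HasTy W (FreeCwF.ctxL c.apex) t A) (k : X.K) :
    t.sub (up (c'.leg k)) = t.sub (up (c.leg k)) :=
  ht.to_bvL (Θ := []) |>.scoped.sub_congr (h.leg k)

theorem Cone.le_tySub {c c' : X.Cone} (h : c.Le c') {A : S.Ty}
    (hA : WTy W (FreeCwF.ctxL c.apex) A) (k : X.K) :
    A.sub (up (c'.leg k)) = A.sub (up (c.leg k)) :=
  hA.scoped_ctxL.sub_congr (h.leg k)

theorem Cone.tySub_unique (hW : BoundedBy W W) {c : X.Cone} {t t' : S.Tm} {A B : S.Ty}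
    (h : HasTy W (FreeCwF.ctxL c.apex) t A) (k : X.K) (e : t.sub (up (c.leg k)) = t')
    (h' : HasTy W (FreeCwF.ctxL (X.ctx k)) t' B) : A.sub (up (c.leg k)) = B := by
  have h₁ := h.sub (c.isSub k).ctxL subset_rfl
  rw [← h.sub_up_eq, e, ← (h.wty hW c.wf).sub_up_eq] at h₁
  exact h₁.unique ctxL_unique h'

end Diagram

variable {Q : CwF.StableIdIntro (D W)} {Δ Γ : (D W).Ctx}

theorem tyScoped_bvs (A : (D W).Ty Γ) (x : (D W).Tm Γ) (hx : (D W).tp x = A) (b : ℕ) (B : S.Ty)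
    (h : Look (bvs Q A x hx) b B) : TyScoped (rc Γ).length B := by
  rcases h with ⟨-, rfl⟩ | ⟨-, rfl⟩ | h
  · refine fun i => Scoped.sub (fun v => ?_) _
    match v with
    | .inl j =>
      rw [closeS]
      split_ifs with hj
      · exact hj
      · trivial
    | .inr _ => trivial
  · exact (rt_wf A).scoped_ctxL
  · exact h.elim

theorem bvs_congr {A A' : (D W).Ty Γ} {x x' : (D W).Tm Γ} (hA : A = A') (hx : x = x')
    (h : (D W).tp x = A) (h' : (D W).tp x' = A') : bvs Q A x h = bvs Q A' x' h' := by
  subst hA hx; rfl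

/-- Data for the elimination principle of identity types. -/
structure Elim (Q : CwF.StableIdIntro (D W)) (Γ : (D W).Ctx) : Type u extends Motive Q Γ where
  d : (D W).Tm Γ
  hd : (D W).tp d = toMotive.base

namespace Elim

/-- Restriction of elimination data. -/
def sub (γ : Δ ⟶ Γ) (M : Elim Q Γ) : Elim Q Δ where
  toMotive := M.toMotive.sub γ
  d := (D W).tmSub γ M.d
  hd := by rw [(D W).tp_sub, M.hd, Motive.base_sub]

theorem eq_sub {M : Elim Q Δ} {N : Elim Q Γ} (γ : Δ ⟶ Γ)
    (h : M.toMotive = N.toMotive.sub γ) (hd : rm M.d = (rm N.d).sub (inst (rh γ))) :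
    M = N.sub γ := by
  obtain ⟨M, d, hd'⟩ := M
  obtain rfl : M = N.toMotive.sub γ := h
  obtain rfl : d = (D W).tmSub γ N.d := D.tm_ext hd
  rfl

/-- The relation of restriction. -/
def Rel (M N : Σ Γ, Elim Q Γ) : Prop := ∃ δ : M.1 ⟶ N.1, M.2 = N.2.sub δ

/-- The diagram of a connected component of the category of elimination data. -/
def diagram (c : Quot (Rel (Q := Q))) : Diagram W where
  K := {M : Σ Γ, Elim Q Γ // Quot.mk Rel M = c}
  ctx M := rc M.1.1
  wf M := rc_wf M.1.1
  arr M N δ := ∃ δ' : M.1.1 ⟶ N.1.1, rh δ' = δ ∧ M.1.2 = N.1.2.sub δ'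
  arr_sub := by
    rintro M N _ ⟨δ, rfl, -⟩
    exact rh_wf δ
  connected P hP := by
    -- The predicate `P` is invariant under arrows, so it descends to the quotient, in which all
    -- objects of the diagram have the same class `c`.
    let f : Quot (Rel (Q := Q)) → Prop :=
      Quot.lift (fun M => ∃ h : Quot.mk Rel M = c, P ⟨M, h⟩) (fun M N h => by
        have e : Quot.mk Rel M = Quot.mk Rel N := Quot.sound h
        obtain ⟨δ, hδ⟩ := h
        refine propext ⟨?_, ?_⟩
        · rintro ⟨h, hM⟩
          exact ⟨e.symm.trans h, (hP ⟨M, h⟩ ⟨N, _⟩ _ ⟨δ, rfl, hδ⟩).1 hM⟩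
        · rintro ⟨h, hM⟩
          exact ⟨e.trans h, (hP ⟨M, _⟩ ⟨N, h⟩ _ ⟨δ, rfl, hδ⟩).2 hM⟩)
    intro M N hM
    have h : f (Quot.mk Rel M.1) := ⟨M.2, hM⟩
    rw [M.2, ← N.2] at h
    exact h.2

/-- Elimination data in a connected component are restrictions of generic elimination data. -/
structure Generic (c : Quot (Rel (Q := Q))) where
  Γ : (D W).Ctx
  elim : Elim Q Γ
  leg : ∀ M : (diagram c).K, M.1.1 ⟶ Γ
  eq_sub : ∀ M, M.1.2 = elim.sub (leg M)
  nat : ∀ (M N : (diagram c).K) (δ : M.1.1 ⟶ N.1.1), M.1.2 = N.1.2.sub δ → leg M = δ ≫ leg N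

/-- Starting from the empty cone, amalgamate `A`, `x` and `d`, and then `P`, whose bound variables
are typed by the amalgamated `A` and `x`. Typing relations between the amalgams hold because they
hold after every restriction, and restrictions are jointly faithful. -/
theorem exists_generic (hW : BoundedBy W W)
    (hacc : ∀ Γ t A, WCon W Γ → HasTy W (ctxL Γ) t A → TAcc W Γ t) (c : Quot (Rel (Q := Q))) :
    Nonempty (Generic c) := by
  obtain ⟨k₀⟩ : Nonempty (diagram c).K := by
    obtain ⟨M, rfl⟩ := Quot.exists_rep c
    exact ⟨⟨M, rfl⟩⟩
  obtain ⟨c₁, -, A, hA, eA⟩ := (Diagram.Cone.empty (diagram c)).amal_ty hW hacc k₀ (Θ := [])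
    (B := fun M => rt M.1.2.A) (by
      rintro M N _ ⟨δ, rfl, e⟩
      rw [e, (rt_wf N.1.2.A).sub_up_eq]; rfl)
    (fun _ _ h => h.elim) (fun M => (rt_wf M.1.2.A).mono subset_rfl bvL_of_ctxL)
  rw [bvL_nil] at hA
  obtain ⟨c₂, h₂, x, A₂, hx, ex⟩ := c₁.amal_tm hW hacc k₀ (t := fun M => rm M.1.2.x) (by
      rintro M N _ ⟨δ, rfl, e⟩
      simp only
      rw [e, (rm_wf N.1.2.x).sub_up_eq]; rfl)
    (fun M => ⟨_, rm_wf M.1.2.x⟩)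
  -- Both the type found for `x` and the amalgam of the types restrict to the given type at each
  -- object.
  obtain rfl : A₂ = A := by
    refine c₂.ty_ext (hx.wty hW c₂.wf).scoped_ctxL
      (hA.mono subset_rfl h₂.ctxL).scoped_ctxL (fun M => ?_) k₀
    rw [Diagram.Cone.le_tySub h₂ hA, eA]
    refine (Diagram.Cone.tySub_unique hW hx M ?_ (rm_wf M.1.2.x)).trans (congrArg rt M.1.2.hx)
    exact ex M
  obtain ⟨c₃, h₃, d, B, hd, ed⟩ := c₂.amal_tm hW hacc k₀ (t := fun M => rm M.1.2.d) (by
      rintro M N _ ⟨δ, rfl, e⟩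
      simp only
      rw [e, (rm_wf N.1.2.d).sub_up_eq]; rfl)
    (fun M => ⟨_, rm_wf M.1.2.d⟩)
  let A₃ : (D W).Ty (mkC c₃.apex c₃.wf) := mkT A₂ (hA.mono subset_rfl (h₂.trans h₃).ctxL)
  let x₃ : (D W).Tm (mkC c₃.apex c₃.wf) := mkM x A₃ (hx.mono subset_rfl h₃.ctxL)
  have hΘ := tyScoped_bvs (Q := Q) A₃ x₃ rfl
  obtain ⟨c₄, h₄, P, hP, eP⟩ := c₃.amal_ty hW hacc k₀ (Θ := bvs Q A₃ x₃ rfl)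
    (B := fun M => M.1.2.closed) (by
      rintro M N _ ⟨δ, rfl, e⟩
      rw [e]
      exact (N.1.2.toMotive.closed_sub δ).symm)
    hΘ (fun M => by
      let γ : M.1.1 ⟶ mkC c₃.apex c₃.wf := mkH (c₃.leg M) (c₃.isSub M)
      have e : c₃.bd (bvs Q A₃ x₃ rfl) M = bvs Q M.1.2.A M.1.2.x M.1.2.hx := by
        refine (bvs_sub γ A₃ x₃ rfl).symm.trans (bvs_congr (D.ty_ext ?_) (D.tm_ext ?_) _ _)
        · refine Eq.trans ?_ ((Diagram.Cone.le_tySub (h₂.trans h₃) hA M).trans (eA M))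
          exact ((rt_wf A₃).sub_up_eq _).symm
        · refine Eq.trans ?_ ((Diagram.Cone.le_sub h₃ hx M).trans (ex M))
          exact ((rm_wf x₃).sub_up_eq _).symm
      rw [e]
      exact M.1.2.closed_wf)
  let A₄ : (D W).Ty (mkC c₄.apex c₄.wf) := mkT A₂ ((rt_wf A₃).mono subset_rfl h₄.ctxL)
  let x₄ : (D W).Tm (mkC c₄.apex c₄.wf) := mkM x A₄ ((rm_wf x₃).mono subset_rfl h₄.ctxL)
  let d₄ : (D W).Tm (mkC c₄.apex c₄.wf) := mkM d
    (mkT B ((hd.wty hW c₃.wf).mono subset_rfl h₄.ctxL)) (hd.mono subset_rfl h₄.ctxL)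
  let γ (M : (diagram c).K) : M.1.1 ⟶ mkC c₄.apex c₄.wf := mkH (c₄.leg M) (c₄.isSub M)
  -- The two sides bind variables lying beyond apexes of different lengths. The weakening `ω`
  -- relates them and fixes the bound types, which are scoped in the smaller apex.
  have hbv : bvs Q A₄ x₄ rfl = bvs Q A₃ x₃ rfl := by
    let ω : mkC c₄.apex c₄.wf ⟶ mkC c₃.apex c₃.wf := mkH (idS c₃.apex.length)
      (c₃.wf.isSub_idS h₄.look)
    refine (bvs_congr (D.ty_ext ((rt_wf A₃).sub_idS le_rfl).symm)
      (D.tm_ext ((rm_wf x₃).sub_idS le_rfl).symm) _ _).trans ((bvs_sub ω A₃ x₃ rfl).trans ?_)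
    refine Look.list_ext (List.length_map _) fun i B hB => ?_
    obtain ⟨B, hB', rfl⟩ := Look.map_iff.1 hB
    have := (hΘ i B hB').sub_up_idS
    exact this.symm ▸ hB'
  let N : Motive Q (mkC c₄.apex c₄.wf) := ⟨A₄, x₄, rfl, mkT (P.sub (openS c₄.apex.length))
    (open_wf (hbv.symm ▸ hP))⟩
  have hN (M : (diagram c).K) : M.1.2.toMotive = N.sub (γ M) := by
    refine Motive.eq_sub (γ M) ?_ ?_ ?_
    · refine ((Diagram.Cone.le_tySub (h₂.trans (h₃.trans h₄)) hA M).trans (eA M)).symm.trans ?_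
      exact (rt_wf A₄).sub_up_eq _
    · refine ((Diagram.Cone.le_sub (h₃.trans h₄) hx M).trans (ex M)).symm.trans ?_
      exact (rm_wf x₄).sub_up_eq _
    · refine Eq.trans ?_ (hP.sub_openS_inst (c₄.isSub M) le_rfl).symm
      rw [eP]
      exact ((rt_wf M.1.2.P).sub_closeS_openS _).symm
  have hed (M : (diagram c).K) : d.sub (up (c₄.leg M)) = rm M.1.2.d :=
    (Diagram.Cone.le_sub h₄ hd M).trans (ed M)
  -- `d` and `P` were amalgamated independently; their types match over the apex because they match
  -- at every object.
  have hd₄ : (D W).tp d₄ = N.base := D.ty_ext <| by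
    refine c₄.ty_ext (rt_wf ((D W).tp d₄)).scoped_ctxL (rt_wf N.base).scoped_ctxL (fun M => ?_) k₀
    refine (Diagram.Cone.tySub_unique hW (rm_wf d₄) M (hed M) (rm_wf M.1.2.d)).trans ?_
    rw [M.1.2.hd, hN, Motive.base_sub]
    exact ((rt_wf N.base).sub_up_eq _).symm
  refine ⟨mkC c₄.apex c₄.wf, ⟨N, d₄, hd₄⟩, γ, fun M => Elim.eq_sub (γ M) (hN M) ?_,
    fun M M' δ e => D.hom_ext fun i hi => ?_⟩
  · exact (hed M).symm.trans ((rm_wf d₄).sub_up_eq _)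
  · obtain ⟨A, hA⟩ := Look.exists_of_lt hi
    refine (c₄.nat i M M' (rh δ) ⟨δ, rfl, e⟩).symm.trans ?_
    exact ((c₄.isSub M').typed i A hA).sub_up_eq _

end Elim

end FreeCwF

namespace FreeCwF

variable {S : Sig.{u}} {W : Set S.Sym} {Q : CwF.StableIdIntro (D W)} {Δ Γ : (D W).Ctx}

/-! ### The stable eliminator -/

namespace Elim

/-- A solution of elimination data: the eliminator and its computation rule. -/
structure Sol (M : Elim Q Γ) where
  j : (D W).Tm ((D W).ext (Q.fam M.A M.x M.hx))
  tp_j : (D W).tp j = M.P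
  β : (D W).Tm Γ
  tp_β : (D W).tp β =
    Q.Id M.base ((D W).tmSub M.reflSec j) M.d ((D W).tp_sub_of _ tp_j) M.hd

/-- Restriction of solutions. -/
def Sol.sub {M : Elim Q Γ} (s : Sol M) (γ : Δ ⟶ Γ) : Sol (M.sub γ) where
  j := (D W).tmSub (Q.lift₂ γ M.A M.x M.hx) s.j
  tp_j := (D W).tp_sub_of _ s.tp_j
  β := (D W).tmSub γ s.β
  tp_β := by
    refine ((D W).tp_sub γ s.β).trans ((congrArg _ s.tp_β).trans ((Q.Id_sub γ _ _ _ _ _).trans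
      (Q.Id_congr _ _ _ _ (Motive.base_sub γ M.toMotive).symm ?_ rfl)))
    rw [← (D W).tmSub_comp]
    refine Eq.trans ?_ ((D W).tmSub_comp _ _ _)
    exact congrArg (fun f => (D W).tmSub f s.j) (Q.reflSec_lift₂ γ M.A M.x M.hx).symm

/-- Recording only the raw terms avoids transporting solutions along `M = N.sub γ`. -/
theorem exists_sol_of_eq {M : Elim Q Δ} {N : Elim Q Γ} {γ : Δ ⟶ Γ} (h : M = N.sub γ) (s : Sol N) :
    ∃ t : Sol M, rm t.j = (rm s.j).sub (inst (liftS (rc Γ).length (rc Δ).length (rh γ))) ∧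
      rm t.β = (rm s.β).sub (inst (rh γ)) := by
  subst h
  refine ⟨s.sub γ, ?_, rfl⟩
  rw [← rh_lift₂ (Q := Q) γ N.A N.x N.hx]; rfl

/-- If all elimination data have solutions and generic contexts exist, then there is a choice of
solutions that is stable under substitution. -/
theorem exists_stable_sol (hg : ∀ c : Quot (Rel (Q := Q)), Nonempty (Generic c))
    (hs : ∀ {Γ : (D W).Ctx} (M : Elim Q Γ), Nonempty (Sol M)) :
    ∃ s : ∀ {Γ : (D W).Ctx} (M : Elim Q Γ), Sol M,
      ∀ {Δ Γ : (D W).Ctx} (γ : Δ ⟶ Γ) (M : Elim Q Γ),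
        (D W).tmSub (Q.lift₂ γ M.A M.x M.hx) (s M).j = (s (M.sub γ)).j ∧
          (D W).tmSub γ (s M).β = (s (M.sub γ)).β := by
  let g (c : Quot (Rel (Q := Q))) : Generic c := (hg c).some
  -- One solution is chosen per connected component, at its generic datum; all others are
  -- restrictions of it.
  let sg (c : Quot (Rel (Q := Q))) : Sol (g c).elim := (hs (g c).elim).some
  have key (M : Σ Γ, Elim Q Γ) := exists_sol_of_eq ((g (Quot.mk Rel M)).eq_sub ⟨M, rfl⟩) (sg _)
  choose s hj hβ using key
  -- The components of `M` and `M.sub γ` are equal but not definitionally so; the formula is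
  -- therefore stated for any `c` equal to the component.
  replace hj (M : Σ Γ, Elim Q Γ) (c : Quot (Rel (Q := Q))) (h : Quot.mk Rel M = c) :
      rm (s M).j = (rm (sg c).j).sub (inst (liftS (rc (g c).Γ).length (rc M.1).length
        (rh ((g c).leg ⟨M, h⟩)))) := by
    subst h; exact hj M
  replace hβ (M : Σ Γ, Elim Q Γ) (c : Quot (Rel (Q := Q))) (h : Quot.mk Rel M = c) :
      rm (s M).β = (rm (sg c).β).sub (inst (rh ((g c).leg ⟨M, h⟩))) := by
    subst h; exact hβ M
  refine ⟨fun M => s ⟨_, M⟩, fun {Δ Γ} γ M => ?_⟩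
  have hc : Quot.mk Rel ⟨Δ, M.sub γ⟩ = Quot.mk (Rel (Q := Q)) ⟨Γ, M⟩ := Quot.sound ⟨γ, rfl⟩
  -- Naturality of the legs turns the leg of `M.sub γ` into `γ` followed by the leg of `M`.
  -- Restricting the generic solution in one step or in two then gives the same result.
  have hleg := (g _).nat ⟨⟨Δ, M.sub γ⟩, hc⟩ ⟨⟨Γ, M⟩, rfl⟩ γ rfl
  refine ⟨D.tm_ext ?_, D.tm_ext ?_⟩
  · refine Eq.trans ?_ (hj ⟨Δ, M.sub γ⟩ _ hc).symm
    rw [rm_tmSub, rh_lift₂, hj ⟨Γ, M⟩ _ rfl, sub_inst_sub, hleg]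
    refine (rm_wf (sg (Quot.mk Rel ⟨Γ, M⟩)).j).sub_congr ?_
    rintro _ B ⟨i, rfl, hi⟩
    exact liftS_comp (rh_wf _) _ hi.lt
  · refine Eq.trans ?_ (hβ ⟨Δ, M.sub γ⟩ _ hc).symm
    rw [rm_tmSub, hβ ⟨Γ, M⟩ _ rfl, sub_inst_sub, hleg]
    rfl

end Elim

/-- Strictly stable weak identity types from a stable choice of solutions. -/
def stableIdOfSol (s : ∀ {Γ : (D W).Ctx} (M : Elim Q Γ), M.Sol)
    (hs : ∀ {Δ Γ : (D W).Ctx} (γ : Δ ⟶ Γ) (M : Elim Q Γ),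
      (D W).tmSub (Q.lift₂ γ M.A M.x M.hx) (s M).j = (s (M.sub γ)).j ∧
        (D W).tmSub γ (s M).β = (s (M.sub γ)).β) : CwF.StableId (D W) where
  toStableIdIntro := Q
  J A x hx P d hd := (s ⟨⟨A, x, hx, P⟩, d, hd⟩).j
  tp_J A x hx P d hd := (s ⟨⟨A, x, hx, P⟩, d, hd⟩).tp_j
  J_sub σ A x hx P d hd := (hs σ ⟨⟨A, x, hx, P⟩, d, hd⟩).1
  Jβ A x hx P d hd := (s ⟨⟨A, x, hx, P⟩, d, hd⟩).β
  tp_Jβ A x hx P d hd := (s ⟨⟨A, x, hx, P⟩, d, hd⟩).tp_β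
  Jβ_sub σ A x hx P d hd := (hs σ ⟨⟨A, x, hx, P⟩, d, hd⟩).2

end FreeCwF

-- The strictification theorem

theorem theorem3 (C : CwF.{u}) (I : CwF.WeaklyStableId C) :
    ∃ (D : CwF.{u}) (S : CwF.StableId D) (F : D ⟶ C),
      CwF.IsCellular D ∧ CwF.Hom.IsTrivialFibration F ∧
        CwF.Hom.WeaklyPreservesId F S.toIdIntro I := by
  have hW := FreeCwF.boundedBy_allGens C
  have hF := FreeCwF.proj_isTrivialFibration C
  have hJ := FreeCwF.synId_mapsToHasJ hF I hW
  obtain ⟨s, hs⟩ := FreeCwF.Elim.exists_stable_sol (Q := FreeCwF.synId hF I hW)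
    (FreeCwF.Elim.exists_generic hW fun Γ t A hΓ ht => ht.tAcc (FreeCwF.stage_isChain C) hΓ)
    (fun {Γ} M => by
      obtain ⟨j, hj, e, he⟩ := CwF.Hom.exists_J hF hJ M.hx M.P M.d M.hd
      exact ⟨j, hj, e, he⟩)
  exact ⟨FreeCwF.Repl C, FreeCwF.stableIdOfSol s hs, FreeCwF.proj C, FreeCwF.isCellular_repl C, hF,
    hJ.weaklyPreservesId⟩
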